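/- Let $0<q<1$, $p=1-q$, $Q=1/q$, $L=\log Q$, and let $r\ge 1$ be an integer. Let $a_1\dots a_n$ be a word of independent letters with $\mathbb P\{a_i=k\}=pq^{k-1}$, $k\ge1$. A left-to-right maximum is a letter strictly larger than all letters to its left; counting from the right, the last one is the instance $r=1$. Let $E^{(r)}_n$ be the expected number of letters to the left of the $r$th left-to-right maximum from the right (one less than its position), where words with fewer than $r$ left-to-right maxima contribute $0$. Put $$\tau(z,m)=\Big(-\frac{q^{m+2}}{p^2}+\frac{q^{m+1}}{p}(z-m-1)+\frac{q^2}{p^2}\Big)\frac1{Q^{z-1}-1}+\Big(\frac{q^{m+2}}{p^2}-\frac{q^{m+1}}{p}(z-m-1)-\frac{q}{p^2}\Big)\frac1{Q^{z}-1},$$ and, for integers $k\ge2$, $$\psi_r(k)=\sum_{0<l_1<\dots<l_{r-1}<k-1}\frac1{Q^{l_1}-1}\cdots\frac1{Q^{l_{r-1}}-1}\,\tau(k,l_{r-1})\qquad(\psi_1(k)=\tau(k,0)).$$ Extend this to complex $z$ by $\psi_1(z)=\tau(z,0)$ and, for $r\ge2$, $$\psi_r(z)=\sum_{l\ge1}g_{r-2}(l)\frac{\tau(z,l)}{Q^l-1}-\sum_{l\ge1}g_{r-2}(l+z-1)\frac{\tau(z,l+z-1)}{Q^{l+z-1}-1},$$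 where $g_0=1$, $s\,g_s(z)=\sum_{m=1}^{s}(-1)^{m-1}g_{s-m}(z)P_m(z)$ and $P_m(z)=\sum_{i\ge1}\big((Q^i-1)^{-m}-(Q^{i+z-1}-1)^{-m}\big)$ (so that $g_s(l)=\sum_{1\le i_1<\dots<i_s<l}\prod_j (Q^{i_j}-1)^{-1}$ for integers $l\ge1$). **Theorem.** The function $\psi_r(z)$ is analytic for $\Re z>1$ and agrees with the nested sum at all integers $k\ge2$; the limit $\psi_r(1):=\lim_{z\to1}\psi_r(z)$ exists and is real; and, as $n\to\infty$ for fixed $q$ and $r$, $$E^{(r)}_n=(-1)^{r-1}\Big(\frac pq\Big)^{r}\psi_r(1)\,n+n\,\varpi_r(\log_Q n)+o(n),$$ where $\varpi_r:\mathbb R\to\mathbb R$ is continuous with period $1$ and originates from the poles $z_k=1+2k\pi i/L$, $k\in\mathbb Z\setminus\{0\}$, at which $\psi_r$ has the residues $\rho_k=\lim_{z\to z_k}(z-z_k)\psi_r(z)$: $$\varpi_r(x)=(-1)^{r-1}\Big(\frac pq\Big)^{r}\sum_{k\ne0}\rho_k\,\Gamma(-z_k)\,e^{2k\pi i x}.$$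 In the limit $q\to1^-$: the constant $(-1)^{r-1}(p/q)^r\psi_r(1)$ tends to $2^{-r}$; $\varpi_r\to0$ uniformly on $\mathbb R$; and for each fixed $n$, $E^{(r)}_n$ tends to the corresponding expectation $\widehat E^{(r)}_n$ for a uniformly random permutation of $n$ elements. For permutations, $$\widehat E^{(r)}_n=\frac n{2^r}+o(n),$$ and more precisely $\widehat E^{(r)}_n+1=\frac{n+1}{2^r}+o(1)$, with the exact equality $\widehat E^{(1)}_n+1=\frac{n+1}2$ for $r=1$ and all $n\ge1$. -/

import Mathlib

open MeasureTheory Filter Topology Asymptotics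

noncomputable section

namespace GeomWords

/-- The geometric law on the letters `1, 2, 3, …`: the letter `k` has probability `p q^(k-1)`,
where `p = 1 - q`. -/
def letterLaw (q : ℝ) : Measure ℕ :=
  Measure.sum fun k : ℕ => ENNReal.ofReal ((1 - q) * q ^ k) • Measure.dirac (k + 1)

/-- The law of a word of `n` independent geometric letters. -/
def wordLaw (q : ℝ) (n : ℕ) : Measure (Fin n → ℕ) :=
  Measure.pi fun _ : Fin n => letterLaw q

/-- `i` is a (strict) left-to-right maximum of the word `w`. -/
def IsLTRMax {α : Type*} [LT α] {n : ℕ} (w : Fin n → α) (i : Fin n) : Prop :=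
  ∀ j : Fin n, j < i → w j < w i

open Classical in
/-- `i` is the `r`th left-to-right maximum of `w` counted from the right: it is a left-to-right
maximum, and exactly `r` left-to-right maxima are at positions `≥ i`. -/
def IsRthFromRight {α : Type*} [LT α] {n : ℕ} (r : ℕ) (w : Fin n → α) (i : Fin n) : Prop :=
  IsLTRMax w i ∧ (Finset.univ.filter fun j : Fin n => i ≤ j ∧ IsLTRMax w j).card = r

open Classical in
/-- The number of letters to the left of the `r`th left-to-right maximum from the right
(the sum has at most one term); it is `0` if there are fewer than `r` left-to-right maxima. -/
def lettersLeft {α : Type*} [LT α] {n : ℕ} (r : ℕ) (w : Fin n → α) : ℕ :=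
  ∑ i ∈ Finset.univ.filter (fun i : Fin n => IsRthFromRight r w i), (i : ℕ)

/-- `E_n^{(r)}` for geometric words. -/
def avgPos (q : ℝ) (r n : ℕ) : ℝ :=
  ∫ w, (lettersLeft r w : ℝ) ∂(wordLaw q n)

/-- `E_n^{(r)}` for uniformly random permutations. -/
def permAvgPos (r n : ℕ) : ℝ :=
  (∑ σ : Equiv.Perm (Fin n), (lettersLeft r (fun i => σ i) : ℝ)) / (n.factorial : ℝ)

/-- `Q ^ z - 1` with `Q = 1 / q`. -/
def Qm1 (q : ℝ) (z : ℂ) : ℂ := ((q⁻¹ : ℝ) : ℂ) ^ z - 1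

/-- The function `τ(z, m)`. -/
def tau (q : ℝ) (z m : ℂ) : ℂ :=
  let p : ℂ := 1 - (q : ℂ);
  (-((q : ℂ) ^ (m + 2) / p ^ 2)) * (1 / Qm1 q (z - 1))
    + (q : ℂ) ^ (m + 1) / p * (1 / Qm1 q (z - 1)) * (z - m - 1)
    + (q : ℂ) ^ 2 / p ^ 2 * (1 / Qm1 q (z - 1))
    + (q : ℂ) ^ (m + 2) / p ^ 2 * (1 / Qm1 q z)
    - (q : ℂ) ^ (m + 1) / p * (1 / Qm1 q z) * (z - m - 1)
    - (q : ℂ) / p ^ 2 * (1 / Qm1 q z)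

/-- The nested sum `ψ_r(k)`, over `0 < l_1 < ⋯ < l_{r-1} < k - 1`, of
`τ(k, l_{r-1}) / ((Q^{l_1} - 1) ⋯ (Q^{l_{r-1}} - 1))`. The tuples are the `(r-1)`-element sets `S`
and `S.sup id` is the largest element (`0` for `r = 1`). -/
def psiSum (q : ℝ) (r k : ℕ) : ℂ :=
  ∑ S ∈ (Finset.Ioo 0 (k - 1)).powersetCard (r - 1),
    (∏ l ∈ S, 1 / Qm1 q (l : ℂ)) * tau q (k : ℂ) ((S.sup id : ℕ) : ℂ)

/-- The extension to complex `z` of the power sum `∑_{1 ≤ i < z} 1 / (Q^i - 1)^m`. -/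
def powerSum (q : ℝ) (m : ℕ) (z : ℂ) : ℂ :=
  ∑' i : ℕ, (1 / Qm1 q ((i : ℂ) + 1) ^ m - 1 / Qm1 q ((i : ℂ) + z) ^ m)

/-- The extension to complex `z` of the elementary symmetric sum
`g_s(z) = ∑_{1 ≤ i_1 < ⋯ < i_s < z} 1 / ((Q^{i_1} - 1) ⋯ (Q^{i_s} - 1))`, expressed through power
sums by Newton's identities. -/
def g (q : ℝ) : ℕ → ℂ → ℂ
  | 0, _ => 1
  | s + 1, z => 1 / ((s : ℂ) + 1) *
      ∑ m : Fin (s + 1), (-1) ^ (m : ℕ) * g q (s - m) z * powerSum q (m + 1) z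
  termination_by s => s
  decreasing_by omega

/-- The extension `ψ_r(z)` of `ψ_r(k)` to complex `z`, for `r ≥ 1`. -/
def psi (q : ℝ) : ℕ → ℂ → ℂ
  | 0, _ => 0
  | 1, z => tau q z 0
  | s + 2, z =>
      (∑' i : ℕ, g q s ((i : ℂ) + 1) * tau q z ((i : ℂ) + 1) / Qm1 q ((i : ℂ) + 1))
      - ∑' i : ℕ, g q s ((i : ℂ) + z) * tau q z ((i : ℂ) + z) / Qm1 q ((i : ℂ) + z)

/-- The point `1 + 2 k π i / L` with `L = log Q`. -/
def polePt (q : ℝ) (k : ℤ) : ℂ :=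
  1 + 2 * (k : ℂ) * (Real.pi : ℂ) * Complex.I / ((Real.log q⁻¹ : ℝ) : ℂ)

end GeomWords

end

/-!
The quantities that enter `ψ_r(z)` depend on `z` only through `w = q ^ z` and an affine factor. In
that variable
`ψ_r(z) = β (z - 1) (1 / (Q^(z-1) - 1) - 1 / (Q^z - 1)) + h(q ^ z)`
with a constant `β` and a function `h` analytic in the unit disc (`psi_eq_add_hW`). This
displays the singularities: `ψ_r` is analytic for `Re z > 1`, tends to `β / L + h(q)` at `1`, and has
residue `β (z_k - 1) / L` at `z_k`. At integers, the extension of `g_s` by Newton's identities obeys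
the recursion `g_{s+1}(l+1) = g_{s+1}(l) + g_s(l) / (Q^l - 1)` (`gW_mul_q`); this gives the nested
sum (`psi_eq_psiSum`), and summation by parts turns it into a simpler single sum (`psi_natCast`).

For words, conditioning on the first letter gives the law of the number of left-to-right maxima above
a given level as a binomial transform (`prec_eq`), and from it
`E_n = (-1)^(r-1) (p/q)^r ∑_{k ≥ 2} C(n, k) (-1)^k ψ_r(k)` (`avgPos_eq_sum_psiR`). No contour
integral is needed to evaluate this sum: expand `ψ_r(k)` in powers of `q ^ k` and sum over `k` first.
The `β` part becomes a sum of binomial tail probabilities, the `h` part a Taylor series of `h` at `0`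
(`hasSum_avgPos`). After division by `n`, binomial tails become Poisson tails, so that
`E_n / n - (-1)^(r-1) (p/q)^r (β T(log_Q n) + h(q)) → 0`, where `T(x) = ∑_j θ(Q^(x+j))` and
`t θ(t)` is the probability that a Poisson variable of mean `t` is at least `2`
(`tendsto_avgPos_div`). Poisson summation and the Mellin transform of `θ` give the Fourier series of
`T`, whose coefficients are the stated multiples of `Γ(-z_k)` (`mellin_theta`, `hasSum_perSum`); its
mean `1 / L` accounts for `ψ_r(1)`. As `q → 1` the factor `β` grows at most like a power of `1 / p`,
while `Γ` decays faster than any power along vertical lines, so the fluctuation vanishes uniformly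
(`abs_varpi_le`).

For the limit of the constant, the generating function `∑ E_n x^n` at `x = y / (1 + y)` is computed
in two ways, from the law of the left-to-right maxima and from the alternating sum (`tsum_genF_eq`).
Letting `y → ∞` along a geometric sequence and integrating over one period expresses the constant as
an integral over the line (`const_eq_integral`), whose integrand contains an iterated Riemann sum of
`dY / (1 + Y)`. This sum lies between two multiples of `log(1+Y)^s / s!` (`lam_le_kap`,
`kap_le_lam`), and dominated convergence leaves an elementary integral with value `2^(-r)`
(`tendsto_const`).

A word with distinct letters, its letters in random order, is a uniformly random permutation, and a
repeated letter has probability at most `n^2 p` (`abs_avgPos_sub_permAvgPos_le`). For permutations,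
removing the last letter shows that the deviation of the expected position from `(n + 1) / 2^r` is
the Cesàro mean of the deviation for `r - 1` (`mul_permDev`).
-/


noncomputable section

namespace GeomWords

/-! ### The variable `w = q ^ z` -/

/-- The function `w / (1 - w)`, which is `1 / (Q ^ z - 1)` at `w = q ^ z`. -/
def aw (w : ℂ) : ℂ := w / (1 - w)

/-- `powerSum q m z` as a function of `w = q ^ z`. -/
def powW (q : ℝ) (m : ℕ) (w : ℂ) : ℂ :=
  ∑' i : ℕ, (aw ((q : ℂ) ^ (i + 1)) ^ m - aw ((q : ℂ) ^ i * w) ^ m)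

/-- `g q s z` as a function of `w = q ^ z`. -/
def gW (q : ℝ) : ℕ → ℂ → ℂ
  | 0, _ => 1
  | s + 1, w => 1 / ((s : ℂ) + 1) *
      ∑ m : Fin (s + 1), (-1) ^ (m : ℕ) * gW q (s - m) w * powW q (m + 1) w
  termination_by s => s
  decreasing_by omega

/-- The summand `g_s(z) / (Q ^ z - 1)` as a function of `w = q ^ z`. -/
def gammaW (q : ℝ) (s : ℕ) (w : ℂ) : ℂ := gW q s w * aw w

/-- The factor of `τ(z, m)` that remains after division by `1/(Q^(z-1)-1) - 1/(Q^z-1)`; here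
`w = q ^ z` and `u = q ^ m`. -/
def tauCore (q : ℝ) (z m w u : ℂ) : ℂ :=
  (q : ℂ) / (1 - q) * u * (z - m - 1) - (q : ℂ) ^ 2 / (1 - q) ^ 2 * (u - w / q)

/-- The coefficient of `z` in `ψ_r(z) = (1/(Q^(z-1)-1) - 1/(Q^z-1)) (β z + V(q^z))`. -/
def beta (q : ℝ) : ℕ → ℂ
  | 0 => 0
  | 1 => (q : ℂ) / (1 - q)
  | s + 2 => (q : ℂ) / (1 - q) * ∑' i : ℕ, gammaW q s ((q : ℂ) ^ (i + 1)) * (q : ℂ) ^ (i + 1)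

/-- The part of `ψ_r(z) = (1/(Q^(z-1)-1) - 1/(Q^z-1)) (β z + V(q^z))` that depends on `z` only
through `w = q ^ z`; it is analytic in the unit disc. -/
def VW (q : ℝ) : ℕ → ℂ → ℂ
  | 0, _ => 0
  | 1, w => tauCore q 0 0 w 1
  | s + 2, w =>
      (∑' i : ℕ, gammaW q s ((q : ℂ) ^ (i + 1)) * tauCore q 0 ((i : ℂ) + 1) w ((q : ℂ) ^ (i + 1)))
      - ∑' i : ℕ, gammaW q s ((q : ℂ) ^ i * w) * tauCore q 0 i w ((q : ℂ) ^ i * w)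

section
variable {q : ℝ}

lemma cpow_natCast_add (h0 : 0 < q) (i : ℕ) (z : ℂ) :
    (q : ℂ) ^ ((i : ℂ) + z) = (q : ℂ) ^ i * (q : ℂ) ^ z := by
  rw [Complex.cpow_add _ _ (by exact_mod_cast h0.ne'), Complex.cpow_natCast]

lemma one_div_Qm1 (h0 : 0 < q) (z : ℂ) : 1 / Qm1 q z = aw ((q : ℂ) ^ z) := by
  have hq : (q : ℂ) ≠ 0 := by exact_mod_cast h0.ne'
  have hw : (q : ℂ) ^ z ≠ 0 := by simp [Complex.cpow_eq_zero_iff, hq]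
  unfold Qm1 aw
  rw [Complex.ofReal_inv, Complex.inv_cpow _ _ (by
    rw [Complex.arg_ofReal_of_nonneg h0.le]; exact Real.pi_ne_zero.symm)]
  generalize (q : ℂ) ^ z = w at hw
  by_cases h1 : w = 1
  · simp [h1]
  have : (1 : ℂ) - w ≠ 0 := sub_ne_zero.mpr (Ne.symm h1)
  have h2 : w⁻¹ - 1 ≠ 0 := by
    intro h; apply h1; rwa [sub_eq_zero, inv_eq_one] at h
  field_simp

lemma powerSum_eq (h0 : 0 < q) (m : ℕ) (z : ℂ) : powerSum q m z = powW q m ((q : ℂ) ^ z) := by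
  unfold powerSum powW
  congr 1; ext i
  rw [← one_div_pow, ← one_div_pow, one_div_Qm1 h0, one_div_Qm1 h0, cpow_natCast_add h0,
    cpow_natCast_add h0, Complex.cpow_one, pow_succ]

lemma g_eq (h0 : 0 < q) (s : ℕ) (z : ℂ) : g q s z = gW q s ((q : ℂ) ^ z) := by
  induction s using Nat.strong_induction_on with
  | _ s ih =>
    cases s with
    | zero => rw [g, gW]
    | succ s =>
      rw [g, gW]
      congr 1
      refine Finset.sum_congr rfl fun m _ => ?_
      rw [ih _ (by omega), powerSum_eq h0]

lemma norm_aw_le {u : ℂ} {t ρ : ℝ} (hu : ‖u‖ ≤ t) (ht : t ≤ ρ) (hρ : ρ < 1) :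
    ‖aw u‖ ≤ t / (1 - ρ) := by
  unfold aw
  rw [norm_div]
  have h1 : 1 - ρ ≤ ‖1 - u‖ := by
    have := norm_sub_norm_le (1 : ℂ) u
    rw [norm_one] at this
    linarith
  have : 0 < 1 - ρ := by linarith
  have := norm_nonneg u
  gcongr
  linarith

lemma norm_q_pow_mul_le (h0 : 0 < q) (i : ℕ) {w : ℂ} {ρ : ℝ} (hw : ‖w‖ ≤ ρ) :
    ‖(q : ℂ) ^ i * w‖ ≤ q ^ i * ρ := by
  rw [norm_mul, norm_pow, Complex.norm_real, Real.norm_of_nonneg h0.le]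
  gcongr

lemma norm_aw_q_pow_mul_le (h0 : 0 < q) (h1 : q < 1) (i : ℕ) {w : ℂ} {ρ : ℝ} (hw : ‖w‖ ≤ ρ)
    (hρ : ρ < 1) : ‖aw ((q : ℂ) ^ i * w)‖ ≤ q ^ i * (1 / (1 - ρ)) := by
  have hρ0 : 0 ≤ ρ := (norm_nonneg w).trans hw
  have h2 : q ^ i ≤ 1 := pow_le_one₀ h0.le h1.le
  refine (norm_aw_le (norm_q_pow_mul_le h0 i hw) (mul_le_of_le_one_left hρ0 h2) hρ).trans ?_
  have : 0 < 1 - ρ := by linarith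
  rw [mul_one_div]
  gcongr
  exact mul_le_of_le_one_right (by positivity) hρ.le

lemma differentiableAt_aw {w : ℂ} (h : w ≠ 1) : DifferentiableAt ℂ aw w :=
  differentiableAt_id.div ((differentiableAt_const _).sub differentiableAt_id)
    (sub_ne_zero.mpr (Ne.symm h))

lemma ne_one_of_norm_lt {w : ℂ} (h : ‖w‖ < 1) : w ≠ 1 := by
  rintro rfl; simp at h

lemma differentiableOn_unitBall {f : ℂ → ℂ} (ρ₀ : ℝ) (hρ₀ : ρ₀ < 1)
    (h : ∀ ρ, ρ₀ < ρ → ρ < 1 → DifferentiableOn ℂ f (Metric.ball 0 ρ)) :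
    DifferentiableOn ℂ f (Metric.ball 0 1) := by
  intro w hw
  rw [mem_ball_zero_iff] at hw
  obtain ⟨ρ, hρ, hρ1⟩ := exists_between (max_lt hw hρ₀)
  have := h ρ ((le_max_right _ _).trans_lt hρ) hρ1
  exact (this.differentiableAt (Metric.isOpen_ball.mem_nhds
    (mem_ball_zero_iff.mpr ((le_max_left _ _).trans_lt hρ)))).differentiableWithinAt

lemma q_pow_mul_mem_ball (h0 : 0 < q) (h1 : q < 1) (i : ℕ) {w : ℂ} (hw : ‖w‖ < 1) :
    ‖(q : ℂ) ^ i * w‖ < 1 := by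
  refine (norm_q_pow_mul_le h0 i le_rfl).trans_lt ?_
  exact (mul_le_of_le_one_left (norm_nonneg _) (pow_le_one₀ h0.le h1.le)).trans_lt hw

lemma norm_q_lt (h0 : 0 < q) (h1 : q < 1) : ‖(q : ℂ)‖ < 1 := by
  rwa [Complex.norm_real, Real.norm_of_nonneg h0.le]

lemma summable_powW (h0 : 0 < q) (h1 : q < 1) (m : ℕ) {w : ℂ} (hw : ‖w‖ < 1) :
    Summable fun i : ℕ => aw ((q : ℂ) ^ i * w) ^ (m + 1) := by
  have hs : Summable fun i : ℕ => q ^ i * (1 / (1 - ‖w‖)) ^ (m + 1) :=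
    (summable_geometric_of_lt_one h0.le h1).mul_right _
  refine Summable.of_norm_bounded hs fun i => ?_
  rw [norm_pow]
  have h3 := norm_aw_q_pow_mul_le h0 h1 i le_rfl hw
  have : 0 < 1 - ‖w‖ := by linarith
  calc ‖aw ((q : ℂ) ^ i * w)‖ ^ (m + 1) ≤ (q ^ i * (1 / (1 - ‖w‖))) ^ (m + 1) := by gcongr
    _ = (q ^ i) ^ (m + 1) * (1 / (1 - ‖w‖)) ^ (m + 1) := mul_pow _ _ _
    _ ≤ q ^ i * (1 / (1 - ‖w‖)) ^ (m + 1) := by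
      gcongr
      exact pow_le_of_le_one (by positivity) (pow_le_one₀ h0.le h1.le) (by omega)

lemma differentiableOn_powW (h0 : 0 < q) (h1 : q < 1) (m : ℕ) :
    DifferentiableOn ℂ (powW q (m + 1)) (Metric.ball 0 1) := by
  refine differentiableOn_unitBall q h1 fun ρ hq hρ => ?_
  have hs : Summable fun i : ℕ => q ^ i * (2 * (1 / (1 - ρ)) ^ (m + 1)) :=
    (summable_geometric_of_lt_one h0.le h1).mul_right _
  have hb : ∀ (i : ℕ) (w : ℂ), ‖w‖ ≤ ρ →
      ‖aw ((q : ℂ) ^ i * w) ^ (m + 1)‖ ≤ q ^ i * (1 / (1 - ρ)) ^ (m + 1) := by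
    intro i w hw
    rw [norm_pow]
    have h3 := norm_aw_q_pow_mul_le h0 h1 i hw hρ
    have : 0 < 1 - ρ := by linarith
    calc ‖aw ((q : ℂ) ^ i * w)‖ ^ (m + 1) ≤ (q ^ i * (1 / (1 - ρ))) ^ (m + 1) := by gcongr
      _ = (q ^ i) ^ (m + 1) * (1 / (1 - ρ)) ^ (m + 1) := mul_pow _ _ _
      _ ≤ q ^ i * (1 / (1 - ρ)) ^ (m + 1) := by
        gcongr
        exact pow_le_of_le_one (by positivity) (pow_le_one₀ h0.le h1.le) (by omega)
  refine Complex.differentiableOn_tsum_of_summable_norm hs (fun i w hw => ?_) Metric.isOpen_ball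
    fun i w hw => ?_
  · rw [mem_ball_zero_iff] at hw
    refine DifferentiableAt.differentiableWithinAt ?_
    refine (differentiableAt_const _).sub (DifferentiableAt.pow ?_ _)
    refine DifferentiableAt.comp (g := aw) w (differentiableAt_aw
      (ne_one_of_norm_lt (q_pow_mul_mem_ball h0 h1 i (hw.trans hρ)))) ?_
    exact (differentiableAt_const _).mul differentiableAt_id
  · rw [mem_ball_zero_iff] at hw
    refine (norm_sub_le _ _).trans ?_
    have e1 := hb i w hw.le
    have e2 := hb i (q : ℂ) (by
      rw [Complex.norm_real, Real.norm_of_nonneg h0.le]; exact hq.le)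
    rw [← pow_succ] at e2
    linarith

lemma differentiableOn_gW (h0 : 0 < q) (h1 : q < 1) (s : ℕ) :
    DifferentiableOn ℂ (gW q s) (Metric.ball 0 1) := by
  induction s using Nat.strong_induction_on with
  | _ s ih =>
    cases s with
    | zero =>
      have : gW q 0 = fun _ => 1 := by ext; rw [gW]
      rw [this]; exact differentiableOn_const _
    | succ s =>
      have : gW q (s + 1) = fun w => 1 / ((s : ℂ) + 1) *
          ∑ m : Fin (s + 1), (-1) ^ (m : ℕ) * gW q (s - m) w * powW q (m + 1) w := by
        ext; rw [gW]
      rw [this]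
      refine (differentiableOn_const _).mul (DifferentiableOn.fun_sum fun m _ => ?_)
      exact ((differentiableOn_const _).mul (ih _ (by omega))).mul (differentiableOn_powW h0 h1 _)

lemma differentiableOn_gammaW (h0 : 0 < q) (h1 : q < 1) (s : ℕ) :
    DifferentiableOn ℂ (gammaW q s) (Metric.ball 0 1) :=
  (differentiableOn_gW h0 h1 s).mul fun _ hw =>
    (differentiableAt_aw (ne_one_of_norm_lt (mem_ball_zero_iff.mp hw))).differentiableWithinAt

lemma exists_norm_gammaW_le (h0 : 0 < q) (h1 : q < 1) (s : ℕ) {ρ : ℝ} (hρ : ρ < 1) :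
    ∃ C : ℝ, 0 ≤ C ∧ ∀ (i : ℕ) (w : ℂ), ‖w‖ ≤ ρ → ‖gammaW q s ((q : ℂ) ^ i * w)‖ ≤ C * q ^ i := by
  have hc : ContinuousOn (gW q s) (Metric.closedBall 0 ρ) :=
    (differentiableOn_gW h0 h1 s).continuousOn.mono (Metric.closedBall_subset_ball hρ)
  obtain ⟨C, hC⟩ := (isCompact_closedBall (0 : ℂ) ρ).exists_bound_of_continuousOn hc
  have hp : 0 < 1 - ρ := by linarith
  refine ⟨|C| * (1 / (1 - ρ)), by positivity, fun i w hw => ?_⟩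
  have hρ0 : 0 ≤ ρ := (norm_nonneg w).trans hw
  have e1 : ‖gW q s ((q : ℂ) ^ i * w)‖ ≤ |C| := by
    refine (hC _ ?_).trans (le_abs_self _)
    rw [mem_closedBall_zero_iff]
    exact (norm_q_pow_mul_le h0 i hw).trans
      (mul_le_of_le_one_left hρ0 (pow_le_one₀ h0.le h1.le))
  have e2 := norm_aw_q_pow_mul_le h0 h1 i hw hρ
  unfold gammaW
  rw [norm_mul]
  calc _ ≤ |C| * (q ^ i * (1 / (1 - ρ))) := by gcongr
    _ = _ := by ring

end

/-! ### The singularities of `ψ_r` on the line `Re z = 1` -/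

/-- The analytic part of `ψ_r`, as a function of `w = q ^ z`:
`ψ_r(z) = β (z - 1) (1/(Q^(z-1)-1) - 1/(Q^z-1)) + h(q^z)`. -/
def hW (q : ℝ) (r : ℕ) (w : ℂ) : ℂ := -(w * (1 - q) / (1 - w)) * dslope (VW q r) q w

section
variable {q : ℝ}

lemma ofReal_ne_one (h1 : q < 1) : (1 : ℂ) - q ≠ 0 :=
  sub_ne_zero.mpr (by exact_mod_cast h1.ne')

lemma tau_eq (h0 : 0 < q) (h1 : q < 1) {z : ℂ} (m : ℂ) (hw : (q : ℂ) ^ z ≠ q)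
    (hw1 : (q : ℂ) ^ z ≠ 1) :
    tau q z m = (aw ((q : ℂ) ^ z / q) - aw ((q : ℂ) ^ z)) *
      tauCore q z m ((q : ℂ) ^ z) ((q : ℂ) ^ m) := by
  have hq : (q : ℂ) ≠ 0 := by exact_mod_cast h0.ne'
  have hp := ofReal_ne_one h1
  have e1 : (q : ℂ) ^ (m + 2) = (q : ℂ) ^ m * (q : ℂ) ^ 2 := by
    rw [Complex.cpow_add _ _ hq]; norm_cast
  have e2 : (q : ℂ) ^ (m + 1) = (q : ℂ) ^ m * (q : ℂ) := by
    rw [Complex.cpow_add _ _ hq, Complex.cpow_one]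
  have e3 : (q : ℂ) ^ (z - 1) = (q : ℂ) ^ z / (q : ℂ) := by
    rw [Complex.cpow_sub _ _ hq, Complex.cpow_one]
  unfold tau tauCore
  simp only [one_div_Qm1 h0, e1, e2, e3]
  generalize (q : ℂ) ^ z = w at *
  generalize (q : ℂ) ^ m = u at *
  unfold aw
  have f1 : (1 : ℂ) - w / q ≠ 0 := by
    rw [sub_ne_zero]; intro h; apply hw; field_simp at h; exact h.symm
  have f2 : (1 : ℂ) - w ≠ 0 := sub_ne_zero.mpr (Ne.symm hw1)
  have f3 : (q : ℂ) - w ≠ 0 := sub_ne_zero.mpr (Ne.symm hw)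
  field_simp
  ring

lemma tauCore_eq (q : ℝ) (z m w u : ℂ) :
    tauCore q z m w u = tauCore q 0 m w u + (q : ℂ) / (1 - q) * u * z := by
  unfold tauCore; ring

lemma norm_tauCore_le (h0 : 0 < q) (h1 : q < 1) {m w u : ℂ} (i : ℕ) (hm : ‖m‖ ≤ i + 1)
    (hu : ‖u‖ ≤ 1) (hw : ‖w‖ ≤ 1) :
    ‖tauCore q 0 m w u‖ ≤ (q / (1 - q) + q ^ 2 / (1 - q) ^ 2 * (1 + 1 / q)) * (i + 2) := by
  have hp : 0 < 1 - q := by linarith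
  have n1 : ‖(1 : ℂ) - q‖ = 1 - q := by
    rw [← Complex.ofReal_one, ← Complex.ofReal_sub, Complex.norm_real, Real.norm_of_nonneg hp.le]
  have n0 : ‖(q : ℂ)‖ = q := by rw [Complex.norm_real, Real.norm_of_nonneg h0.le]
  unfold tauCore
  refine (norm_sub_le _ _).trans ?_
  rw [norm_mul, norm_mul, norm_div, norm_mul, norm_div, norm_pow, norm_pow, n1, n0]
  have a1 : ‖(0 : ℂ) - m - 1‖ ≤ i + 2 := by
    calc ‖(0 : ℂ) - m - 1‖ ≤ ‖(0 : ℂ) - m‖ + ‖(1 : ℂ)‖ := norm_sub_le _ _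
      _ ≤ _ := by rw [zero_sub, norm_neg, norm_one]; linarith
  have a2 : ‖u - w / q‖ ≤ 1 + 1 / q := by
    refine (norm_sub_le _ _).trans ?_
    rw [norm_div, n0]
    gcongr
  have a3 : q / (1 - q) * ‖u‖ * ‖(0 : ℂ) - m - 1‖ ≤ q / (1 - q) * 1 * (i + 2) := by
    gcongr
  have a4 : q ^ 2 / (1 - q) ^ 2 * ‖u - w / q‖ ≤ q ^ 2 / (1 - q) ^ 2 * (1 + 1 / q) * (i + 2) := by
    calc _ ≤ q ^ 2 / (1 - q) ^ 2 * (1 + 1 / q) * 1 := by rw [mul_one]; gcongr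
      _ ≤ _ := by
        gcongr
        have : (0 : ℝ) ≤ i := Nat.cast_nonneg i
        linarith
  linarith

lemma summable_q_pow_mul (h0 : 0 < q) (h1 : q < 1) (C : ℝ) :
    Summable fun i : ℕ => C * (q ^ i * ((i : ℝ) + 2)) := by
  refine Summable.mul_left _ ?_
  have s1 : Summable fun i : ℕ => (i : ℝ) ^ 1 * q ^ i :=
    summable_pow_mul_geometric_of_norm_lt_one 1 (by rwa [Real.norm_of_nonneg h0.le])
  have s2 := (summable_geometric_of_lt_one h0.le h1).mul_right 2
  refine (s1.add s2).congr fun i => ?_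
  ring

lemma norm_term_le (h0 : 0 < q) (h1 : q < 1) (s : ℕ) {ρ : ℝ} (hρ : ρ < 1) :
    ∃ C : ℝ, ∀ (i : ℕ) (w m w' : ℂ), ‖w‖ ≤ ρ → ‖w'‖ ≤ 1 → ‖m‖ ≤ i + 1 →
      ‖gammaW q s ((q : ℂ) ^ i * w) * tauCore q 0 m w' ((q : ℂ) ^ i * w)‖
        ≤ C * (q ^ i * ((i : ℝ) + 2)) := by
  obtain ⟨C, hC, h⟩ := exists_norm_gammaW_le h0 h1 s hρ
  refine ⟨C * (q / (1 - q) + q ^ 2 / (1 - q) ^ 2 * (1 + 1 / q)), fun i w m w' hw hw' hm => ?_⟩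
  have hu : ‖(q : ℂ) ^ i * w‖ ≤ 1 := (q_pow_mul_mem_ball h0 h1 i (hw.trans_lt hρ)).le
  have b1 := norm_tauCore_le h0 h1 (w := w') i hm hu hw'
  have b2 := h i w hw
  rw [norm_mul]
  calc _ ≤ (C * q ^ i) * ((q / (1 - q) + q ^ 2 / (1 - q) ^ 2 * (1 + 1 / q)) * (i + 2)) := by
        gcongr
    _ = _ := by ring

lemma summable_first (h0 : 0 < q) (h1 : q < 1) (s : ℕ) {w : ℂ} (hw : ‖w‖ < 1) :
    Summable fun i : ℕ => gammaW q s ((q : ℂ) ^ (i + 1)) *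
      tauCore q 0 ((i : ℂ) + 1) w ((q : ℂ) ^ (i + 1)) := by
  obtain ⟨C, hC⟩ := norm_term_le h0 h1 s (norm_q_lt h0 h1)
  refine Summable.of_norm_bounded (summable_q_pow_mul h0 h1 C) fun i => ?_
  have := hC i q ((i : ℂ) + 1) w le_rfl hw.le (by
    refine (norm_add_le _ _).trans ?_
    simp)
  rwa [← pow_succ] at this

lemma summable_second (h0 : 0 < q) (h1 : q < 1) (s : ℕ) {w : ℂ} (hw : ‖w‖ < 1) :
    Summable fun i : ℕ => gammaW q s ((q : ℂ) ^ i * w) *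
      tauCore q 0 i w ((q : ℂ) ^ i * w) := by
  obtain ⟨C, hC⟩ := norm_term_le h0 h1 s hw
  exact Summable.of_norm_bounded (summable_q_pow_mul h0 h1 C) fun i =>
    hC i w i w le_rfl hw.le (by simp)

lemma summable_gammaW (h0 : 0 < q) (h1 : q < 1) (s : ℕ) :
    Summable fun i : ℕ => gammaW q s ((q : ℂ) ^ (i + 1)) * (q : ℂ) ^ (i + 1) := by
  obtain ⟨C, hC0, hC⟩ := exists_norm_gammaW_le h0 h1 s (norm_q_lt h0 h1)
  refine Summable.of_norm_bounded ((summable_geometric_of_lt_one h0.le h1).mul_left C) fun i => ?_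
  have e1 := hC i q le_rfl
  rw [← pow_succ] at e1
  have e2 : ‖(q : ℂ) ^ (i + 1)‖ ≤ 1 := by
    rw [norm_pow]; exact pow_le_one₀ (norm_nonneg _) (norm_q_lt h0 h1).le
  rw [norm_mul]
  calc _ ≤ (C * q ^ i) * 1 := by gcongr
    _ = _ := mul_one _

/-- The decomposition of `ψ_r` that exposes its poles: `aw (w / q)` and `aw w` are
`1/(Q^(z-1)-1)` and `1/(Q^z-1)`. -/
lemma psi_eq (h0 : 0 < q) (h1 : q < 1) (r : ℕ) {z : ℂ} (hw : (q : ℂ) ^ z ≠ q)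
    (hw1 : ‖(q : ℂ) ^ z‖ < 1) :
    psi q r z = (aw ((q : ℂ) ^ z / q) - aw ((q : ℂ) ^ z)) *
      (beta q r * z + VW q r ((q : ℂ) ^ z)) := by
  have hw1' := ne_one_of_norm_lt hw1
  match r with
  | 0 => simp [psi, beta, VW]
  | 1 =>
    rw [psi, tau_eq h0 h1 _ hw hw1', Complex.cpow_zero, tauCore_eq, beta, VW]
    ring
  | s + 2 =>
    rw [psi, beta, VW]
    have e1 : ∀ i : ℕ, g q s ((i : ℂ) + 1) * tau q z ((i : ℂ) + 1) / Qm1 q ((i : ℂ) + 1) =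
        (aw ((q : ℂ) ^ z / q) - aw ((q : ℂ) ^ z)) *
        (gammaW q s ((q : ℂ) ^ (i + 1)) *
          tauCore q 0 ((i : ℂ) + 1) ((q : ℂ) ^ z) ((q : ℂ) ^ (i + 1))
        + (q : ℂ) / (1 - q) * z * (gammaW q s ((q : ℂ) ^ (i + 1)) * (q : ℂ) ^ (i + 1))) := by
      intro i
      have : (q : ℂ) ^ ((i : ℂ) + 1) = (q : ℂ) ^ (i + 1) := by
        rw [← Complex.cpow_natCast]; push_cast; rfl
      rw [div_eq_mul_one_div, one_div_Qm1 h0, g_eq h0, tau_eq h0 h1 _ hw hw1', tauCore_eq, this,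
        gammaW]
      ring
    have e2 : ∀ i : ℕ, g q s ((i : ℂ) + z) * tau q z ((i : ℂ) + z) / Qm1 q ((i : ℂ) + z) =
        (aw ((q : ℂ) ^ z / q) - aw ((q : ℂ) ^ z)) *
        (gammaW q s ((q : ℂ) ^ i * (q : ℂ) ^ z) *
          tauCore q 0 i ((q : ℂ) ^ z) ((q : ℂ) ^ i * (q : ℂ) ^ z)) := by
      intro i
      rw [div_eq_mul_one_div, one_div_Qm1 h0, g_eq h0, tau_eq h0 h1 _ hw hw1', cpow_natCast_add h0,
        gammaW]
      unfold tauCore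
      ring
    simp_rw [e1, e2, tsum_mul_left]
    rw [Summable.tsum_add (summable_first h0 h1 s hw1) ((summable_gammaW h0 h1 s).mul_left _),
      tsum_mul_left]
    ring

lemma VW_self (h0 : 0 < q) (h1 : q < 1) (r : ℕ) : VW q r q = -beta q r := by
  have hq : (q : ℂ) ≠ 0 := by exact_mod_cast h0.ne'
  match r with
  | 0 => simp [beta, VW]
  | 1 =>
    have hp := ofReal_ne_one h1
    rw [VW, beta, tauCore]; field_simp; ring
  | s + 2 =>
    rw [VW, beta, ← Summable.tsum_sub (summable_first h0 h1 s (norm_q_lt h0 h1))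
      (summable_second h0 h1 s (norm_q_lt h0 h1)), ← tsum_mul_left, ← tsum_neg]
    congr 1; ext i
    rw [← pow_succ]
    unfold tauCore
    ring

lemma differentiableOn_VW (h0 : 0 < q) (h1 : q < 1) (r : ℕ) :
    DifferentiableOn ℂ (VW q r) (Metric.ball 0 1) := by
  match r with
  | 0 =>
    have : VW q 0 = fun _ => 0 := by ext; rw [VW]
    rw [this]; exact differentiableOn_const _
  | 1 =>
    have : VW q 1 = fun w => tauCore q 0 0 w 1 := by ext; rw [VW]
    rw [this]; unfold tauCore; fun_prop
  | s + 2 =>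
    have : VW q (s + 2) = fun w => (∑' i : ℕ, gammaW q s ((q : ℂ) ^ (i + 1)) *
        tauCore q 0 ((i : ℂ) + 1) w ((q : ℂ) ^ (i + 1)))
      - ∑' i : ℕ, gammaW q s ((q : ℂ) ^ i * w) * tauCore q 0 i w ((q : ℂ) ^ i * w) := by
      ext; rw [VW]
    rw [this]
    refine DifferentiableOn.sub ?_ ?_
    · obtain ⟨C, hC⟩ := norm_term_le h0 h1 s (norm_q_lt h0 h1)
      refine Complex.differentiableOn_tsum_of_summable_norm (summable_q_pow_mul h0 h1 C)
        (fun i => ?_) Metric.isOpen_ball fun i w hw => ?_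
      · refine (differentiableOn_const _).mul ?_
        unfold tauCore; fun_prop
      · have := hC i q ((i : ℂ) + 1) w le_rfl (mem_ball_zero_iff.mp hw).le (by
          refine (norm_add_le _ _).trans ?_
          simp)
        rwa [← pow_succ] at this
    · refine differentiableOn_unitBall 0 one_pos fun ρ _ hρ => ?_
      obtain ⟨C, hC⟩ := norm_term_le h0 h1 s hρ
      refine Complex.differentiableOn_tsum_of_summable_norm (summable_q_pow_mul h0 h1 C)
        (fun i => ?_) Metric.isOpen_ball fun i w hw => ?_
      · refine DifferentiableOn.mul ?_ ?_
        · refine (differentiableOn_gammaW h0 h1 s).comp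
            ((differentiableOn_const _).mul differentiableOn_id) fun w hw => ?_
          exact mem_ball_zero_iff.mpr
            (q_pow_mul_mem_ball h0 h1 i ((mem_ball_zero_iff.mp hw).trans hρ))
        · unfold tauCore; fun_prop
      · have hw := mem_ball_zero_iff.mp hw
        exact hC i w i w hw.le (hw.trans hρ).le (by simp)

lemma differentiableOn_hW (h0 : 0 < q) (h1 : q < 1) (r : ℕ) :
    DifferentiableOn ℂ (hW q r) (Metric.ball 0 1) := by
  refine DifferentiableOn.mul (DifferentiableOn.neg ?_) ?_
  · refine DifferentiableOn.div (by fun_prop) (by fun_prop) fun w hw => ?_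
    exact sub_ne_zero.mpr (Ne.symm (ne_one_of_norm_lt (mem_ball_zero_iff.mp hw)))
  · exact (Complex.differentiableOn_dslope (Metric.isOpen_ball.mem_nhds
      (mem_ball_zero_iff.mpr (norm_q_lt h0 h1)))).mpr (differentiableOn_VW h0 h1 r)

/-- The two factors `β (z - 1)` and `1/(Q^(z-1)-1)` carry all the singular behaviour of `ψ_r` in
`Re z > 0`. -/
lemma psi_eq_add_hW (h0 : 0 < q) (h1 : q < 1) (r : ℕ) {z : ℂ} (hw : (q : ℂ) ^ z ≠ q)
    (hw1 : ‖(q : ℂ) ^ z‖ < 1) :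
    psi q r z = beta q r * (z - 1) * (aw ((q : ℂ) ^ z / q) - aw ((q : ℂ) ^ z))
      + hW q r ((q : ℂ) ^ z) := by
  rw [psi_eq h0 h1 r hw hw1, hW, dslope_of_ne _ hw, slope_def_field, VW_self h0 h1]
  have hw1' := ne_one_of_norm_lt hw1
  have hq : (q : ℂ) ≠ 0 := by exact_mod_cast h0.ne'
  generalize (q : ℂ) ^ z = w at *
  unfold aw
  have f2 : (1 : ℂ) - w ≠ 0 := sub_ne_zero.mpr (Ne.symm hw1')
  have f3 : (q : ℂ) - w ≠ 0 := sub_ne_zero.mpr (Ne.symm hw)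
  have f4 : w - (q : ℂ) ≠ 0 := sub_ne_zero.mpr hw
  have f1 : w / q / (1 - w / q) = w / (q - w) := by
    rw [div_div, mul_sub, mul_one, mul_div_cancel₀ _ hq]
  rw [f1]
  field_simp
  ring

lemma norm_q_cpow (h0 : 0 < q) (z : ℂ) : ‖(q : ℂ) ^ z‖ = q ^ z.re :=
  Complex.norm_cpow_eq_rpow_re_of_pos h0 z

lemma analyticOnNhd_psi (h0 : 0 < q) (h1 : q < 1) (r : ℕ) :
    AnalyticOnNhd ℂ (psi q r) {z : ℂ | 1 < z.re} := by
  have ho : IsOpen {z : ℂ | 1 < z.re} := isOpen_lt continuous_const Complex.continuous_re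
  have hq : (q : ℂ) ≠ 0 := by exact_mod_cast h0.ne'
  refine DifferentiableOn.analyticOnNhd ?_ ho
  have key : ∀ z ∈ {z : ℂ | 1 < z.re}, ‖(q : ℂ) ^ z‖ < q := fun z hz => by
    rw [norm_q_cpow h0]
    simpa using Real.rpow_lt_rpow_of_exponent_gt h0 h1 hz
  have hne : ∀ z ∈ {z : ℂ | 1 < z.re}, (q : ℂ) ^ z ≠ q := fun z hz h => by
    have := key z hz
    rw [h, Complex.norm_real, Real.norm_of_nonneg h0.le] at this
    exact lt_irrefl _ this
  have hd : DifferentiableOn ℂ (fun z : ℂ => (q : ℂ) ^ z) {z : ℂ | 1 < z.re} := fun z _ =>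
    (differentiableAt_id.const_cpow (Or.inl hq)).differentiableWithinAt
  refine DifferentiableOn.congr (f := fun z => (aw ((q : ℂ) ^ z / q) - aw ((q : ℂ) ^ z)) *
      (beta q r * z + VW q r ((q : ℂ) ^ z))) ?_
    fun z hz => psi_eq h0 h1 r (hne z hz) ((key z hz).trans h1)
  refine DifferentiableOn.mul (DifferentiableOn.sub ?_ ?_) (DifferentiableOn.add (by fun_prop) ?_)
  · intro z hz
    refine DifferentiableAt.comp_differentiableWithinAt z (g := aw) (differentiableAt_aw ?_)
      ((hd z hz).div_const _)
    intro h
    exact hne z hz (by field_simp at h; exact h)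
  · intro z hz
    exact DifferentiableAt.comp_differentiableWithinAt z (g := aw)
      (differentiableAt_aw (ne_one_of_norm_lt ((key z hz).trans h1))) (hd z hz)
  · exact (differentiableOn_VW h0 h1 r).comp hd fun z hz =>
      mem_ball_zero_iff.mpr ((key z hz).trans h1)

end

section
variable {q : ℝ}

lemma hasDerivAt_one_sub_cpow (h0 : 0 < q) {z₀ : ℂ} (hz : (q : ℂ) ^ z₀ = q) :
    HasDerivAt (fun z : ℂ => 1 - (q : ℂ) ^ z / q) ((Real.log q⁻¹ : ℝ) : ℂ) z₀ := by
  have hq : (q : ℂ) ≠ 0 := by exact_mod_cast h0.ne'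
  have h := ((hasDerivAt_id z₀).const_cpow (c := (q : ℂ)) (Or.inl hq)).div_const (q : ℂ)
  refine (h.const_sub 1).congr_deriv ?_
  rw [Real.log_inv, Complex.ofReal_neg, Complex.ofReal_log h0.le, id, hz, mul_one,
    mul_div_cancel_left₀ _ hq]

lemma log_inv_pos (h0 : 0 < q) (h1 : q < 1) : 0 < Real.log q⁻¹ :=
  Real.log_pos ((one_lt_inv₀ h0).mpr h1)

lemma tendsto_sub_mul_aw (h0 : 0 < q) (h1 : q < 1) {z₀ : ℂ} (hz : (q : ℂ) ^ z₀ = q) :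
    Tendsto (fun z : ℂ => (z - z₀) * aw ((q : ℂ) ^ z / q)) (𝓝[≠] z₀)
      (𝓝 (1 / ((Real.log q⁻¹ : ℝ) : ℂ))) := by
  have hq : (q : ℂ) ≠ 0 := by exact_mod_cast h0.ne'
  have hL : ((Real.log q⁻¹ : ℝ) : ℂ) ≠ 0 := by exact_mod_cast (log_inv_pos h0 h1).ne'
  have t1 := ((hasDerivAt_one_sub_cpow h0 hz).tendsto_slope).inv₀ hL
  have t2 : Tendsto (fun z : ℂ => (q : ℂ) ^ z / q) (𝓝[≠] z₀) (𝓝 1) := by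
    have : ContinuousAt (fun z : ℂ => (q : ℂ) ^ z / q) z₀ :=
      ((differentiableAt_id.const_cpow (Or.inl hq)).div_const _).continuousAt
    have h := this.tendsto
    rw [hz, div_self hq] at h
    exact h.mono_left nhdsWithin_le_nhds
  have t3 := t1.mul t2
  rw [mul_one, ← one_div] at t3
  refine t3.congr fun z => ?_
  rw [slope_def_field, hz, div_self hq, sub_self, sub_zero, inv_div, aw]
  ring

lemma eventually_cpow_ne (h0 : 0 < q) (h1 : q < 1) {z₀ : ℂ} (hz : (q : ℂ) ^ z₀ = q) :
    ∀ᶠ z in 𝓝[≠] z₀, (q : ℂ) ^ z ≠ q ∧ ‖(q : ℂ) ^ z‖ < 1 := by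
  have hq : (q : ℂ) ≠ 0 := by exact_mod_cast h0.ne'
  have hL : ((Real.log q⁻¹ : ℝ) : ℂ) ≠ 0 := by exact_mod_cast (log_inv_pos h0 h1).ne'
  have e1 := (hasDerivAt_one_sub_cpow h0 hz).eventually_ne (c := 0) hL
  have e2 : ∀ᶠ z in 𝓝[≠] z₀, ‖(q : ℂ) ^ z‖ < 1 := by
    have : ContinuousAt (fun z : ℂ => ‖(q : ℂ) ^ z‖) z₀ :=
      (differentiableAt_id.const_cpow (Or.inl hq)).continuousAt.norm
    refine nhdsWithin_le_nhds (this.eventually_lt continuousAt_const ?_)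
    rw [hz]; exact norm_q_lt h0 h1
  filter_upwards [e1, e2] with z hz1 hz2
  exact ⟨fun h => hz1 (by rw [h, div_self hq, sub_self]), hz2⟩

lemma tendsto_cpow (h0 : 0 < q) {z₀ : ℂ} (hz : (q : ℂ) ^ z₀ = q) :
    Tendsto (fun z : ℂ => (q : ℂ) ^ z) (𝓝[≠] z₀) (𝓝 (q : ℂ)) := by
  have hq : (q : ℂ) ≠ 0 := by exact_mod_cast h0.ne'
  have : ContinuousAt (fun z : ℂ => (q : ℂ) ^ z) z₀ :=
    (differentiableAt_id.const_cpow (Or.inl hq)).continuousAt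
  have h := this.tendsto
  rw [hz] at h
  exact h.mono_left nhdsWithin_le_nhds

lemma tendsto_aw_cpow (h0 : 0 < q) (h1 : q < 1) {z₀ : ℂ} (hz : (q : ℂ) ^ z₀ = q) :
    Tendsto (fun z : ℂ => aw ((q : ℂ) ^ z)) (𝓝[≠] z₀) (𝓝 (aw q)) :=
  (differentiableAt_aw (ne_one_of_norm_lt (norm_q_lt h0 h1))).continuousAt.tendsto.comp
    (tendsto_cpow h0 hz)

lemma tendsto_hW_cpow (h0 : 0 < q) (h1 : q < 1) (r : ℕ) {z₀ : ℂ} (hz : (q : ℂ) ^ z₀ = q) :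
    Tendsto (fun z : ℂ => hW q r ((q : ℂ) ^ z)) (𝓝[≠] z₀) (𝓝 (hW q r q)) :=
  ((differentiableOn_hW h0 h1 r).differentiableAt (Metric.isOpen_ball.mem_nhds
    (mem_ball_zero_iff.mpr (norm_q_lt h0 h1)))).continuousAt.tendsto.comp (tendsto_cpow h0 hz)

lemma tendsto_psi_one (h0 : 0 < q) (h1 : q < 1) (r : ℕ) :
    Tendsto (psi q r) (𝓝[≠] 1) (𝓝 (beta q r / ((Real.log q⁻¹ : ℝ) : ℂ) + hW q r q)) := by
  have hz : (q : ℂ) ^ (1 : ℂ) = q := Complex.cpow_one _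
  have t0 : Tendsto (fun z : ℂ => z - 1) (𝓝[≠] 1) (𝓝 0) := by
    have : Tendsto (fun z : ℂ => z - 1) (𝓝 1) (𝓝 (1 - 1)) :=
      (continuous_id.sub continuous_const).tendsto 1
    rw [sub_self] at this
    exact this.mono_left nhdsWithin_le_nhds
  have t := (((tendsto_sub_mul_aw h0 h1 hz).sub (t0.mul (tendsto_aw_cpow h0 h1 hz))).const_mul
    (beta q r)).add (tendsto_hW_cpow h0 h1 r hz)
  rw [zero_mul, sub_zero, mul_one_div] at t
  refine t.congr' ?_
  filter_upwards [eventually_cpow_ne h0 h1 hz] with z hz'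
  rw [psi_eq_add_hW h0 h1 r hz'.1 hz'.2]
  ring

lemma cpow_polePt (h0 : 0 < q) (h1 : q < 1) (k : ℤ) : (q : ℂ) ^ polePt q k = q := by
  have hq : (q : ℂ) ≠ 0 := by exact_mod_cast h0.ne'
  have hL : ((Real.log q⁻¹ : ℝ) : ℂ) ≠ 0 := by exact_mod_cast (log_inv_pos h0 h1).ne'
  rw [polePt, Complex.cpow_add _ _ hq, Complex.cpow_one]
  rw [Complex.cpow_def_of_ne_zero hq, ← Complex.ofReal_log h0.le]
  have : ((Real.log q : ℝ) : ℂ) = -((Real.log q⁻¹ : ℝ) : ℂ) := by rw [Real.log_inv]; simp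
  rw [this]
  have e : -((Real.log q⁻¹ : ℝ) : ℂ) * (2 * (k : ℂ) * Real.pi * Complex.I /
      ((Real.log q⁻¹ : ℝ) : ℂ)) = ((-k : ℤ) : ℂ) * (2 * Real.pi * Complex.I) := by
    push_cast
    generalize ((Real.log q⁻¹ : ℝ) : ℂ) = L at hL
    field_simp
  rw [e, Complex.exp_int_mul_two_pi_mul_I, mul_one]

lemma tendsto_residue (h0 : 0 < q) (h1 : q < 1) (r : ℕ) (k : ℤ) :
    Tendsto (fun z : ℂ => (z - polePt q k) * psi q r z) (𝓝[≠] (polePt q k))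
      (𝓝 (beta q r * (polePt q k - 1) / ((Real.log q⁻¹ : ℝ) : ℂ))) := by
  have hz := cpow_polePt h0 h1 k
  have t1 : Tendsto (fun z : ℂ => z - 1) (𝓝[≠] (polePt q k)) (𝓝 (polePt q k - 1)) :=
    ((continuous_id.sub continuous_const).tendsto (polePt q k)).mono_left nhdsWithin_le_nhds
  have t0 : Tendsto (fun z : ℂ => z - polePt q k) (𝓝[≠] (polePt q k)) (𝓝 0) := by
    have : Tendsto (fun z : ℂ => z - polePt q k) (𝓝 (polePt q k)) (𝓝 (polePt q k - polePt q k)) :=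
      (continuous_id.sub continuous_const).tendsto _
    rw [sub_self] at this
    exact this.mono_left nhdsWithin_le_nhds
  have t := (((tendsto_sub_mul_aw h0 h1 hz).sub (t0.mul (tendsto_aw_cpow h0 h1 hz))).mul
    (t1.const_mul (beta q r))).add (t0.mul (tendsto_hW_cpow h0 h1 r hz))
  have e : (1 / ((Real.log q⁻¹ : ℝ) : ℂ) - 0 * aw q) * (beta q r * (polePt q k - 1))
      + 0 * hW q r q = beta q r * (polePt q k - 1) / ((Real.log q⁻¹ : ℝ) : ℂ) := by ring
  rw [e] at t
  refine t.congr' ?_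
  filter_upwards [eventually_cpow_ne h0 h1 hz] with z hz'
  rw [psi_eq_add_hW h0 h1 r hz'.1 hz'.2]
  ring

/-! ### Integer arguments -/

/-- `1 / (Q ^ l - 1)` for an integer `l`, as a real number. -/
def ar (q : ℝ) (l : ℕ) : ℝ := q ^ l / (1 - q ^ l)

/-- The elementary symmetric sum `g_s(l)` at an integer `l`, as a real number: it obeys the
recursion `g_s(l+1) = g_s(l) + g_{s-1}(l) / (Q ^ l - 1)`. -/
def gr (q : ℝ) : ℕ → ℕ → ℝ
  | 0, _ => 1
  | s + 1, l => ∑ i ∈ Finset.Ioo 0 l, ar q i * gr q s i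

lemma aw_q_pow (q : ℝ) (l : ℕ) : aw ((q : ℂ) ^ l) = (ar q l : ℂ) := by
  unfold aw ar; push_cast; rfl

lemma powW_mul_q (h0 : 0 < q) (h1 : q < 1) (m : ℕ) {w : ℂ} (hw : ‖w‖ < 1) :
    powW q (m + 1) (q * w) = powW q (m + 1) w + aw w ^ (m + 1) := by
  have s0 : Summable fun i : ℕ => aw ((q : ℂ) ^ (i + 1)) ^ (m + 1) :=
    (summable_powW h0 h1 m (norm_q_lt h0 h1)).congr fun i => by
      rw [pow_succ (q : ℂ) i]
  have s1 := summable_powW h0 h1 m hw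
  have s2 : Summable fun i : ℕ => aw ((q : ℂ) ^ i * (q * w)) ^ (m + 1) :=
    ((summable_nat_add_iff 1).mpr s1).congr fun i => by
      rw [pow_succ (q : ℂ) i, mul_assoc]
  have e : ∑' i : ℕ, aw ((q : ℂ) ^ i * w) ^ (m + 1) =
      aw w ^ (m + 1) + ∑' i : ℕ, aw ((q : ℂ) ^ i * (q * w)) ^ (m + 1) := by
    rw [s1.tsum_eq_zero_add]
    simp only [pow_zero, one_mul, pow_succ (q : ℂ), mul_assoc]
  unfold powW
  rw [s0.tsum_sub s1, s0.tsum_sub s2, e]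
  ring

lemma gW_succ (q : ℝ) (s : ℕ) (w : ℂ) : ((s : ℂ) + 1) * gW q (s + 1) w =
    ∑ m ∈ Finset.range (s + 1), (-1) ^ m * gW q (s - m) w * powW q (m + 1) w := by
  rw [gW, ← mul_assoc, mul_one_div_cancel (by exact_mod_cast Nat.succ_ne_zero s), one_mul,
    ← Fin.sum_univ_eq_sum_range (fun m => (-1) ^ m * gW q (s - m) w * powW q (m + 1) w)]

/-- The defining recursion of elementary symmetric sums survives the passage to complex `z`. -/
lemma gW_mul_q (h0 : 0 < q) (h1 : q < 1) (s : ℕ) {w : ℂ} (hw : ‖w‖ < 1) :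
    gW q (s + 1) (q * w) = gW q (s + 1) w + aw w * gW q s w := by
  induction s using Nat.strong_induction_on with
  | _ s ih =>
  have hs : ((s : ℂ) + 1) ≠ 0 := by exact_mod_cast Nat.succ_ne_zero s
  apply mul_left_cancel₀ hs
  rw [mul_add, gW_succ, gW_succ]
  set a := aw w
  have hP : ∀ m, powW q (m + 1) (q * w) = powW q (m + 1) w + a ^ (m + 1) := fun m =>
    powW_mul_q h0 h1 m hw
  cases s with
  | zero => simp [gW, hP]
  | succ s =>
    have hG : ∀ m ∈ Finset.range (s + 1),
        (-1) ^ m * gW q (s + 1 - m) (q * w) * powW q (m + 1) (q * w) =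
        (-1) ^ m * gW q (s + 1 - m) w * powW q (m + 1) w +
        a * ((-1) ^ m * gW q (s - m) w * powW q (m + 1) w) +
        ((-1) ^ m * a ^ (m + 1) * gW q (s + 1 - m) w -
          (-1) ^ (m + 1) * a ^ (m + 1 + 1) * gW q (s + 1 - (m + 1)) w) := by
      intro m hm
      have hm' := Finset.mem_range.mp hm
      have e : s + 1 - m = (s - m) + 1 := by omega
      rw [e, hP, ih (s - m) (by omega)]
      have e2 : s + 1 - (m + 1) = s - m := by omega
      rw [e2]
      ring
    rw [Finset.sum_range_succ, Finset.sum_congr rfl hG, Finset.sum_add_distrib,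
      Finset.sum_add_distrib, ← Finset.mul_sum, ← gW_succ,
      Finset.sum_range_sub' (fun m => (-1) ^ m * a ^ (m + 1) * gW q (s + 1 - m) w)]
    rw [Finset.sum_range_succ _ (s + 1)]
    have g0 : ∀ x, gW q 0 x = 1 := fun x => by rw [gW]
    simp only [Nat.sub_self, g0, hP, Nat.sub_zero]
    push_cast
    ring

lemma gr_succ_succ (q : ℝ) (s l : ℕ) (hl : 0 < l) :
    gr q (s + 1) (l + 1) = gr q (s + 1) l + ar q l * gr q s l := by
  rw [gr, gr]
  have : Finset.Ioo 0 (l + 1) = insert l (Finset.Ioo 0 l) := by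
    ext x; simp only [Finset.mem_Ioo, Finset.mem_insert]; omega
  rw [this, Finset.sum_insert (by simp), add_comm]

lemma powW_self (q : ℝ) (m : ℕ) : powW q m q = 0 := by
  unfold powW
  simp [pow_succ]

lemma gW_q_pow (h0 : 0 < q) (h1 : q < 1) (s l : ℕ) :
    gW q s ((q : ℂ) ^ (l + 1)) = (gr q s (l + 1) : ℂ) := by
  induction s generalizing l with
  | zero => rw [gW, gr]; simp
  | succ s ihs =>
    induction l with
    | zero =>
      rw [gW]
      have : Finset.Ioo 0 1 = (∅ : Finset ℕ) := by decide
      simp [powW_self, gr, this]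
    | succ l ihl =>
      have hw : ‖(q : ℂ) ^ (l + 1)‖ < 1 := by
        rw [norm_pow]; exact pow_lt_one₀ (norm_nonneg _) (norm_q_lt h0 h1) (by omega)
      rw [pow_succ' (q : ℂ) (l + 1), gW_mul_q h0 h1 s hw, ihl, ihs, aw_q_pow,
        gr_succ_succ q s (l + 1) (by omega)]
      push_cast; ring

lemma gammaW_q_pow (h0 : 0 < q) (h1 : q < 1) (s l : ℕ) :
    gammaW q s ((q : ℂ) ^ (l + 1)) = ((ar q (l + 1) * gr q s (l + 1) : ℝ) : ℂ) := by
  rw [gammaW, gW_q_pow h0 h1, aw_q_pow]; push_cast; ring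

end

section
variable {q : ℝ}

/-- Sorting the `(s+1)`-element sets by their largest element. -/
lemma sum_powersetCard_sup (a F : ℕ → ℂ) (s n : ℕ) :
    ∑ S ∈ (Finset.Ioo 0 n).powersetCard (s + 1), (∏ l ∈ S, a l) * F (S.sup id) =
      ∑ l ∈ Finset.Ioo 0 n, a l * F l * ∑ S ∈ (Finset.Ioo 0 l).powersetCard s, ∏ l ∈ S, a l := by
  have h0 : (∅ : Finset ℕ).powersetCard (s + 1) = ∅ := Finset.powersetCard_eq_empty.mpr (by simp)
  induction n with
  | zero => simp [h0]
  | succ n ih =>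
    rcases Nat.eq_zero_or_pos n with rfl | hn
    · have : Finset.Ioo 0 1 = (∅ : Finset ℕ) := by decide
      simp [this, h0]
    have e : Finset.Ioo 0 (n + 1) = insert n (Finset.Ioo 0 n) := by
      ext x; simp only [Finset.mem_Ioo, Finset.mem_insert]; omega
    have hn' : n ∉ Finset.Ioo 0 n := by simp
    have hmem : ∀ S ∈ (Finset.Ioo 0 n).powersetCard s, ∀ l ∈ S, l < n := fun S hS l hl =>
      (Finset.mem_Ioo.mp ((Finset.mem_powersetCard.mp hS).1 hl)).2
    rw [e, Finset.powersetCard_succ_insert hn', Finset.sum_insert hn', Finset.sum_union, ih,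
      add_comm]
    · congr 1
      rw [Finset.sum_image, Finset.mul_sum]
      · refine Finset.sum_congr rfl fun S hS => ?_
        have h1 : n ∉ S := fun h => lt_irrefl _ (hmem S hS n h)
        have h2 : S.sup id ≤ n := Finset.sup_le fun l hl => (hmem S hS l hl).le
        rw [Finset.prod_insert h1, Finset.sup_insert, id, sup_eq_left.mpr h2]
        ring
      · intro S hS T hT h
        have h1 : n ∉ S := fun h => lt_irrefl _ (hmem S hS n h)
        have h2 : n ∉ T := fun h => lt_irrefl _ (hmem T hT n h)
        rw [← Finset.erase_insert h1, ← Finset.erase_insert h2]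
        rw [show insert n S = insert n T from h]
    · rw [Finset.disjoint_left]
      intro S hS hS'
      obtain ⟨T, _, rfl⟩ := Finset.mem_image.mp hS'
      exact hn' ((Finset.mem_powersetCard.mp hS).1 (Finset.mem_insert_self n T))

lemma sum_powersetCard_prod_ar (q : ℝ) (s l : ℕ) :
    ∑ S ∈ (Finset.Ioo 0 l).powersetCard s, ∏ i ∈ S, (ar q i : ℂ) = (gr q s l : ℂ) := by
  induction s generalizing l with
  | zero => simp [gr]
  | succ s ih =>
    have := sum_powersetCard_sup (fun i => (ar q i : ℂ)) (fun _ => 1) s l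
    simp only [mul_one, ih] at this
    rw [this, gr]
    push_cast; rfl

/-- The real number `τ(k, m) / (1/(Q^(k-1)-1) - 1/(Q^k-1))` at integers `k` and `m`. -/
def tauR (q : ℝ) (k m : ℕ) : ℝ :=
  q / (1 - q) * q ^ m * ((k : ℝ) - m - 1) - q ^ 2 / (1 - q) ^ 2 * (q ^ m - q ^ k / q)

lemma tauCore_natCast (q : ℝ) (k m : ℕ) :
    tauCore q k m ((q : ℂ) ^ k) ((q : ℂ) ^ m) = (tauR q k m : ℂ) := by
  unfold tauCore tauR; push_cast; rfl

lemma tauR_pred (h0 : 0 < q) (k : ℕ) : tauR q (k + 1) k = 0 := by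
  unfold tauR; rw [pow_succ]; push_cast; field_simp; ring

lemma tauR_sub (h0 : 0 < q) (h1 : q < 1) (k m : ℕ) :
    tauR q k m - tauR q k (m + 1) = ((k : ℝ) - (m + 1)) * q ^ (m + 1) := by
  have : 1 - q ≠ 0 := by linarith
  unfold tauR; rw [pow_succ]; push_cast; field_simp; ring

lemma norm_q_pow_lt (h0 : 0 < q) (h1 : q < 1) {l : ℕ} (hl : l ≠ 0) : ‖(q : ℂ) ^ l‖ < 1 := by
  rw [norm_pow]; exact pow_lt_one₀ (norm_nonneg _) (norm_q_lt h0 h1) hl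

lemma q_pow_ne (h0 : 0 < q) (h1 : q < 1) (k : ℕ) : (q : ℂ) ^ (k + 2) ≠ q := by
  have hq : (q : ℂ) ≠ 0 := by exact_mod_cast h0.ne'
  intro h
  rw [pow_succ] at h
  have h2 := mul_right_cancel₀ hq (h.trans (one_mul (q : ℂ)).symm)
  have h3 := norm_q_pow_lt h0 h1 (Nat.succ_ne_zero k)
  rw [h2] at h3
  simp at h3

/-- At an integer `k`, the difference of the two series in the definition of `ψ_r(k)` telescopes. -/
lemma beta_mul_add_VW_natCast (h0 : 0 < q) (h1 : q < 1) (s k : ℕ) :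
    beta q (s + 2) * ((k + 1 : ℕ) : ℂ) + VW q (s + 2) ((q : ℂ) ^ (k + 1)) =
      ((∑ i ∈ Finset.range k, ar q (i + 1) * gr q s (i + 1) * tauR q (k + 1) (i + 1) : ℝ) : ℂ) := by
  have hw := norm_q_pow_lt h0 h1 (Nat.succ_ne_zero k)
  have s1 := summable_first h0 h1 s hw
  have s2 := (summable_gammaW h0 h1 s).mul_left ((q : ℂ) / (1 - q) * ((k + 1 : ℕ) : ℂ))
  have e1 : ∀ i : ℕ, gammaW q s ((q : ℂ) ^ (i + 1)) *
      tauCore q 0 ((i : ℂ) + 1) ((q : ℂ) ^ (k + 1)) ((q : ℂ) ^ (i + 1)) +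
      (q : ℂ) / (1 - q) * ((k + 1 : ℕ) : ℂ) *
        (gammaW q s ((q : ℂ) ^ (i + 1)) * (q : ℂ) ^ (i + 1)) =
      ((ar q (i + 1) * gr q s (i + 1) * tauR q (k + 1) (i + 1) : ℝ) : ℂ) := by
    intro i
    rw [gammaW_q_pow h0 h1, Complex.ofReal_mul _ (tauR _ _ _), ← tauCore_natCast,
      tauCore_eq q ((k + 1 : ℕ) : ℂ)]
    push_cast
    ring
  have e2 : ∀ i : ℕ, gammaW q s ((q : ℂ) ^ i * (q : ℂ) ^ (k + 1)) *
      tauCore q 0 i ((q : ℂ) ^ (k + 1)) ((q : ℂ) ^ i * (q : ℂ) ^ (k + 1)) =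
      ((ar q (i + k + 1) * gr q s (i + k + 1) * tauR q (k + 1) (i + k + 1) : ℝ) : ℂ) := by
    intro i
    rw [← pow_add, ← add_assoc, gammaW_q_pow h0 h1, Complex.ofReal_mul _ (tauR _ _ _),
      ← tauCore_natCast]
    unfold tauCore
    push_cast
    ring
  have s3 := s1.add s2
  rw [beta, VW]
  have e3 := s1.tsum_add s2
  rw [tsum_mul_left] at e3
  simp_rw [e1] at e3 s3
  simp_rw [e2]
  rw [← s3.sum_add_tsum_nat_add k] at e3
  rw [Complex.ofReal_sum]
  linear_combination -e3

/-- `ψ_r(k)` as a single sum over `g_{r-1}`. -/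
def psiR (q : ℝ) (r k : ℕ) : ℝ :=
  (ar q (k - 1) - ar q k) * ∑ m ∈ Finset.range (k - 1), ((k : ℝ) - (m + 1)) * q ^ (m + 1) *
    gr q (r - 1) (m + 1)

lemma aw_q_pow_sub (h0 : 0 < q) (k : ℕ) :
    aw ((q : ℂ) ^ (k + 1) / q) - aw ((q : ℂ) ^ (k + 1)) = ((ar q k - ar q (k + 1) : ℝ) : ℂ) := by
  have hq : (q : ℂ) ≠ 0 := by exact_mod_cast h0.ne'
  rw [pow_succ, mul_div_cancel_right₀ _ hq, ← pow_succ, aw_q_pow, aw_q_pow]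
  push_cast; rfl

/-- Summation by parts: the difference of `g_{s+1}` is `g_s(i) / (Q^i - 1)`, and that of `τ(k, ·)` is
elementary. -/
lemma sum_by_parts (h0 : 0 < q) (h1 : q < 1) (s k n : ℕ) :
    ∑ m ∈ Finset.range n, ((k : ℝ) - (m + 1)) * q ^ (m + 1) * gr q (s + 1) (m + 1) =
    ∑ i ∈ Finset.range n, ar q (i + 1) * gr q s (i + 1) * tauR q k (i + 1)
      - tauR q k n * gr q (s + 1) (n + 1) := by
  induction n with
  | zero =>
    have : Finset.Ioo 0 1 = (∅ : Finset ℕ) := by decide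
    simp [gr, this]
  | succ n ih =>
    rw [Finset.sum_range_succ, Finset.sum_range_succ, ih, ← tauR_sub h0 h1,
      gr_succ_succ q s (n + 1) (by omega)]
    ring

lemma sum_by_parts_zero (h0 : 0 < q) (h1 : q < 1) (k n : ℕ) :
    ∑ m ∈ Finset.range n, ((k : ℝ) - (m + 1)) * q ^ (m + 1) * gr q 0 (m + 1) =
    tauR q k 0 - tauR q k n := by
  induction n with
  | zero => simp
  | succ n ih =>
    rw [Finset.sum_range_succ, ih, ← tauR_sub h0 h1, gr]
    ring

/-- At integers the analytic extension is the elementary sum `psiR`. -/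
lemma psi_natCast (h0 : 0 < q) (h1 : q < 1) {r : ℕ} (hr : 1 ≤ r) {k : ℕ} (hk : 2 ≤ k) :
    psi q r k = (psiR q r k : ℂ) := by
  obtain ⟨k, rfl⟩ := Nat.exists_eq_add_of_le' hk
  have hw := norm_q_pow_lt h0 h1 (l := k + 2) (by omega)
  have hc : (q : ℂ) ^ ((k + 2 : ℕ) : ℂ) = (q : ℂ) ^ (k + 2) := Complex.cpow_natCast _ _
  rw [psi_eq h0 h1 r (by rw [hc]; exact q_pow_ne h0 h1 k) (by rw [hc]; exact hw), hc,
    aw_q_pow_sub h0 (k + 1), psiR, Complex.ofReal_mul]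
  congr 1
  match r, hr with
  | 1, _ =>
    rw [sum_by_parts_zero h0 h1, show k + 2 - 1 = k + 1 from rfl, tauR_pred h0 (k + 1), sub_zero,
      ← tauCore_natCast, beta, VW, tauCore_eq q ((k + 2 : ℕ) : ℂ)]
    simp only [Nat.cast_zero, pow_zero]
    ring
  | s + 2, _ =>
    rw [beta_mul_add_VW_natCast h0 h1 s (k + 1), show s + 2 - 1 = s + 1 from rfl,
      sum_by_parts h0 h1, show k + 2 - 1 = k + 1 from rfl, tauR_pred h0 (k + 1)]
    simp

lemma psi_eq_psiSum (h0 : 0 < q) (h1 : q < 1) {r : ℕ} (hr : 1 ≤ r) {k : ℕ} (hk : 2 ≤ k) :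
    psi q r k = psiSum q r k := by
  rw [psiSum]
  match r, hr with
  | 1, _ => simp [psi]
  | s + 2, _ =>
    obtain ⟨k, rfl⟩ := Nat.exists_eq_add_of_le' hk
    have hw := norm_q_pow_lt h0 h1 (l := k + 2) (by omega)
    have hc : (q : ℂ) ^ ((k + 2 : ℕ) : ℂ) = (q : ℂ) ^ (k + 2) := Complex.cpow_natCast _ _
    have hne : (q : ℂ) ^ ((k + 2 : ℕ) : ℂ) ≠ q := by rw [hc]; exact q_pow_ne h0 h1 k
    have hlt : ‖(q : ℂ) ^ ((k + 2 : ℕ) : ℂ)‖ < 1 := by rw [hc]; exact hw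
    have hQ : ∀ l : ℕ, 1 / Qm1 q (l : ℂ) = (ar q l : ℂ) := fun l => by
      rw [one_div_Qm1 h0, Complex.cpow_natCast, aw_q_pow]
    simp_rw [hQ]
    rw [show s + 2 - 1 = s + 1 from rfl,
      sum_powersetCard_sup (fun l => (ar q l : ℂ)) (fun m => tau q ((k + 2 : ℕ) : ℂ) m) s]
    simp_rw [sum_powersetCard_prod_ar]
    rw [psi_eq h0 h1 _ hne hlt, hc, beta_mul_add_VW_natCast h0 h1 s (k + 1), Finset.sum_range_succ,
      tauR_pred h0 (k + 1), mul_zero, add_zero, show k + 2 - 1 = k + 1 from rfl,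
      Complex.ofReal_sum, Finset.mul_sum]
    have e : Finset.Ioo 0 (k + 1) = (Finset.range k).image (· + 1) := by
      ext x
      simp only [Finset.mem_Ioo, Finset.mem_image, Finset.mem_range]
      constructor
      · rintro ⟨h1, h2⟩; exact ⟨x - 1, by omega, by omega⟩
      · rintro ⟨y, h1, rfl⟩; omega
    rw [e, Finset.sum_image (fun a _ b _ h => Nat.succ_injective h)]
    refine Finset.sum_congr rfl fun i _ => ?_
    rw [tau_eq h0 h1 _ hne (ne_one_of_norm_lt hlt), hc, Complex.cpow_natCast, tauCore_natCast]
    push_cast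
    ring

end

/-! ### Splitting off the first letter -/

open Classical in
/-- The number of left-to-right maxima of `w` that exceed `v`. -/
def recs {n : ℕ} (v : ℕ) (w : Fin n → ℕ) : ℕ :=
  (Finset.univ.filter fun j : Fin n => v < w j ∧ IsLTRMax w j).card

lemma isLTRMax_cons_succ {n : ℕ} (b : ℕ) (w : Fin n → ℕ) (j : Fin n) :
    IsLTRMax (Fin.cons b w : Fin (n + 1) → ℕ) j.succ ↔ b < w j ∧ IsLTRMax w j := by
  unfold IsLTRMax
  rw [Fin.forall_fin_succ]
  simp [Fin.succ_pos]

lemma isLTRMax_zero {n : ℕ} (w : Fin (n + 1) → ℕ) : IsLTRMax w 0 := fun j hj =>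
  absurd hj (Fin.not_lt_zero j)

open Classical in
lemma recs_cons {n : ℕ} (v b : ℕ) (w : Fin n → ℕ) :
    recs v (Fin.cons b w : Fin (n + 1) → ℕ) = if v < b then recs b w + 1 else recs v w := by
  unfold recs
  rw [Fin.card_filter_univ_succ]
  simp only [Fin.cons_zero, Fin.cons_succ, isLTRMax_cons_succ, isLTRMax_zero, and_true]
  split_ifs with h
  · congr 2
    ext j
    simp only [Finset.mem_filter]
    refine ⟨fun hj => ⟨hj.1, hj.2.2⟩, fun hj => ⟨hj.1, h.trans hj.2.1, hj.2⟩⟩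
  · congr 1
    ext j
    simp only [Finset.mem_filter]
    refine ⟨fun hj => ⟨hj.1, hj.2.1, hj.2.2.2⟩, fun hj => ⟨hj.1, hj.2.1, ?_, hj.2.2⟩⟩
    exact (not_lt.mp h).trans_lt hj.2.1

lemma isRthFromRight_cons_succ {n : ℕ} (r b : ℕ) (w : Fin n → ℕ) (i : Fin n) :
    IsRthFromRight r (Fin.cons b w : Fin (n + 1) → ℕ) i.succ ↔
      b < w i ∧ IsRthFromRight r w i := by
  classical
  unfold IsRthFromRight
  rw [isLTRMax_cons_succ, and_assoc]
  refine and_congr_right fun hb => and_congr_right fun hi => ?_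
  rw [Fin.card_filter_univ_succ, if_neg (by simp [Fin.succ_ne_zero])]
  simp only [isLTRMax_cons_succ, Fin.succ_le_succ_iff]
  have : (Finset.univ.filter fun j : Fin n => i ≤ j ∧ b < w j ∧ IsLTRMax w j) =
      Finset.univ.filter fun j : Fin n => i ≤ j ∧ IsLTRMax w j := by
    ext j
    simp only [Finset.mem_filter]
    refine ⟨fun hj => ⟨hj.1, hj.2.1, hj.2.2.2⟩, fun hj => ⟨hj.1, hj.2.1, ?_, hj.2.2⟩⟩
    rcases hj.2.1.eq_or_lt with rfl | hlt
    · exact hb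
    · exact hb.trans (hj.2.2 i hlt)
  rw [this]

lemma isRthFromRight_cons_zero {n : ℕ} (r b : ℕ) (w : Fin n → ℕ) :
    IsRthFromRight r (Fin.cons b w : Fin (n + 1) → ℕ) 0 ↔ recs b w + 1 = r := by
  classical
  unfold IsRthFromRight recs
  rw [Fin.card_filter_univ_succ]
  simp only [isLTRMax_zero, isLTRMax_cons_succ, Fin.zero_le, true_and, if_true]

/-! ### Integrals over words -/

section
variable {q : ℝ}

lemma letterLaw_weight (h1 : q < 1) (h0 : 0 < q) (k : ℕ) : 0 ≤ (1 - q) * q ^ k :=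
  mul_nonneg (by linarith) (by positivity)

lemma hasSum_letterLaw_weight (h0 : 0 < q) (h1 : q < 1) :
    HasSum (fun k : ℕ => (1 - q) * q ^ k) 1 := by
  have := (hasSum_geometric_of_lt_one h0.le h1).mul_left (1 - q)
  rwa [mul_inv_cancel₀ (by linarith)] at this

lemma isProbabilityMeasure_letterLaw (h0 : 0 < q) (h1 : q < 1) :
    IsProbabilityMeasure (letterLaw q) := by
  constructor
  rw [letterLaw, Measure.sum_apply _ MeasurableSet.univ]
  simp only [Measure.smul_apply, measure_univ, smul_eq_mul, mul_one]
  rw [← ENNReal.ofReal_tsum_of_nonneg (letterLaw_weight h1 h0)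
    (hasSum_letterLaw_weight h0 h1).summable, (hasSum_letterLaw_weight h0 h1).tsum_eq,
    ENNReal.ofReal_one]

lemma isProbabilityMeasure_wordLaw (h0 : 0 < q) (h1 : q < 1) (n : ℕ) :
    IsProbabilityMeasure (wordLaw q n) := by
  have := isProbabilityMeasure_letterLaw h0 h1
  unfold wordLaw
  infer_instance

lemma integrable_letterLaw (h0 : 0 < q) (h1 : q < 1) {f : ℕ → ℝ} {C : ℝ} (hf : ∀ k, |f k| ≤ C) :
    Integrable f (letterLaw q) := by
  have := isProbabilityMeasure_letterLaw h0 h1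
  exact Integrable.of_bound (measurable_of_countable f).aestronglyMeasurable C
    (Eventually.of_forall hf)

lemma integrable_wordLaw (h0 : 0 < q) (h1 : q < 1) {n : ℕ} {f : (Fin n → ℕ) → ℝ} {C : ℝ}
    (hf : ∀ k, |f k| ≤ C) : Integrable f (wordLaw q n) := by
  have := isProbabilityMeasure_wordLaw h0 h1 n
  exact Integrable.of_bound (measurable_of_countable f).aestronglyMeasurable C
    (Eventually.of_forall hf)

lemma hasSum_integral_letterLaw (h0 : 0 < q) (h1 : q < 1) {f : ℕ → ℝ} {C : ℝ}
    (hf : ∀ k, |f k| ≤ C) :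
    HasSum (fun k : ℕ => (1 - q) * q ^ k * f (k + 1)) (∫ b, f b ∂(letterLaw q)) := by
  have h := hasSum_integral_measure (integrable_letterLaw h0 h1 hf)
  have e : ∀ k : ℕ, ∫ b, f b ∂(ENNReal.ofReal ((1 - q) * q ^ k) • Measure.dirac (k + 1)) =
      (1 - q) * q ^ k * f (k + 1) := fun k => by
    rw [integral_smul_measure, integral_dirac, ENNReal.toReal_ofReal (letterLaw_weight h1 h0 k),
      smul_eq_mul]
  simp_rw [e] at h
  exact h

lemma integral_wordLaw_succ (h0 : 0 < q) (h1 : q < 1) {n : ℕ} {F : (Fin (n + 1) → ℕ) → ℝ} {C : ℝ}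
    (hF : ∀ w, |F w| ≤ C) :
    ∫ w, F w ∂(wordLaw q (n + 1)) =
      ∫ b, ∫ w, F (Fin.cons b w) ∂(wordLaw q n) ∂(letterLaw q) := by
  have := isProbabilityMeasure_letterLaw h0 h1
  have := isProbabilityMeasure_wordLaw h0 h1 n
  have hp := (measurePreserving_piFinSuccAbove (fun _ : Fin (n + 1) => letterLaw q) 0).symm
  have h := hp.integral_comp' F
  unfold wordLaw at *
  rw [← h]
  rw [integral_prod]
  · simp [MeasurableEquiv.piFinSuccAbove, Fin.consEquiv]
  · refine Integrable.of_bound (C := C) (measurable_of_countable _).aestronglyMeasurable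
      (Eventually.of_forall fun _ => hF _)

lemma integral_wordLaw_succ' (h0 : 0 < q) (h1 : q < 1) {n : ℕ} {F : (Fin (n + 1) → ℕ) → ℝ} {C : ℝ}
    (hF : ∀ w, |F w| ≤ C) :
    ∫ w, F w ∂(wordLaw q (n + 1)) =
      ∫ w, ∫ b, F (Fin.cons b w) ∂(letterLaw q) ∂(wordLaw q n) := by
  have := isProbabilityMeasure_letterLaw h0 h1
  have := isProbabilityMeasure_wordLaw h0 h1 n
  rw [integral_wordLaw_succ h0 h1 hF]
  refine integral_integral_swap ?_
  exact Integrable.of_bound (C := C) (measurable_of_countable _).aestronglyMeasurable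
      (Eventually.of_forall fun _ => hF _)

end

section
variable {q : ℝ}

/-- The probability that a word of `m` letters has exactly `s` left-to-right maxima above `v`. -/
def prec (q : ℝ) (s m v : ℕ) : ℝ := ∫ w, (if recs v w = s then 1 else 0 : ℝ) ∂(wordLaw q m)

lemma abs_ite_le_one (P : Prop) [Decidable P] : |(if P then 1 else 0 : ℝ)| ≤ 1 := by
  split_ifs <;> simp

lemma prec_nonneg (q : ℝ) (s m v : ℕ) : 0 ≤ prec q s m v :=
  integral_nonneg fun w => by dsimp only; split_ifs <;> simp

lemma prec_le_one (h0 : 0 < q) (h1 : q < 1) (s m v : ℕ) : prec q s m v ≤ 1 := by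
  have := isProbabilityMeasure_wordLaw h0 h1 m
  have h : prec q s m v ≤ ∫ _, (1 : ℝ) ∂(wordLaw q m) :=
    integral_mono (integrable_wordLaw h0 h1 fun w => abs_ite_le_one _) (integrable_const _)
      fun w => by dsimp only; split_ifs <;> simp
  simpa using h

lemma abs_prec_le_one (h0 : 0 < q) (h1 : q < 1) (s m v : ℕ) : |prec q s m v| ≤ 1 := by
  rw [abs_of_nonneg (prec_nonneg q s m v)]; exact prec_le_one h0 h1 s m v

lemma prec_zero (h0 : 0 < q) (h1 : q < 1) (s v : ℕ) : prec q s 0 v = if s = 0 then 1 else 0 := by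
  have := isProbabilityMeasure_wordLaw h0 h1 0
  have e : ∀ w : Fin 0 → ℕ, recs v w = 0 := fun w => by simp [recs]
  unfold prec
  simp only [e, eq_comm (a := 0)]
  simp

lemma prec_succ (h0 : 0 < q) (h1 : q < 1) (s m v : ℕ) :
    prec q s (m + 1) v = ∫ b, (if v < b then (if s = 0 then 0 else prec q (s - 1) m b)
      else prec q s m v) ∂(letterLaw q) := by
  unfold prec
  rw [integral_wordLaw_succ h0 h1 fun w => abs_ite_le_one _]
  congr 1; ext b
  simp only [recs_cons]
  split_ifs with hb hs
  · subst hs; simp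
  · have : ∀ x, x + 1 = s ↔ x = s - 1 := fun x => by omega
    simp only [this]
  · rfl

lemma hasSum_tail (h0 : 0 < q) (h1 : q < 1) (v k : ℕ) :
    HasSum (fun i : ℕ => (1 - q) * q ^ i * (if v < i + 1 then (q ^ (i + 1)) ^ k else 0))
      ((1 - q) / q * q ^ (v * (k + 1)) * ar q (k + 1)) := by
  have hk : q ^ (k + 1) < 1 := pow_lt_one₀ h0.le h1 (by omega)
  have e := (hasSum_geometric_of_lt_one (by positivity) hk).mul_left
    ((1 - q) * q ^ (v * (k + 1)) * q ^ k)
  rw [← hasSum_nat_add_iff' v]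
  have z : ∑ i ∈ Finset.range v, (1 - q) * q ^ i * (if v < i + 1 then (q ^ (i + 1)) ^ k else 0) = 0 :=
    Finset.sum_eq_zero fun i hi => by
      rw [if_neg (by have := Finset.mem_range.mp hi; omega), mul_zero]
  rw [z, sub_zero]
  have e1 : (fun i : ℕ => (1 - q) * q ^ (i + v) *
      (if v < i + v + 1 then (q ^ (i + v + 1)) ^ k else 0)) =
      fun i => (1 - q) * q ^ (v * (k + 1)) * q ^ k * (q ^ (k + 1)) ^ i := by
    ext i
    rw [if_pos (by omega)]
    ring
  have e2 : (1 - q) / q * q ^ (v * (k + 1)) * ar q (k + 1) =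
      (1 - q) * q ^ (v * (k + 1)) * q ^ k * (1 - q ^ (k + 1))⁻¹ := by
    unfold ar
    rw [pow_succ q k]
    field_simp
  rw [e1, e2]
  exact e

lemma integral_tail (h0 : 0 < q) (h1 : q < 1) (v k : ℕ) :
    ∫ b, (if v < b then (q ^ b) ^ k else 0) ∂(letterLaw q) =
      (1 - q) / q * q ^ (v * (k + 1)) * ar q (k + 1) := by
  refine (hasSum_integral_letterLaw h0 h1 (C := 1) fun b => ?_).unique (hasSum_tail h0 h1 v k)
  split_ifs
  · rw [abs_of_nonneg (by positivity)]
    exact pow_le_one₀ (by positivity) (pow_le_one₀ h0.le h1.le)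
  · simp

lemma one_sub_q_pow_pos (h0 : 0 < q) (h1 : q < 1) (k : ℕ) : 0 < 1 - q ^ (k + 1) := by
  have := pow_lt_one₀ h0.le h1 (Nat.succ_ne_zero k)
  simp only [Nat.succ_eq_add_one] at this
  linarith

lemma integral_gt (h0 : 0 < q) (h1 : q < 1) (v : ℕ) :
    ∫ b, (if v < b then 1 else 0 : ℝ) ∂(letterLaw q) = q ^ v := by
  have h := integral_tail h0 h1 v 0
  simp only [pow_zero] at h
  rw [h, ar]
  have : (1 - q) ≠ 0 := by linarith
  simp
  field_simp

lemma integral_le (h0 : 0 < q) (h1 : q < 1) (v : ℕ) :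
    ∫ b, (if v < b then 0 else 1 : ℝ) ∂(letterLaw q) = 1 - q ^ v := by
  have := isProbabilityMeasure_letterLaw h0 h1
  have e : ∀ b, (if v < b then 0 else 1 : ℝ) = 1 - (if v < b then 1 else 0 : ℝ) := fun b => by
    split_ifs <;> simp
  simp_rw [e]
  rw [integral_sub (integrable_const _) (integrable_letterLaw h0 h1 fun _ => abs_ite_le_one _),
    integral_gt h0 h1]
  simp

/-- The coefficients of the binomial transform of `m ↦ prec q s m v`. -/
def bcoef (q : ℝ) (s k : ℕ) : ℝ := (-((1 - q) / q)) ^ s * gr q s (k + 1)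

lemma bcoef_succ (q : ℝ) (s k : ℕ) :
    bcoef q (s + 1) (k + 1) = bcoef q (s + 1) k - (1 - q) / q * ar q (k + 1) * bcoef q s k := by
  unfold bcoef
  rw [gr_succ_succ q s (k + 1) (by omega)]
  ring

lemma sum_choose_succ (u : ℕ → ℝ) (m : ℕ) :
    ∑ k ∈ Finset.range (m + 2), ((m + 1).choose k : ℝ) * (-1) ^ k * u k =
      ∑ k ∈ Finset.range (m + 1), (m.choose k : ℝ) * (-1) ^ k * (u k - u (k + 1)) := by
  have e : ∑ k ∈ Finset.range (m + 1), (m.choose k : ℝ) * (-1) ^ k * u k =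
      ∑ k ∈ Finset.range (m + 2), (m.choose k : ℝ) * (-1) ^ k * u k := by
    rw [Finset.sum_range_succ _ (m + 1)]; simp
  simp_rw [mul_sub]
  rw [Finset.sum_sub_distrib, e, Finset.sum_range_succ', Finset.sum_range_succ' _ (m + 1)]
  simp only [Nat.choose_succ_succ, Nat.choose_zero_right]
  push_cast
  have : ∀ k, ((m.choose k : ℝ) + (m.choose (k + 1) : ℝ)) * (-1) ^ (k + 1) * u (k + 1) =
    (m.choose (k + 1) : ℝ) * (-1) ^ (k + 1) * u (k + 1)
      - (m.choose k : ℝ) * (-1) ^ k * u (k + 1) := fun k => by ring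
  simp_rw [this]
  rw [Finset.sum_sub_distrib]
  ring

/-- The law of the number of left-to-right maxima above level `v`, as a binomial transform in the
length `m`. Conditioning on the first letter reproduces the recursion of `gr`. -/
lemma prec_eq (h0 : 0 < q) (h1 : q < 1) (s m v : ℕ) :
    prec q s m v = ∑ k ∈ Finset.range (m + 1),
      (m.choose k : ℝ) * (-1) ^ k * ((q ^ v) ^ k * bcoef q s k) := by
  induction m generalizing s v with
  | zero =>
    rw [prec_zero h0 h1]
    cases s with
    | zero => simp [bcoef, gr]
    | succ s =>
      have : Finset.Ioo 0 1 = (∅ : Finset ℕ) := by decide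
      simp [bcoef, gr, this]
  | succ m ih =>
    rw [prec_succ h0 h1, sum_choose_succ]
    have i1 : Integrable (fun b => (if v < b then 0 else 1 : ℝ) * prec q s m v) (letterLaw q) :=
      (integrable_letterLaw h0 h1 (C := 1) fun b => by split_ifs <;> simp).mul_const _
    cases s with
    | zero =>
      have e : ∀ b, (if v < b then (if 0 = 0 then 0 else prec q (0 - 1) m b)
        else prec q 0 m v) = (if v < b then 0 else 1 : ℝ) * prec q 0 m v := fun b => by
          by_cases hb : v < b <;> simp [hb]
      refine (integral_congr_ae (Eventually.of_forall e)).trans ?_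
      rw [integral_mul_const, integral_le h0 h1, ih, Finset.mul_sum]
      refine Finset.sum_congr rfl fun k _ => ?_
      simp only [bcoef, gr]
      ring
    | succ s =>
      have e : ∀ b, (if v < b then (if s + 1 = 0 then 0 else prec q (s + 1 - 1) m b)
        else prec q (s + 1) m v) = (if v < b then 0 else 1 : ℝ) * prec q (s + 1) m v +
        ∑ k ∈ Finset.range (m + 1), (if v < b then (q ^ b) ^ k else 0) *
          ((m.choose k : ℝ) * (-1) ^ k * bcoef q s k) := fun b => by
          by_cases hb : v < b
          · simp only [if_pos hb, if_neg (Nat.succ_ne_zero s)]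
            rw [Nat.add_sub_cancel, ih, zero_mul, zero_add]
            exact Finset.sum_congr rfl fun k _ => by ring
          · simp [hb]
      have i2 : ∀ k ∈ Finset.range (m + 1), Integrable (fun b => (if v < b then (q ^ b) ^ k else 0) *
          ((m.choose k : ℝ) * (-1) ^ k * bcoef q s k)) (letterLaw q) := fun k _ =>
        (integrable_letterLaw h0 h1 (C := 1) fun b => by
          split_ifs
          · rw [abs_of_nonneg (by positivity)]
            exact pow_le_one₀ (by positivity) (pow_le_one₀ h0.le h1.le)
          · simp).mul_const _
      simp_rw [e]
      rw [integral_add i1 (integrable_finsetSum _ i2), integral_finsetSum _ i2, integral_mul_const,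
        integral_le h0 h1, ih, Finset.mul_sum, ← Finset.sum_add_distrib]
      refine Finset.sum_congr rfl fun k _ => ?_
      rw [integral_mul_const, integral_tail h0 h1, bcoef_succ, pow_mul]
      ring

open Classical in
/-- The law of the position and of the value of the `r`th maximum from the right: the letters
before it are smaller, and the letters after it contain `r - 1` further left-to-right maxima. -/
lemma integral_isRth (h0 : 0 < q) (h1 : q < 1) (r : ℕ) (hr : 1 ≤ r) {n : ℕ} (i : Fin n) (u : ℕ → ℝ)
    (hu : ∀ k, |u k| ≤ 1) :
    ∫ w, (if IsRthFromRight r w i then u (w i) else 0) ∂(wordLaw q n) =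
      ∑' ν : ℕ, (1 - q) * q ^ ν * (u (ν + 1) * (1 - q ^ ν) ^ (i : ℕ) *
        prec q (r - 1) (n - 1 - i) (ν + 1)) := by
  have hb : ∀ {m : ℕ} (j : Fin m) (u : ℕ → ℝ), (∀ k, |u k| ≤ 1) → ∀ w : Fin m → ℕ,
      |(if IsRthFromRight r w j then u (w j) else 0)| ≤ 1 := fun j u hu w => by
    split_ifs
    · exact hu _
    · simp
  induction n generalizing u with
  | zero => exact i.elim0
  | succ n ih =>
    refine Fin.cases ?_ (fun i => ?_) i
    · rw [integral_wordLaw_succ h0 h1 (hb _ u hu)]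
      have hrr : ∀ x, x + 1 = r ↔ x = r - 1 := fun x => by omega
      simp only [isRthFromRight_cons_zero, Fin.cons_zero, hrr]
      have e : ∀ b, ∫ w, (if recs b w = r - 1 then u b else 0) ∂(wordLaw q n) =
          u b * prec q (r - 1) n b := fun b => by
        unfold prec
        rw [← integral_const_mul]
        simp
      simp_rw [e]
      have hs := hasSum_integral_letterLaw h0 h1 (f := fun b => u b * prec q (r - 1) n b) (C := 1)
        fun b => by
          rw [abs_mul]
          exact mul_le_one₀ (hu b) (abs_nonneg _) (abs_prec_le_one h0 h1 _ _ _)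
      rw [← hs.tsum_eq]
      simp
    · rw [integral_wordLaw_succ' h0 h1 (hb _ u hu)]
      simp only [isRthFromRight_cons_succ, Fin.cons_succ]
      have e : ∀ w : Fin n → ℕ, ∫ b, (if b < w i ∧ IsRthFromRight r w i then u (w i) else 0)
          ∂(letterLaw q) = if IsRthFromRight r w i then
            (fun a => u a * ∫ b, (if b < a then 1 else 0 : ℝ) ∂(letterLaw q)) (w i) else 0 :=
        fun w => by
          by_cases h : IsRthFromRight r w i
          · simp only [h, and_true, if_true]
            rw [← integral_const_mul]
            simp
          · simp [h]
      simp_rw [e]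
      have hlt : ∀ ν : ℕ, ∫ b, (if b < ν + 1 then 1 else 0 : ℝ) ∂(letterLaw q) = 1 - q ^ ν :=
        fun ν => by
          rw [← integral_le h0 h1]
          congr 1; ext b
          by_cases hb : ν < b
          · rw [if_neg (by omega), if_pos hb]
          · rw [if_pos (by omega), if_neg hb]
      refine (ih i (fun a => u a * ∫ b, (if b < a then 1 else 0 : ℝ) ∂(letterLaw q))
        fun a => ?_).trans ?_
      rotate_left
      · congr 1; ext ν
        simp only [hlt]
        rw [Fin.val_succ, pow_succ, show n + 1 - 1 - ((i : ℕ) + 1) = n - 1 - i by omega]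
        ring
      · rw [abs_mul]
        refine mul_le_one₀ (hu a) (abs_nonneg _) ?_
        have := isProbabilityMeasure_letterLaw h0 h1
        rw [abs_of_nonneg (integral_nonneg fun b => by dsimp only; split_ifs <;> simp)]
        have h : ∫ b, (if b < a then 1 else 0 : ℝ) ∂(letterLaw q) ≤ ∫ _, (1 : ℝ) ∂(letterLaw q) :=
          integral_mono (integrable_letterLaw h0 h1 fun w => abs_ite_le_one _) (integrable_const _)
            fun w => by dsimp only; split_ifs <;> simp
        simpa using h

lemma avgPos_eq (h0 : 0 < q) (h1 : q < 1) (r : ℕ) (hr : 1 ≤ r) (n : ℕ) :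
    avgPos q r n = ∑ i ∈ Finset.range n, (i : ℝ) * ∑' ν : ℕ, (1 - q) * q ^ ν * ((1 - q ^ ν) ^ i *
        prec q (r - 1) (n - 1 - i) (ν + 1)) := by
  classical
  have e : ∀ w : Fin n → ℕ, (lettersLeft r w : ℝ) =
      ∑ i : Fin n, (i : ℝ) * (if IsRthFromRight r w i then 1 else 0) := fun w => by
    unfold lettersLeft
    rw [Finset.sum_filter]
    push_cast
    refine Finset.sum_congr rfl fun i _ => ?_
    split_ifs <;> simp
  unfold avgPos
  simp_rw [e]
  rw [integral_finsetSum _ fun i _ => (integrable_wordLaw h0 h1 fun w =>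
    abs_ite_le_one _).const_mul _, ← Fin.sum_univ_eq_sum_range (fun i => (i : ℝ) * ∑' ν : ℕ,
      (1 - q) * q ^ ν * ((1 - q ^ ν) ^ i * prec q (r - 1) (n - 1 - i) (ν + 1)))]
  refine Finset.sum_congr rfl fun i _ => ?_
  rw [integral_const_mul]
  have := integral_isRth h0 h1 r hr i (fun _ => 1) (by simp)
  rw [this]
  simp

end

/-! ### The exact formula for the expectation -/

/-- The coefficient with which the `k`th term of the law of the left-to-right maxima enters the
expectation, for a letter that is a maximum with probability `(1 - u) ^ i` at position `i`. -/
lemma sum_pow_mul_choose (u : ℝ) (n k : ℕ) :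
    ∑ i ∈ Finset.range n, (i : ℝ) * (1 - u) ^ i * ((n - 1 - i).choose k : ℝ) =
      ∑ j ∈ Finset.range n, (n.choose (k + 2 + j) : ℝ) * (-1) ^ j * (j + 1) * u ^ j * (1 - u) := by
  induction n generalizing k with
  | zero => simp
  | succ n ih =>
    rw [Finset.sum_range_succ, Finset.sum_range_succ, Nat.choose_eq_zero_of_lt
      (show n + 1 < k + 2 + n by omega)]
    have hR : ∑ j ∈ Finset.range n, ((n + 1).choose (k + 2 + j) : ℝ) * (-1) ^ j * (j + 1) * u ^ j *
        (1 - u) = ∑ j ∈ Finset.range n, (n.choose (k + 1 + j) : ℝ) * (-1) ^ j * (j + 1) * u ^ j *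
        (1 - u) + ∑ j ∈ Finset.range n, (n.choose (k + 2 + j) : ℝ) * (-1) ^ j * (j + 1) * u ^ j *
        (1 - u) := by
      rw [← Finset.sum_add_distrib]
      refine Finset.sum_congr rfl fun j _ => ?_
      rw [show k + 2 + j = (k + 1 + j) + 1 by omega, Nat.choose_succ_succ]
      push_cast
      ring
    rw [hR]
    cases k with
    | zero =>
      have h0 := ih 0
      simp only [Nat.choose_zero_right, Nat.cast_one, mul_one, zero_add] at h0 ⊢
      rw [h0]
      have : ∑ j ∈ Finset.range n, (n.choose (1 + j) : ℝ) * (-1) ^ j * (j + 1) * u ^ j * (1 - u) =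
          (n : ℝ) * (1 - u) ^ n := by
        cases n with
        | zero => simp
        | succ m =>
          have e := add_pow (-u) 1 m
          simp only [one_pow, mul_one] at e
          rw [pow_succ, show 1 - u = -u + 1 by ring, e, Finset.sum_mul, Finset.mul_sum]
          refine Finset.sum_congr rfl fun j _ => ?_
          have hc := Nat.add_one_mul_choose_eq m j
          have hc' : ((m : ℝ) + 1) * (m.choose j : ℝ) = ((m + 1).choose (j + 1) : ℝ) * (j + 1) := by
            exact_mod_cast hc
          rw [add_comm 1 j, neg_pow]
          push_cast
          linear_combination (-(-1 : ℝ) ^ j * u ^ j * (-u + 1)) * hc'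
      rw [this]
      push_cast
      ring
    | succ k =>
      have hL : ∑ i ∈ Finset.range n, (i : ℝ) * (1 - u) ^ i * ((n + 1 - 1 - i).choose (k + 1) : ℝ) =
          ∑ i ∈ Finset.range n, (i : ℝ) * (1 - u) ^ i * ((n - 1 - i).choose k : ℝ) +
          ∑ i ∈ Finset.range n, (i : ℝ) * (1 - u) ^ i * ((n - 1 - i).choose (k + 1) : ℝ) := by
        rw [← Finset.sum_add_distrib]
        refine Finset.sum_congr rfl fun i hi => ?_
        have := Finset.mem_range.mp hi
        rw [show n + 1 - 1 - i = (n - 1 - i) + 1 by omega, Nat.choose_succ_succ]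
        push_cast
        ring
      rw [hL, ih, ih]
      simp only [Nat.add_sub_cancel, Nat.sub_self, Nat.choose_zero_succ, Nat.cast_zero]
      have : ∀ j, k + 1 + 1 + j = k + 2 + j := fun j => by omega
      simp only [this]
      ring

section
variable {q : ℝ}

lemma hasSum_pow_sub (h0 : 0 < q) (h1 : q < 1) (t : ℕ) :
    HasSum (fun ν : ℕ => (1 - q) * q ^ ν * ((q ^ ν) ^ t * (1 - q ^ ν)))
      ((1 - q) * (ar q (t + 1) - ar q (t + 2))) := by
  have e1 := hasSum_geometric_of_lt_one (by positivity) (pow_lt_one₀ h0.le h1 (Nat.succ_ne_zero t))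
  have e2 := hasSum_geometric_of_lt_one (by positivity)
    (pow_lt_one₀ h0.le h1 (Nat.succ_ne_zero (t + 1)))
  have e3 := (e1.sub e2).mul_left (1 - q)
  have f1 := (one_sub_q_pow_pos h0 h1 t).ne'
  have f2 := (one_sub_q_pow_pos h0 h1 (t + 1)).ne'
  have a1 : ∀ k : ℕ, 1 - q ^ (k + 1) ≠ 0 → (1 - q ^ (k + 1))⁻¹ = 1 + ar q (k + 1) := fun k hk => by
    unfold ar; field_simp; ring
  have e4 : ((1 - q ^ t.succ)⁻¹ - (1 - q ^ (t + 1).succ)⁻¹) = ar q (t + 1) - ar q (t + 2) := by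
    rw [Nat.succ_eq_add_one, Nat.succ_eq_add_one, a1 _ f1, a1 _ f2]; ring
  rw [e4] at e3
  have e5 : (fun ν : ℕ => (1 - q) * q ^ ν * ((q ^ ν) ^ t * (1 - q ^ ν))) =
      fun ν => (1 - q) * ((q ^ t.succ) ^ ν - (q ^ (t + 1).succ) ^ ν) := by
    ext ν
    rw [← pow_mul, ← pow_mul, ← pow_mul, Nat.succ_mul, Nat.succ_mul, Nat.succ_mul, pow_add,
      pow_add, pow_add, mul_comm t ν]
    ring
  rw [e5]
  exact e3

lemma summable_avgPos (h0 : 0 < q) (h1 : q < 1) (s i m : ℕ) :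
    Summable fun ν : ℕ => (1 - q) * q ^ ν * ((1 - q ^ ν) ^ i * prec q s m (ν + 1)) := by
  refine Summable.of_nonneg_of_le (fun ν => ?_) (fun ν => ?_)
    (hasSum_letterLaw_weight h0 h1).summable
  · have h2 : 0 ≤ 1 - q ^ ν := sub_nonneg.mpr (pow_le_one₀ h0.le h1.le)
    exact mul_nonneg (letterLaw_weight h1 h0 ν) (mul_nonneg (by positivity) (prec_nonneg _ _ _ _))
  · have h2 : 0 ≤ 1 - q ^ ν := sub_nonneg.mpr (pow_le_one₀ h0.le h1.le)
    have h3 : 1 - q ^ ν ≤ 1 := sub_le_self _ (by positivity)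
    refine mul_le_of_le_one_right (letterLaw_weight h1 h0 ν) ?_
    exact mul_le_one₀ (pow_le_one₀ h2 h3) (prec_nonneg _ _ _ _) (prec_le_one h0 h1 _ _ _)

/-- The sign and the power of `p / q` that relate `E_n^{(r)}` and `ψ_r`. -/
def sgnC (q : ℝ) (r : ℕ) : ℝ := (-1) ^ (r - 1) * ((1 - q) / q) ^ r

/-- The expectation is the alternating sum `∑_{k ≥ 2} C(n, k) (-1)^k ψ_r(k)`, up to the factor
`sgnC`; here `k = t + 2`. -/
lemma avgPos_eq_sum_psiR (h0 : 0 < q) (h1 : q < 1) (r : ℕ) (hr : 1 ≤ r) (n : ℕ) :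
    avgPos q r n = sgnC q r *
      ∑ t ∈ Finset.range n, (n.choose (t + 2) : ℝ) * (-1) ^ t * psiR q r (t + 2) := by
  obtain ⟨s, rfl⟩ := Nat.exists_eq_add_of_le' hr
  rw [avgPos_eq h0 h1 _ hr]
  simp only [Nat.add_sub_cancel]
  simp_rw [← tsum_mul_left]
  rw [← Summable.tsum_finsetSum fun i _ => (summable_avgPos h0 h1 s i _).mul_left _]
  have e : ∀ ν : ℕ, ∑ i ∈ Finset.range n, (i : ℝ) * ((1 - q) * q ^ ν * ((1 - q ^ ν) ^ i *
      prec q s (n - 1 - i) (ν + 1))) =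
      ∑ k ∈ Finset.range n, ∑ j ∈ Finset.range n, ((n.choose (k + j + 2) : ℝ) * (-1) ^ (k + j) *
        (j + 1) * q ^ k * bcoef q s k) *
        ((1 - q) * q ^ ν * ((q ^ ν) ^ (k + j) * (1 - q ^ ν))) := by
    intro ν
    have e1 : ∀ i ∈ Finset.range n, (i : ℝ) * ((1 - q) * q ^ ν * ((1 - q ^ ν) ^ i *
        prec q s (n - 1 - i) (ν + 1))) = ∑ k ∈ Finset.range n, ((1 - q) * q ^ ν) * ((-1) ^ k *
          ((q ^ (ν + 1)) ^ k * bcoef q s k)) * ((i : ℝ) * (1 - q ^ ν) ^ i *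
            ((n - 1 - i).choose k : ℝ)) := by
      intro i hi
      have hi := Finset.mem_range.mp hi
      rw [prec_eq h0 h1, Finset.sum_subset (s₁ := Finset.range (n - 1 - i + 1))
        (s₂ := Finset.range n), Finset.mul_sum, Finset.mul_sum, Finset.mul_sum]
      · exact Finset.sum_congr rfl fun k _ => by ring
      · exact Finset.range_mono (by omega)
      · intro k _ hk
        rw [Nat.choose_eq_zero_of_lt (by simp at hk; omega)]
        simp
    rw [Finset.sum_congr rfl e1, Finset.sum_comm]
    refine Finset.sum_congr rfl fun k _ => ?_
    rw [← Finset.mul_sum, sum_pow_mul_choose, Finset.mul_sum]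
    refine Finset.sum_congr rfl fun j _ => ?_
    rw [show k + 2 + j = k + j + 2 by omega, pow_succ q ν, mul_pow, pow_add, pow_add]
    ring
  simp_rw [e]
  have hs := hasSum_sum (s := Finset.range n) fun k _ =>
    hasSum_sum (s := Finset.range n) fun j _ =>
    (hasSum_pow_sub h0 h1 (k + j)).mul_left ((n.choose (k + j + 2) : ℝ) * (-1) ^ (k + j) *
        (j + 1) * q ^ k * bcoef q s k)
  rw [hs.tsum_eq]
  have hd := Finset.sum_range_diag_flip n fun k j => (n.choose (k + j + 2) : ℝ) * (-1) ^ (k + j) *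
        (j + 1) * q ^ k * bcoef q s k * ((1 - q) * (ar q (k + j + 1) - ar q (k + j + 2)))
  have hd2 : ∀ k ∈ Finset.range n, ∑ j ∈ Finset.range n, (n.choose (k + j + 2) : ℝ) *
      (-1) ^ (k + j) * (j + 1) * q ^ k * bcoef q s k *
        ((1 - q) * (ar q (k + j + 1) - ar q (k + j + 2))) =
      ∑ j ∈ Finset.range (n - k), (n.choose (k + j + 2) : ℝ) *
      (-1) ^ (k + j) * (j + 1) * q ^ k * bcoef q s k *
        ((1 - q) * (ar q (k + j + 1) - ar q (k + j + 2))) := by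
    intro k _
    refine (Finset.sum_subset (Finset.range_mono (by omega)) fun j _ hj => ?_).symm
    rw [Nat.choose_eq_zero_of_lt (by simp at hj; omega)]
    simp
  rw [Finset.sum_congr rfl hd2, ← hd, Finset.mul_sum]
  refine Finset.sum_congr rfl fun t _ => ?_
  rw [psiR, show t + 2 - 1 = t + 1 from rfl, Finset.mul_sum, Finset.mul_sum, Finset.mul_sum]
  refine Finset.sum_congr rfl fun k hk => ?_
  have hk := Finset.mem_range.mp hk
  rw [Nat.add_sub_cancel' (by omega : k ≤ t), Nat.cast_sub (by omega : k ≤ t), sgnC, bcoef,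
    Nat.add_sub_cancel, neg_pow ((1 - q) / q) s, pow_succ ((1 - q) / q), pow_succ q k]
  have hq := h0.ne'
  push_cast
  have : (1 - q) / q * q = 1 - q := by field_simp
  generalize (1 - q) / q = c at this ⊢
  linear_combination (-(n.choose (t + 2) : ℝ) * (-1) ^ t * (t - k + 1) * q ^ k * (-1) ^ s *
    c ^ s * gr q s (k + 1) * (ar q (t + 1) - ar q (t + 2))) * this

end

/-! ### Expansion of `ψ_r` in powers of `q ^ z` -/

/-- The Taylor coefficients of `hW` at `0`. -/
def hcoef (q : ℝ) (r j : ℕ) : ℂ := ((Nat.factorial j : ℂ))⁻¹ * iteratedDeriv j (hW q r) 0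

/-- The coefficient `β` as a real number. -/
def betaR (q : ℝ) : ℕ → ℝ
  | 0 => 0
  | 1 => q / (1 - q)
  | s + 2 => q / (1 - q) * ∑' i : ℕ, ar q (i + 1) * gr q s (i + 1) * q ^ (i + 1)

/-- The probability that a binomial variable with parameters `n` and `u` is at least `2`. -/
def binTail (n : ℕ) (u : ℝ) : ℝ := 1 - (1 - u) ^ n - n * u * (1 - u) ^ (n - 1)

lemma sum_choose_pow (n : ℕ) (u : ℝ) :
    ∑ t ∈ Finset.range n, (n.choose (t + 2) : ℝ) * (-1) ^ t * u ^ (t + 2) =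
      (1 - u) ^ n - 1 + n * u := by
  have e := add_pow (-u) 1 n
  have e2 : ∑ k ∈ Finset.range (n + 1), (-u) ^ k * 1 ^ (n - k) * (n.choose k : ℝ) =
      ∑ k ∈ Finset.range (n + 2), (-u) ^ k * 1 ^ (n - k) * (n.choose k : ℝ) := by
    rw [Finset.sum_range_succ _ (n + 1)]; simp
  rw [e2, Finset.sum_range_succ', Finset.sum_range_succ'] at e
  have e3 : ∀ t, (n.choose (t + 2) : ℝ) * (-1) ^ t * u ^ (t + 2) =
      (-u) ^ (t + 1 + 1) * 1 ^ (n - (t + 1 + 1)) * (n.choose (t + 1 + 1) : ℝ) := fun t => by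
    rw [neg_pow u]; simp only [one_pow]; ring
  simp_rw [e3]
  simp only [zero_add, pow_one, one_pow, mul_one, pow_zero, Nat.choose_one_right,
    Nat.choose_zero_right, Nat.cast_one] at e ⊢
  rw [show 1 - u = -u + 1 by ring, e]
  ring

lemma sum_choose_mul_pow (n : ℕ) (u : ℝ) :
    ∑ t ∈ Finset.range n, (n.choose (t + 2) : ℝ) * (-1) ^ t * ((t + 1) * u ^ (t + 2)) =
      binTail n u := by
  have h2 : ∑ t ∈ Finset.range n, (n.choose (t + 2) : ℝ) * (-1) ^ t * ((t + 2) * u ^ (t + 2)) =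
      n * u - n * u * (1 - u) ^ (n - 1) := by
    cases n with
    | zero => simp
    | succ m =>
      have e := add_pow (-u) 1 m
      have e2 : ∑ k ∈ Finset.range (m + 1), (-u) ^ k * 1 ^ (m - k) * (m.choose k : ℝ) =
          ∑ k ∈ Finset.range (m + 2), (-u) ^ k * 1 ^ (m - k) * (m.choose k : ℝ) := by
        rw [Finset.sum_range_succ _ (m + 1)]; simp
      rw [e2, Finset.sum_range_succ'] at e
      rw [Nat.add_sub_cancel, show 1 - u = -u + 1 by ring, e, mul_add, ← sub_sub, sub_right_comm]
      rw [Finset.mul_sum]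
      have e3 : ∀ t, ((m + 1).choose (t + 2) : ℝ) * (-1) ^ t * ((t + 2) * u ^ (t + 2)) =
          -(((m + 1 : ℕ) : ℝ) * u *
            ((-u) ^ (t + 1) * 1 ^ (m - (t + 1)) * (m.choose (t + 1) : ℝ))) := fun t => by
        have hc := Nat.add_one_mul_choose_eq m (t + 1)
        have hc' : ((m : ℝ) + 1) * (m.choose (t + 1) : ℝ) =
            ((m + 1).choose (t + 2) : ℝ) * (t + 2) := by
          have : ((m : ℝ) + 1) * (m.choose (t + 1) : ℝ) =
            ((m + 1).choose (t + 1 + 1) : ℝ) * (((t + 1 : ℕ) : ℝ) + 1) := by exact_mod_cast hc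
          rw [this]; push_cast; ring
        rw [neg_pow u, one_pow]
        push_cast
        linear_combination (-(-1 : ℝ) ^ t * u ^ (t + 2)) * hc'
      simp_rw [e3]
      rw [Finset.sum_neg_distrib]
      simp
  have h1 := sum_choose_pow n u
  unfold binTail
  have e : ∀ t : ℕ, (n.choose (t + 2) : ℝ) * (-1) ^ t * ((t + 1) * u ^ (t + 2)) =
    (n.choose (t + 2) : ℝ) * (-1) ^ t * ((t + 2) * u ^ (t + 2)) -
      (n.choose (t + 2) : ℝ) * (-1) ^ t * u ^ (t + 2) := fun t => by ring
  simp_rw [e]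
  rw [Finset.sum_sub_distrib, h1, h2]
  ring

section
variable {q : ℝ}

lemma beta_eq_betaR (h0 : 0 < q) (h1 : q < 1) (r : ℕ) : beta q r = (betaR q r : ℂ) := by
  match r with
  | 0 => simp [beta, betaR]
  | 1 => simp [beta, betaR]
  | s + 2 =>
    rw [beta, betaR]
    push_cast
    congr 2
    ext i
    rw [gammaW_q_pow h0 h1]
    push_cast
    ring

lemma hasSum_hcoef (h0 : 0 < q) (h1 : q < 1) (r : ℕ) {w : ℂ} (hw : ‖w‖ < 1) :
    HasSum (fun j => hcoef q r j * w ^ j) (hW q r w) := by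
  have h := Complex.hasSum_taylorSeries_on_ball (f := hW q r) (c := 0) (r := 1)
    (by simpa using differentiableOn_hW h0 h1 r) (z := w) (by simpa using hw)
  refine h.congr_fun ?_
  intro j
  simp [hcoef]
  ring

lemma hasSum_psiR (h0 : 0 < q) (h1 : q < 1) {r : ℕ} (hr : 1 ≤ r) (t : ℕ) :
    HasSum (fun j : ℕ => (betaR q r : ℂ) * ((q⁻¹ ^ j - 1 : ℝ) * (((t + 1) * (q ^ j) ^ (t + 2) : ℝ)))
      + hcoef q r j * (((q ^ j) ^ (t + 2) : ℝ) : ℂ)) (psiR q r (t + 2) : ℂ) := by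
  have hq : (q : ℂ) ≠ 0 := by exact_mod_cast h0.ne'
  have hw := norm_q_pow_lt h0 h1 (l := t + 2) (by omega)
  have hw' := norm_q_pow_lt h0 h1 (l := t + 1) (by omega)
  have hc : (q : ℂ) ^ ((t + 2 : ℕ) : ℂ) = (q : ℂ) ^ (t + 2) := Complex.cpow_natCast _ _
  rw [← psi_natCast h0 h1 hr (by omega), psi_eq_add_hW h0 h1 r
    (by rw [hc]; exact q_pow_ne h0 h1 t) (by rw [hc]; exact hw), hc, beta_eq_betaR h0 h1]
  have g1 := (hasSum_geometric_of_norm_lt_one hw').sub (hasSum_geometric_of_norm_lt_one hw)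
  have g2 := (g1.mul_left ((betaR q r : ℂ) * (((t + 2 : ℕ) : ℂ) - 1))).add (hasSum_hcoef h0 h1 r hw)
  have n1 : (1 : ℂ) - (q : ℂ) ^ (t + 1) ≠ 0 := sub_ne_zero.mpr (Ne.symm (ne_one_of_norm_lt hw'))
  have n2 : (1 : ℂ) - (q : ℂ) ^ (t + 2) ≠ 0 := sub_ne_zero.mpr (Ne.symm (ne_one_of_norm_lt hw))
  have e1 : aw ((q : ℂ) ^ (t + 2) / q) - aw ((q : ℂ) ^ (t + 2)) =
      (1 - (q : ℂ) ^ (t + 1))⁻¹ - (1 - (q : ℂ) ^ (t + 2))⁻¹ := by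
    have : (q : ℂ) ^ (t + 2) / q = (q : ℂ) ^ (t + 1) := by
      rw [pow_succ, mul_div_cancel_right₀ _ hq]
    rw [this]
    unfold aw
    field_simp
    ring
  rw [e1]
  refine g2.congr_fun ?_
  intro j
  have e2 : ((q : ℂ) ^ (t + 1)) ^ j = ((q : ℂ)⁻¹) ^ j * ((q : ℂ) ^ j) ^ (t + 2) := by
    rw [inv_pow, pow_succ _ (t + 1), ← pow_mul, ← pow_mul, mul_comm j (t + 1)]
    field_simp
  have e3 : ((q : ℂ) ^ (t + 2)) ^ j = ((q : ℂ) ^ j) ^ (t + 2) := by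
    rw [← pow_mul, ← pow_mul, mul_comm]
  rw [e2, e3]
  push_cast
  ring

/-- Expanding `ψ_r(k)` in powers of `q^k` and performing the alternating sum over `k` first. -/
lemma hasSum_avgPos (h0 : 0 < q) (h1 : q < 1) {r : ℕ} (hr : 1 ≤ r) (n : ℕ) :
    HasSum (fun j : ℕ => (sgnC q r : ℂ) * ((betaR q r : ℂ) * (((q⁻¹ ^ j - 1) * binTail n (q ^ j) : ℝ))
      + hcoef q r j * (((1 - q ^ j) ^ n - 1 + n * q ^ j : ℝ) : ℂ))) (avgPos q r n : ℂ) := by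
  rw [avgPos_eq_sum_psiR h0 h1 r hr, Complex.ofReal_mul, Complex.ofReal_sum]
  refine HasSum.mul_left _ ?_
  have h := hasSum_sum (s := Finset.range n) fun t _ =>
    (hasSum_psiR h0 h1 hr t).mul_left ((((n.choose (t + 2) : ℝ) * (-1) ^ t : ℝ)) : ℂ)
  have e : ∀ t, (((n.choose (t + 2) : ℝ) * (-1) ^ t * psiR q r (t + 2) : ℝ) : ℂ) =
    ((((n.choose (t + 2) : ℝ) * (-1) ^ t : ℝ)) : ℂ) * (psiR q r (t + 2) : ℂ) := fun t => by
      push_cast; ring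
  simp_rw [e]
  refine h.congr_fun ?_
  intro j
  rw [← sum_choose_mul_pow, ← sum_choose_pow, Complex.ofReal_mul, Complex.ofReal_sum,
    Complex.ofReal_sum, Finset.mul_sum, Finset.mul_sum, Finset.mul_sum, ← Finset.sum_add_distrib]
  refine Finset.sum_congr rfl fun t _ => ?_
  push_cast
  ring

end

/-! ### The limit of `E_n / n` along the logarithmic scale -/

/-- The limit shape of a single term: `θ(t) = P(Poisson(t) ≥ 2) / t`. -/
def theta (t : ℝ) : ℝ := (1 - Real.exp (-t) - t * Real.exp (-t)) / t

/-- The `1`-periodic sum of `θ(Q ^ x)` over integer translates. -/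
def perSum (q x : ℝ) : ℝ := ∑' j : ℤ, theta (Real.exp (Real.log q⁻¹ * (x + j)))

lemma theta_nonneg {t : ℝ} (ht : 0 < t) : 0 ≤ theta t := by
  refine div_nonneg ?_ ht.le
  have h := Real.add_one_le_exp t
  have e : Real.exp t * Real.exp (-t) = 1 := by rw [← Real.exp_add]; simp
  have := Real.exp_pos (-t)
  nlinarith

lemma theta_le_inv {t : ℝ} (ht : 0 < t) : theta t ≤ t⁻¹ := by
  unfold theta
  rw [div_eq_mul_inv]
  refine mul_le_of_le_one_left (by positivity) ?_
  have := Real.exp_pos (-t)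
  have := mul_pos ht this
  linarith

lemma theta_le_self {t : ℝ} (ht : 0 < t) : theta t ≤ t := by
  unfold theta
  rw [div_le_iff₀ ht]
  have h := Real.add_one_le_exp (-t)
  nlinarith

lemma mul_exp_neg_le_one (x : ℝ) : x * Real.exp (-x) ≤ 1 := by
  have h := Real.add_one_le_exp x
  have e : Real.exp x * Real.exp (-x) = 1 := by rw [← Real.exp_add]; simp
  have := Real.exp_pos (-x)
  nlinarith

lemma pow_sub_pow_le {a b : ℝ} (ha : 0 ≤ a) (hab : a ≤ b) (m : ℕ) :
    b ^ m - a ^ m ≤ (b - a) * (m * b ^ (m - 1)) := by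
  have hb : 0 ≤ b := ha.trans hab
  induction m with
  | zero => simp
  | succ m ih =>
    have h1 : a ^ m ≤ b ^ m := by gcongr
    have e : b ^ (m + 1) - a ^ (m + 1) = b * (b ^ m - a ^ m) + (b - a) * a ^ m := by ring
    have e2 : b * (m * b ^ (m - 1)) = m * b ^ m := by
      cases m with
      | zero => simp
      | succ k => rw [Nat.add_sub_cancel]; ring
    rw [e, Nat.add_sub_cancel]
    push_cast
    have h2 : b * (b ^ m - a ^ m) ≤ (b - a) * (m * b ^ m) := by
      calc _ ≤ b * ((b - a) * (m * b ^ (m - 1))) := by gcongr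
        _ = (b - a) * (b * (m * b ^ (m - 1))) := by ring
        _ = _ := by rw [e2]
    have h3 : (b - a) * a ^ m ≤ (b - a) * b ^ m :=
      mul_le_mul_of_nonneg_left h1 (by linarith)
    linarith

lemma exp_neg_sub_le {u : ℝ} (hu : 0 ≤ u) (hu1 : u ≤ 1) : Real.exp (-u) - (1 - u) ≤ u ^ 2 := by
  have h := Real.abs_exp_sub_one_sub_id_le (x := -u) (by rw [abs_neg, abs_of_nonneg hu]; exact hu1)
  have := (abs_le.mp h).2
  nlinarith

lemma exp_sub_pow_nonneg {u : ℝ} (hu1 : u ≤ 1) (m : ℕ) :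
    0 ≤ Real.exp (-u) ^ m - (1 - u) ^ m := by
  have h := Real.add_one_le_exp (-u)
  have : 1 - u ≤ Real.exp (-u) := by linarith
  have h0 : 0 ≤ 1 - u := by linarith
  have : (1 - u) ^ m ≤ Real.exp (-u) ^ m := by gcongr
  linarith

lemma exp_sub_pow_le {u : ℝ} (hu : 0 ≤ u) (hu1 : u ≤ 1) (m : ℕ) :
    Real.exp (-u) ^ m - (1 - u) ^ m ≤ u ^ 2 * (m * Real.exp (-u) ^ (m - 1)) := by
  have h := Real.add_one_le_exp (-u)
  refine (pow_sub_pow_le (by linarith) (by linarith) m).trans ?_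
  gcongr
  exact exp_neg_sub_le hu hu1

lemma exp_sub_pow_le_three_mul {u : ℝ} (hu : 0 ≤ u) (hu1 : u ≤ 1) (m : ℕ) :
    Real.exp (-u) ^ m - (1 - u) ^ m ≤ 3 * u := by
  refine (exp_sub_pow_le hu hu1 m).trans ?_
  cases m with
  | zero => simp; linarith
  | succ k =>
    rw [Nat.add_sub_cancel]
    have e : u * (((k + 1 : ℕ) : ℝ) * Real.exp (-u) ^ k) =
        (((k + 1 : ℕ) : ℝ) * u) * Real.exp (-(((k + 1 : ℕ) : ℝ) * u)) * Real.exp u := by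
      rw [← Real.exp_nat_mul, mul_assoc _ (Real.exp _), ← Real.exp_add]
      push_cast
      rw [show (k : ℝ) * -u = -((k + 1) * u) + u by ring]
      ring
    have h1 := mul_exp_neg_le_one (((k + 1 : ℕ) : ℝ) * u)
    have h2 : Real.exp u ≤ 3 := by
      have := Real.exp_le_exp.mpr hu1
      have := Real.exp_one_lt_d9
      linarith
    have h3 : u * (((k + 1 : ℕ) : ℝ) * Real.exp (-u) ^ k) ≤ 1 * 3 := by
      rw [e]
      exact mul_le_mul h1 h2 (Real.exp_pos _).le zero_le_one
    calc u ^ 2 * (((k + 1 : ℕ) : ℝ) * Real.exp (-u) ^ k)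
        = u * (u * (((k + 1 : ℕ) : ℝ) * Real.exp (-u) ^ k)) := by ring
      _ ≤ u * (1 * 3) := by gcongr
      _ = 3 * u := by ring

lemma binTail_nonneg {u : ℝ} (hu1 : u ≤ 1) (n : ℕ) : 0 ≤ binTail n u := by
  unfold binTail
  cases n with
  | zero => simp
  | succ m =>
    have h0 : (0 : ℝ) ≤ 1 - u := by linarith
    rw [Nat.add_sub_cancel, pow_succ]
    have key : ∀ m : ℕ, (1 - u) ^ m * (1 - u) + ((m : ℝ) + 1) * u * (1 - u) ^ m ≤ 1 := by
      intro m
      induction m with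
      | zero => simp
      | succ m ih =>
        have h1 : 0 ≤ (1 - u) ^ m := by positivity
        have e1 : (1 - u) ^ (m + 1) * (1 - u) + (((m + 1 : ℕ) : ℝ) + 1) * u * (1 - u) ^ (m + 1) =
          (1 - u) ^ m * (1 - u) + ((m : ℝ) + 1) * u * (1 - u) ^ m
            - ((m : ℝ) + 1) * u ^ 2 * (1 - u) ^ m := by
          push_cast; ring
        rw [e1]
        have : 0 ≤ ((m : ℝ) + 1) * u ^ 2 * (1 - u) ^ m := by positivity
        linarith
    have := key m
    push_cast
    linarith

lemma binTail_le_one {u : ℝ} (hu : 0 ≤ u) (hu1 : u ≤ 1) (n : ℕ) : binTail n u ≤ 1 := by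
  unfold binTail
  have h0 : (0 : ℝ) ≤ 1 - u := by linarith
  have h1 : 0 ≤ (1 - u) ^ n := by positivity
  have h2 : 0 ≤ n * u * (1 - u) ^ (n - 1) := by positivity
  linarith

lemma binTail_le_mul {u : ℝ} (hu : 0 ≤ u) (hu1 : u ≤ 1) (n : ℕ) : binTail n u ≤ n * u := by
  unfold binTail
  have h := one_add_mul_le_pow (a := -u) (by linarith) n
  have h0 : (0 : ℝ) ≤ 1 - u := by linarith
  have h2 : 0 ≤ n * u * (1 - u) ^ (n - 1) := by positivity
  rw [show 1 + -u = 1 - u by ring] at h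
  linarith

/-- Uniform closeness of the binomial and the Poisson tail. -/
lemma abs_binTail_div_sub_theta_le {u : ℝ} (hu : 0 < u) (hu1 : u ≤ 1) {n : ℕ} (hn : 1 ≤ n) :
    |binTail n u / (n * u) - theta (n * u)| ≤ 5 * u := by
  obtain ⟨m, rfl⟩ := Nat.exists_eq_add_of_le' hn
  have hnu : 0 < ((m + 1 : ℕ) : ℝ) * u := by positivity
  set N : ℝ := ((m + 1 : ℕ) : ℝ) with hN
  have hE : Real.exp (-(N * u)) = Real.exp (-u) ^ (m + 1) := by
    rw [← Real.exp_nat_mul, hN]; ring_nf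
  have e : binTail (m + 1) u / (N * u) - theta (N * u) =
      (Real.exp (-u) ^ (m + 1) - (1 - u) ^ (m + 1)) / (N * u)
      + (Real.exp (-u) ^ m - (1 - u) ^ m)
      - Real.exp (-u) ^ m * (1 - Real.exp (-u)) := by
    unfold binTail theta
    have hN0 : N ≠ 0 := by rw [hN]; positivity
    rw [hE, Nat.add_sub_cancel, ← hN]
    field_simp
    ring
  have a1 := exp_sub_pow_nonneg hu1 (m + 1)
  have a2 := exp_sub_pow_nonneg hu1 m
  have a3 := exp_sub_pow_le_three_mul hu.le hu1 m
  have hx1 : Real.exp (-u) ≤ 1 := Real.exp_le_one_iff.mpr (by linarith)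
  have a4 : (Real.exp (-u) ^ (m + 1) - (1 - u) ^ (m + 1)) / (N * u) ≤ u := by
    rw [div_le_iff₀ hnu]
    refine (exp_sub_pow_le hu.le hu1 (m + 1)).trans ?_
    have : Real.exp (-u) ^ (m + 1 - 1) ≤ 1 := pow_le_one₀ (Real.exp_pos _).le hx1
    calc u ^ 2 * (N * Real.exp (-u) ^ (m + 1 - 1)) ≤ u ^ 2 * (N * 1) := by gcongr
      _ = _ := by ring
  have a5 : 0 ≤ (Real.exp (-u) ^ (m + 1) - (1 - u) ^ (m + 1)) / (N * u) := div_nonneg a1 hnu.le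
  have a6 : Real.exp (-u) ^ m ≤ 1 := pow_le_one₀ (Real.exp_pos _).le hx1
  have a7 : 0 ≤ Real.exp (-u) ^ m * (1 - Real.exp (-u)) :=
    mul_nonneg (by positivity) (by linarith)
  have a8 : Real.exp (-u) ^ m * (1 - Real.exp (-u)) ≤ u := by
    have := Real.add_one_le_exp (-u)
    calc _ ≤ 1 * (1 - Real.exp (-u)) := mul_le_mul_of_nonneg_right a6 (by linarith)
      _ ≤ u := by linarith
  rw [e, abs_le]
  constructor <;> linarith

section
variable {q : ℝ}

lemma exp_log_mul (h0 : 0 < q) (h1 : q < 1) {n : ℝ} (hn : 0 < n) (j : ℤ) :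
    Real.exp (Real.log q⁻¹ * (Real.logb q⁻¹ n + j)) = n * q⁻¹ ^ j := by
  have hL := log_inv_pos h0 h1
  rw [mul_add, Real.exp_add, Real.logb, mul_div_cancel₀ _ hL.ne', Real.exp_log hn, mul_comm _ (j : ℝ),
    ← Real.log_zpow, Real.exp_log (zpow_pos (inv_pos.mpr h0) _)]

lemma summable_theta_pos (h0 : 0 < q) (h1 : q < 1) {y : ℝ} (hy : 0 < y) :
    Summable fun j : ℕ => theta (y * q ^ j) :=
  Summable.of_nonneg_of_le (fun j => theta_nonneg (by positivity))
    (fun j => theta_le_self (by positivity)) ((summable_geometric_of_lt_one h0.le h1).mul_left y)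

lemma summable_theta_neg (h0 : 0 < q) (h1 : q < 1) {y : ℝ} (hy : 0 < y) :
    Summable fun j : ℕ => theta (y * q⁻¹ ^ (j + 1)) := by
  refine Summable.of_nonneg_of_le (fun j => theta_nonneg (by positivity))
    (fun j => theta_le_inv (by positivity))
    (((summable_nat_add_iff 1).mpr (summable_geometric_of_lt_one h0.le h1)).mul_left y⁻¹ |>.congr
      fun j => ?_)
  rw [mul_inv, inv_pow, inv_inv]

lemma perSum_logb (h0 : 0 < q) (h1 : q < 1) {y : ℝ} (hy : 0 < y) :
    perSum q (Real.logb q⁻¹ y) =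
      ∑' j : ℕ, (theta (y * q ^ j) + theta (y * q⁻¹ ^ (j + 1))) := by
  unfold perSum
  simp_rw [exp_log_mul h0 h1 hy]
  rw [← (Equiv.neg ℤ).tsum_eq]
  simp only [Equiv.neg_apply]
  have e1 : ∀ j : ℕ, theta (y * q⁻¹ ^ (-(j : ℤ))) = theta (y * q ^ j) := fun j => by
    rw [zpow_neg, zpow_natCast, inv_pow, inv_inv]
  have e2 : ∀ j : ℕ, theta (y * q⁻¹ ^ (-(-((j : ℤ) + 1)))) = theta (y * q⁻¹ ^ (j + 1)) := fun j => by
    rw [neg_neg]; norm_cast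
  have s1 := summable_theta_pos h0 h1 hy
  have s2 := summable_theta_neg h0 h1 hy
  rw [s1.tsum_add s2, tsum_of_nat_of_neg_add_one]
  · simp_rw [e1, e2]
  · simpa only [e1] using s1
  · simpa only [e2] using s2

lemma tendsto_div_natCast (C : ℝ) : Tendsto (fun n : ℕ => C / (n : ℝ)) atTop (𝓝 0) :=
  tendsto_const_nhds.div_atTop tendsto_natCast_atTop_atTop

/-- Binomial tails tend to Poisson tails. The second `θ` in the summand supplies the terms of the
bilateral sum `perSum` with the opposite sign of `j`. -/
lemma tendsto_sum_binTail (h0 : 0 < q) (h1 : q < 1) :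
    Tendsto (fun n : ℕ => ∑' j : ℕ, ((q⁻¹ ^ j - 1) * binTail n (q ^ j) / n
      - (theta (n * q ^ j) + theta (n * q⁻¹ ^ (j + 1))))) atTop (𝓝 0) := by
  have hs : Summable fun j : ℕ => 7 * q ^ j := (summable_geometric_of_lt_one h0.le h1).mul_left 7
  have h := tendsto_tsum_of_dominated_convergence (𝓕 := (atTop : Filter ℕ))
    (f := fun (n : ℕ) (j : ℕ) => (q⁻¹ ^ j - 1) * binTail n (q ^ j) / n
      - (theta (n * q ^ j) + theta (n * q⁻¹ ^ (j + 1)))) (g := fun _ => 0) hs ?_ ?_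
  · simpa using h
  · intro j
    have hu : 0 < q ^ j := by positivity
    have hu1 : q ^ j ≤ 1 := pow_le_one₀ h0.le h1.le
    have t1 : Tendsto (fun n : ℕ => (q⁻¹ ^ j - 1) * binTail n (q ^ j) / n) atTop (𝓝 0) := by
      refine squeeze_zero (g := fun n : ℕ => (q⁻¹ ^ j - 1) / n) (fun n => ?_) (fun n => ?_)
        (tendsto_div_natCast _)
      · have : 0 ≤ q⁻¹ ^ j - 1 := sub_nonneg.mpr (one_le_pow₀ ((one_le_inv₀ h0).mpr h1.le))
        have := binTail_nonneg hu1 n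
        positivity
      · have : 0 ≤ q⁻¹ ^ j - 1 := sub_nonneg.mpr (one_le_pow₀ ((one_le_inv₀ h0).mpr h1.le))
        gcongr
        exact mul_le_of_le_one_right this (binTail_le_one hu.le hu1 n)
    have t2 : ∀ c : ℝ, 0 < c → Tendsto (fun n : ℕ => theta (n * c)) atTop (𝓝 0) := by
      intro c hc
      refine squeeze_zero' (g := fun n : ℕ => c⁻¹ / n) ?_ ?_ (tendsto_div_natCast _)
      · filter_upwards [eventually_ge_atTop 1] with n hn
        have : (0 : ℝ) < n := by exact_mod_cast hn
        exact theta_nonneg (by positivity)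
      · filter_upwards [eventually_ge_atTop 1] with n hn
        have : (0 : ℝ) < n := by exact_mod_cast hn
        refine (theta_le_inv (by positivity)).trans (le_of_eq ?_)
        field_simp
    have := t1.sub ((t2 _ hu).add (t2 (q⁻¹ ^ (j + 1)) (by positivity)))
    simpa using this
  · filter_upwards [eventually_ge_atTop 1] with n hn j
    have hn' : (1 : ℝ) ≤ n := by exact_mod_cast hn
    have hn0 : (0 : ℝ) < n := by linarith
    have hu : 0 < q ^ j := by positivity
    have hu1 : q ^ j ≤ 1 := pow_le_one₀ h0.le h1.le
    have b1 := abs_binTail_div_sub_theta_le hu hu1 hn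
    have b2 : binTail n (q ^ j) / n ≤ q ^ j := by
      rw [div_le_iff₀ hn0, mul_comm]; exact binTail_le_mul hu.le hu1 n
    have b2' : 0 ≤ binTail n (q ^ j) / n := div_nonneg (binTail_nonneg hu1 n) hn0.le
    have b3 : theta (n * q⁻¹ ^ (j + 1)) ≤ q ^ j := by
      refine (theta_le_inv (by positivity)).trans ?_
      rw [mul_inv, inv_pow, inv_inv, pow_succ]
      have : (n : ℝ)⁻¹ ≤ 1 := inv_le_one_of_one_le₀ hn'
      calc (n : ℝ)⁻¹ * (q ^ j * q) ≤ 1 * (q ^ j * 1) := by gcongr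
        _ = q ^ j := by ring
    have b3' : 0 ≤ theta (n * q⁻¹ ^ (j + 1)) := theta_nonneg (by positivity)
    have e : (q⁻¹ ^ j - 1) * binTail n (q ^ j) / n
      - (theta (n * q ^ j) + theta (n * q⁻¹ ^ (j + 1))) =
      (binTail n (q ^ j) / (n * q ^ j) - theta (n * q ^ j)) - binTail n (q ^ j) / n
        - theta (n * q⁻¹ ^ (j + 1)) := by
      rw [inv_pow]; field_simp; ring
    rw [e, Real.norm_eq_abs, abs_le]
    have := abs_le.mp b1
    constructor <;> linarith [this.1, this.2]

/-- Only the linear term `n q^j` survives the division by `n`, which leaves the Taylor series of `h`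
at `q`. -/
lemma tendsto_sum_hcoef (h0 : 0 < q) (h1 : q < 1) (r : ℕ) :
    Tendsto (fun n : ℕ => ∑' j : ℕ, hcoef q r j * (((1 - q ^ j) ^ n - 1 + n * q ^ j : ℝ) : ℂ) / n)
      atTop (𝓝 (hW q r q)) := by
  have hs := hasSum_hcoef h0 h1 r (norm_q_lt h0 h1)
  rw [← hs.tsum_eq]
  refine tendsto_tsum_of_dominated_convergence hs.summable.norm ?_ ?_
  · intro j
    have hu : 0 < q ^ j := by positivity
    have hu1 : q ^ j ≤ 1 := pow_le_one₀ h0.le h1.le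
    have t0 : Tendsto (fun n : ℕ => ((1 - q ^ j) ^ n - 1) / n) atTop (𝓝 0) := by
      refine squeeze_zero_norm (a := fun n : ℕ => 1 / (n : ℝ)) (fun n => ?_) (tendsto_div_natCast 1)
      rw [norm_div, Real.norm_natCast]
      gcongr
      have h3 : 0 ≤ 1 - q ^ j := by linarith
      have h4 : (1 - q ^ j) ^ n ≤ 1 := pow_le_one₀ h3 (by linarith)
      have h5 : 0 ≤ (1 - q ^ j) ^ n := by positivity
      rw [Real.norm_eq_abs, abs_le]
      constructor <;> linarith
    have t1 : Tendsto (fun n : ℕ => ((1 - q ^ j) ^ n - 1 + n * q ^ j) / n) atTop (𝓝 (q ^ j)) := by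
      have := t0.add_const (q ^ j)
      rw [zero_add] at this
      refine this.congr' ?_
      filter_upwards [eventually_ge_atTop 1] with n hn
      have : (n : ℝ) ≠ 0 := by positivity
      field_simp
    have t2 := ((Complex.continuous_ofReal.tendsto _).comp t1).const_mul (hcoef q r j)
    have e : ((q ^ j : ℝ) : ℂ) = (q : ℂ) ^ j := by push_cast; rfl
    rw [e] at t2
    refine t2.congr fun n => ?_
    simp only [Function.comp]
    push_cast
    ring
  · filter_upwards [eventually_ge_atTop 1] with n hn j
    have hn0 : (0 : ℝ) < n := by exact_mod_cast hn
    have hu : 0 < q ^ j := by positivity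
    have hu1 : q ^ j ≤ 1 := pow_le_one₀ h0.le h1.le
    have h2 := one_add_mul_le_pow (a := -q ^ j) (by linarith) n
    rw [show 1 + -q ^ j = 1 - q ^ j by ring] at h2
    have h3 : 0 ≤ 1 - q ^ j := by linarith
    have h4 : (1 - q ^ j) ^ n ≤ 1 := pow_le_one₀ h3 (by linarith)
    rw [norm_div, norm_mul, norm_mul, Complex.norm_natCast, Complex.norm_real, norm_pow,
      Complex.norm_real, Real.norm_of_nonneg h0.le, div_le_iff₀ hn0, mul_assoc]
    gcongr
    rw [Real.norm_eq_abs, abs_le]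
    constructor <;> nlinarith

/-- The asymptotics of `E_n / n`, before the periodic part is split off. -/
lemma tendsto_avgPos_div (h0 : 0 < q) (h1 : q < 1) {r : ℕ} (hr : 1 ≤ r) :
    Tendsto (fun n : ℕ => ((avgPos q r n / n : ℝ) : ℂ) -
      sgnC q r * (betaR q r * (perSum q (Real.logb q⁻¹ n) : ℂ))) atTop
      (𝓝 (sgnC q r * hW q r q)) := by
  have t1 := (Complex.continuous_ofReal.tendsto _).comp (tendsto_sum_binTail h0 h1)
  have t2 := ((t1.const_mul (betaR q r : ℂ)).add (tendsto_sum_hcoef h0 h1 r)).const_mul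
    (sgnC q r : ℂ)
  simp only [Complex.ofReal_zero, mul_zero, zero_add] at t2
  refine t2.congr' ?_
  filter_upwards [eventually_ge_atTop 1] with n hn
  have hn0 : (0 : ℝ) < n := by exact_mod_cast hn
  have hs := hasSum_avgPos h0 h1 hr n
  have hb0 : ∀ j : ℕ, 0 ≤ binTail n (q ^ j) := fun j =>
    binTail_nonneg (pow_le_one₀ h0.le h1.le) n
  have hθ := (summable_theta_pos h0 h1 hn0).add (summable_theta_neg h0 h1 hn0)
  have hh : Summable fun j : ℕ =>
      hcoef q r j * (((1 - q ^ j) ^ n - 1 + n * q ^ j : ℝ) : ℂ) / n := by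
    have hs := hasSum_hcoef h0 h1 r (norm_q_lt h0 h1)
    refine Summable.of_norm_bounded hs.summable.norm fun j => ?_
    have hu : 0 < q ^ j := by positivity
    have hu1 : q ^ j ≤ 1 := pow_le_one₀ h0.le h1.le
    have h2 := one_add_mul_le_pow (a := -q ^ j) (by linarith) n
    rw [show 1 + -q ^ j = 1 - q ^ j by ring] at h2
    have h3 : 0 ≤ 1 - q ^ j := by linarith
    have h4 : (1 - q ^ j) ^ n ≤ 1 := pow_le_one₀ h3 (by linarith)
    rw [norm_div, norm_mul, norm_mul, Complex.norm_natCast, Complex.norm_real, norm_pow,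
      Complex.norm_real, Real.norm_of_nonneg h0.le, div_le_iff₀ hn0, mul_assoc]
    gcongr
    rw [Real.norm_eq_abs, abs_le]
    constructor <;> nlinarith
  have hB : Summable fun j : ℕ => (q⁻¹ ^ j - 1) * binTail n (q ^ j) / n := by
    have hd : Summable fun j : ℕ => 5 * q ^ j := (summable_geometric_of_lt_one h0.le h1).mul_left 5
    refine Summable.of_nonneg_of_le (fun j => ?_) (fun j => ?_)
      (hd.add (summable_theta_pos h0 h1 hn0))
    · have : 0 ≤ q⁻¹ ^ j - 1 := sub_nonneg.mpr (one_le_pow₀ ((one_le_inv₀ h0).mpr h1.le))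
      have := hb0 j
      positivity
    · have hu : 0 < q ^ j := by positivity
      have b1 := (abs_le.mp (abs_binTail_div_sub_theta_le hu (pow_le_one₀ h0.le h1.le) hn)).2
      have e : (q⁻¹ ^ j - 1) * binTail n (q ^ j) / n =
          binTail n (q ^ j) / (n * q ^ j) - binTail n (q ^ j) / n := by
        rw [inv_pow]; field_simp
      have := div_nonneg (hb0 j) hn0.le
      rw [e]
      linarith
  rw [perSum_logb h0 h1 hn0]
  simp only [Function.comp]
  rw [hB.tsum_sub hθ]
  have key : ((avgPos q r n / n : ℝ) : ℂ) = sgnC q r * (betaR q r *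
      ((∑' j : ℕ, (q⁻¹ ^ j - 1) * binTail n (q ^ j) / n : ℝ) : ℂ) +
      ∑' j : ℕ, hcoef q r j * (((1 - q ^ j) ^ n - 1 + n * q ^ j : ℝ) : ℂ) / n) := by
    have h5 := (((Complex.hasSum_ofReal.mpr hB.hasSum).mul_left (betaR q r : ℂ)).add
      hh.hasSum).mul_left (sgnC q r : ℂ)
    have h6 := hs.div_const (n : ℂ)
    rw [Complex.ofReal_div, Complex.ofReal_natCast]
    refine h6.unique (h5.congr_fun ?_)
    intro j
    push_cast
    ring
  rw [key]
  push_cast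
  ring

end

/-! ### Decay of the Gamma function -/

/-- From the reflection formula, since `Γ(1 - iy)` is the conjugate of `Γ(1 + iy)`. -/
lemma normSq_Gamma_one_add_mul_I {y : ℝ} (hy : y ≠ 0) :
    Complex.normSq (Complex.Gamma (1 + y * Complex.I)) = Real.pi * y / Real.sinh (Real.pi * y) := by
  have hyI : (y : ℂ) * Complex.I ≠ 0 := mul_ne_zero (by exact_mod_cast hy) Complex.I_ne_zero
  have h1 : (starRingEnd ℂ) (Complex.Gamma (1 + y * Complex.I)) =
      Complex.Gamma (1 - y * Complex.I) := by
    rw [← Complex.Gamma_conj]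
    congr 1
    simp [sub_eq_add_neg]
  have h2 : Complex.Gamma (1 + y * Complex.I) =
      (y * Complex.I) * Complex.Gamma (y * Complex.I) := by
    rw [add_comm, Complex.Gamma_add_one _ hyI]
  have h3 : ((Complex.normSq (Complex.Gamma (1 + y * Complex.I)) : ℝ) : ℂ) =
      ((Real.pi * y / Real.sinh (Real.pi * y) : ℝ) : ℂ) := by
    rw [← Complex.mul_conj, h1]
    nth_rewrite 1 [h2]
    rw [mul_assoc, Complex.Gamma_mul_Gamma_one_sub, ← mul_assoc (Real.pi : ℂ), Complex.sin_mul_I]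
    have hs : Real.sinh (Real.pi * y) ≠ 0 := by
      rw [Ne, Real.sinh_eq_zero]; exact mul_ne_zero Real.pi_ne_zero hy
    have hs' : Complex.sinh ((Real.pi : ℂ) * y) ≠ 0 := by exact_mod_cast hs
    push_cast
    field_simp [Complex.I_ne_zero]
  exact_mod_cast h3

lemma pow_le_sinh {x : ℝ} (hx : 0 ≤ x) (N : ℕ) :
    x ^ (2 * N + 1) / ((2 * N + 1).factorial : ℝ) ≤ Real.sinh x :=
  le_hasSum (Real.hasSum_sinh x) N fun _ _ => by positivity

lemma norm_Gamma_one_add_mul_I_le {y : ℝ} (hy : y ≠ 0) (N : ℕ) :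
    ‖Complex.Gamma (1 + y * Complex.I)‖ ≤ ((2 * N + 1).factorial : ℝ) / (Real.pi * |y|) ^ N := by
  have hf : (1 : ℝ) ≤ ((2 * N + 1).factorial : ℝ) := by
    exact_mod_cast Nat.one_le_iff_ne_zero.mpr (Nat.factorial_ne_zero _)
  have hx : 0 < Real.pi * |y| := mul_pos Real.pi_pos (abs_pos.mpr hy)
  refine le_of_sq_le_sq ?_ (by positivity)
  rw [← Complex.normSq_eq_norm_sq, normSq_Gamma_one_add_mul_I hy]
  have e : Real.pi * y / Real.sinh (Real.pi * y) =
      Real.pi * |y| / Real.sinh (Real.pi * |y|) := by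
    rcases abs_choice y with h | h
    · rw [h]
    · rw [h, mul_neg, Real.sinh_neg, neg_div_neg_eq]
  rw [e]
  have hs := pow_le_sinh hx.le N
  set x := Real.pi * |y|
  calc x / Real.sinh x ≤ x / (x ^ (2 * N + 1) / ((2 * N + 1).factorial : ℝ)) := by gcongr
    _ = ((2 * N + 1).factorial : ℝ) / (x ^ N) ^ 2 := by field_simp; ring
    _ ≤ ((2 * N + 1).factorial : ℝ) ^ 2 / (x ^ N) ^ 2 := by
      gcongr
      exact le_self_pow₀ hf two_ne_zero
    _ = _ := (div_pow _ _ _).symm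

/-! ### The Mellin transform of `θ` -/

lemma hasDerivAt_theta_num (t : ℝ) :
    HasDerivAt (fun t : ℝ => 1 - Real.exp (-t) - t * Real.exp (-t)) (t * Real.exp (-t)) t := by
  have h1 : HasDerivAt (fun t : ℝ => Real.exp (-t)) (-Real.exp (-t)) t := by
    simpa using (hasDerivAt_neg t).exp
  have h2 := ((h1.const_sub 1).sub ((hasDerivAt_id t).mul h1))
  refine h2.congr_deriv ?_
  simp

lemma continuousOn_theta : ContinuousOn theta (Set.Ioi 0) := by
  unfold theta
  refine ContinuousOn.div (by fun_prop) continuousOn_id fun t ht => (Set.mem_Ioi.mp ht).ne'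

lemma integrableOn_theta_div : IntegrableOn (fun t : ℝ => theta t / t) (Set.Ioi 0) := by
  have hm : ∀ s : Set ℝ, MeasurableSet s → s ⊆ Set.Ioi 0 →
      AEStronglyMeasurable (fun t : ℝ => theta t / t) (volume.restrict s) := fun s hs hs0 =>
    ContinuousOn.aestronglyMeasurable ((continuousOn_theta.div continuousOn_id
      fun t ht => (Set.mem_Ioi.mp ht).ne').mono hs0) hs
  rw [← Set.Ioc_union_Ioi_eq_Ioi zero_le_one]
  refine IntegrableOn.union ?_ ?_
  · refine Integrable.of_bound (hm _ measurableSet_Ioc fun t ht => ht.1) 1 ?_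
    refine (ae_restrict_iff' measurableSet_Ioc).mpr (Eventually.of_forall fun t ht => ?_)
    rw [Real.norm_of_nonneg (div_nonneg (theta_nonneg ht.1) ht.1.le), div_le_one ht.1]
    exact theta_le_self ht.1
  · refine Integrable.mono' (integrableOn_Ioi_rpow_of_lt (a := -2) (by norm_num) one_pos)
      (hm _ measurableSet_Ioi fun t ht => lt_trans zero_lt_one (Set.mem_Ioi.mp ht)) ?_
    refine (ae_restrict_iff' measurableSet_Ioi).mpr (Eventually.of_forall fun t ht => ?_)
    have ht0 : 0 < t := zero_lt_one.trans ht
    rw [Real.norm_of_nonneg (div_nonneg (theta_nonneg ht0) ht0.le), Real.rpow_neg ht0.le,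
      div_le_iff₀ ht0]
    refine (theta_le_inv ht0).trans (le_of_eq ?_)
    norm_cast
    field_simp

/-- Integration by parts, the numerator of `θ` having derivative `t e^(-t)`. -/
lemma mellin_theta {s : ℂ} (hs : s.re = 0) :
    mellin (fun t => (theta t : ℂ)) s = Complex.Gamma (s + 1) / (1 - s) := by
  have hs1 : s - 1 ≠ 0 := by
    intro h
    have := congrArg Complex.re h
    simp [hs] at this
  have hs2 : (1 : ℂ) - s ≠ 0 := fun h => hs1 (by rw [← neg_sub, h, neg_zero])
  have hG : 0 < (s + 1).re := by simp [hs]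
  rw [Complex.Gamma_eq_integral hG, Complex.GammaIntegral, mellin]
  have hnorm : ∀ t : ℝ, 0 < t → ∀ w : ℂ, ‖(t : ℂ) ^ w‖ = t ^ w.re := fun t ht w =>
    Complex.norm_cpow_eq_rpow_re_of_pos ht w
  have hdiv : ∀ t : ℝ, 0 < t → (t : ℂ) ^ (s - 1) = (t : ℂ) ^ (s - 2) * t := fun t ht => by
    have h0 : (t : ℂ) ≠ 0 := by exact_mod_cast ht.ne'
    rw [show s - 1 = (s - 2) + 1 by ring, Complex.cpow_add _ _ h0, Complex.cpow_one]
  have hIBP := integral_Ioi_mul_deriv_eq_deriv_mul (a := (0 : ℝ)) (a' := (0 : ℂ)) (b' := 0)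
    (u := fun t : ℝ => ((1 - Real.exp (-t) - t * Real.exp (-t) : ℝ) : ℂ))
    (u' := fun t : ℝ => ((t * Real.exp (-t) : ℝ) : ℂ))
    (v := fun t : ℝ => (t : ℂ) ^ (s - 1) / (s - 1)) (v' := fun t : ℝ => (t : ℂ) ^ (s - 2))
    (fun t _ => (hasDerivAt_theta_num t).ofReal_comp) (fun t ht => ?_) ?_ ?_ ?_ ?_
  · have e1 : ∫ t : ℝ in Set.Ioi 0, (t : ℂ) ^ (s - 1) • (theta t : ℂ) =
        ∫ t : ℝ in Set.Ioi 0, ((1 - Real.exp (-t) - t * Real.exp (-t) : ℝ) : ℂ) *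
          (t : ℂ) ^ (s - 2) := by
      refine setIntegral_congr_fun measurableSet_Ioi fun t ht => ?_
      have ht : 0 < t := ht
      have h0 : (t : ℂ) ≠ 0 := by exact_mod_cast ht.ne'
      simp only [smul_eq_mul]
      rw [hdiv t ht, theta, Complex.ofReal_div]
      field_simp
    rw [e1, hIBP, sub_zero, zero_sub, ← integral_neg, div_eq_mul_inv, ← integral_mul_const]
    refine setIntegral_congr_fun measurableSet_Ioi fun t ht => ?_
    have ht : 0 < t := ht
    have h0 : (t : ℂ) ≠ 0 := by exact_mod_cast ht.ne'
    have e3 : (t : ℂ) ^ (s + 1 - 1) = (t : ℂ) ^ (s - 1) * t := by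
      rw [show s + 1 - 1 = (s - 1) + 1 by ring, Complex.cpow_add _ _ h0, Complex.cpow_one]
    rw [e3]
    push_cast
    rw [show (1 - s) = -(s - 1) by ring, inv_neg]
    ring
  · have ht : 0 < t := ht
    have h := (hasDerivAt_ofReal_cpow_const' ht.ne' (r := s - 2) (by
      intro h
      have := congrArg Complex.re h
      simp [hs] at this))
    rw [show s - 2 + 1 = s - 1 by ring] at h
    exact h
  · refine Integrable.mono' integrableOn_theta_div ?_ ?_
    · refine ContinuousOn.aestronglyMeasurable ?_ measurableSet_Ioi
      refine ContinuousOn.mul (by fun_prop) fun t ht => ?_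
      exact (Complex.continuousAt_ofReal_cpow_const t _ (Or.inr (Set.mem_Ioi.mp ht).ne')).continuousWithinAt
    · refine (ae_restrict_iff' measurableSet_Ioi).mpr (Eventually.of_forall fun t ht => ?_)
      have ht : 0 < t := ht
      rw [Pi.mul_apply, norm_mul, hnorm t ht, Complex.norm_real]
      have e2 : 1 - Real.exp (-t) - t * Real.exp (-t) = theta t * t := by
        unfold theta; field_simp
      rw [e2, Real.norm_of_nonneg (mul_nonneg (theta_nonneg ht) ht.le)]
      simp only [Complex.sub_re, hs, Complex.re_ofNat, zero_sub]
      rw [Real.rpow_neg ht.le]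
      apply le_of_eq
      norm_cast
      field_simp
  · have h := (Complex.GammaIntegral_convergent hG).div_const (s - 1)
    refine h.congr ?_
    refine (ae_restrict_iff' measurableSet_Ioi).mpr (Eventually.of_forall fun t ht => ?_)
    have ht : 0 < t := ht
    have h0 : (t : ℂ) ≠ 0 := by exact_mod_cast ht.ne'
    have e3 : (t : ℂ) ^ (s + 1 - 1) = (t : ℂ) ^ (s - 1) * t := by
      rw [show s + 1 - 1 = (s - 1) + 1 by ring, Complex.cpow_add _ _ h0, Complex.cpow_one]
    simp only [Pi.mul_apply]
    rw [e3]
    push_cast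
    ring
  all_goals
    rw [tendsto_zero_iff_norm_tendsto_zero]
    have hn : ∀ t : ℝ, 0 < t → ‖((fun t : ℝ => ((1 - Real.exp (-t) - t * Real.exp (-t) : ℝ) : ℂ)) *
        fun t : ℝ => (t : ℂ) ^ (s - 1) / (s - 1)) t‖ = theta t / ‖s - 1‖ := fun t ht => by
      rw [Pi.mul_apply, norm_mul, norm_div, hnorm t ht, Complex.norm_real]
      have e2 : 1 - Real.exp (-t) - t * Real.exp (-t) = theta t * t := by
        unfold theta; field_simp
      rw [e2, Real.norm_of_nonneg (mul_nonneg (theta_nonneg ht) ht.le)]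
      simp only [Complex.sub_re, hs, Complex.one_re, zero_sub]
      rw [Real.rpow_neg_one]
      field_simp
  · have hz : Tendsto (fun t : ℝ => t / ‖s - 1‖) (𝓝[>] 0) (𝓝 0) := by
      have : Tendsto (fun t : ℝ => t / ‖s - 1‖) (𝓝 0) (𝓝 (0 / ‖s - 1‖)) :=
        (continuous_id.div_const _).tendsto 0
      rw [zero_div] at this
      exact this.mono_left nhdsWithin_le_nhds
    refine squeeze_zero' (Eventually.of_forall fun _ => norm_nonneg _) ?_ hz
    filter_upwards [self_mem_nhdsWithin] with t ht
    rw [hn t ht]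
    have := theta_le_self (Set.mem_Ioi.mp ht)
    gcongr
  · have hz : Tendsto (fun t : ℝ => t⁻¹ / ‖s - 1‖) atTop (𝓝 0) := by
      have := tendsto_inv_atTop_zero.div_const (‖s - 1‖)
      rwa [zero_div] at this
    refine squeeze_zero' (Eventually.of_forall fun _ => norm_nonneg _) ?_ hz
    filter_upwards [eventually_gt_atTop 0] with t ht
    rw [hn t ht]
    have := theta_le_inv ht
    gcongr

/-! ### Fourier series of the periodic part -/

section
variable {q : ℝ}

lemma theta_exp_le (y : ℝ) : theta (Real.exp y) ≤ Real.exp (-|y|) := by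
  rcases le_total 0 y with h | h
  · rw [abs_of_nonneg h, Real.exp_neg]; exact theta_le_inv (Real.exp_pos y)
  · rw [abs_of_nonpos h, neg_neg]; exact theta_le_self (Real.exp_pos y)

lemma continuous_theta_exp (L : ℝ) : Continuous fun x : ℝ => theta (Real.exp (L * x)) :=
  continuousOn_theta.comp_continuous (by fun_prop) fun x => Real.exp_pos _

/-- The Fourier transform of `x ↦ θ(Q ^ x)` at an integer, in terms of the pole `z_k`. -/
lemma fourier_theta (h0 : 0 < q) (h1 : q < 1) (k : ℤ) :
    FourierTransform.fourier (fun x : ℝ => (theta (Real.exp (Real.log q⁻¹ * x)) : ℂ)) (k : ℝ) =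
      Complex.Gamma (2 - polePt q k) / polePt q k / ((Real.log q⁻¹ : ℝ) : ℂ) := by
  have hL := log_inv_pos h0 h1
  set L := Real.log q⁻¹ with hLdef
  have hs : (1 - polePt q k).re = 0 := by
    unfold polePt
    rw [← hLdef]
    have : 2 * (k : ℂ) * (Real.pi : ℂ) * Complex.I / (L : ℂ) =
      ((2 * k * Real.pi / L : ℝ) : ℂ) * Complex.I := by push_cast; ring
    rw [this]; simp
  have him : (1 - polePt q k).im / (2 * Real.pi) = -(k : ℝ) / L := by
    unfold polePt
    rw [← hLdef]
    have : 2 * (k : ℂ) * (Real.pi : ℂ) * Complex.I / (L : ℂ) =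
      ((2 * k * Real.pi / L : ℝ) : ℂ) * Complex.I := by push_cast; ring
    rw [this]
    have := Real.pi_ne_zero
    simp
    field_simp
  have hM := mellin_theta hs
  rw [mellin_eq_fourier, him, hs] at hM
  have e1 : (1 - polePt q k) + 1 = 2 - polePt q k := by ring
  have e2 : 1 - (1 - polePt q k) = polePt q k := by ring
  rw [e1, e2] at hM
  rw [← hM, Real.fourier_eq', Real.fourier_eq']
  have hsub := Measure.integral_comp_mul_left (fun u : ℝ =>
    Complex.exp (((-2 * Real.pi * inner ℝ u (-(k : ℝ) / L) : ℝ) : ℂ) * Complex.I) •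
      (Real.exp (-0 * u) • (theta (Real.exp (-u)) : ℂ))) (-L)
  rw [abs_inv, abs_neg, abs_of_pos hL] at hsub
  rw [div_eq_inv_mul, ← Complex.ofReal_inv]
  refine Eq.trans ?_ (hsub.trans (Complex.real_smul))
  congr 1
  ext x
  have : (-2 * Real.pi * inner ℝ (-L * x) (-(k : ℝ) / L) : ℝ) =
      -2 * Real.pi * inner ℝ x (k : ℝ) := by
    simp only [RCLike.inner_apply, conj_trivial]
    field_simp
  rw [this]
  simp

lemma polePt_eq (q : ℝ) (k : ℤ) :
    polePt q k = 1 + ((2 * k * Real.pi / Real.log q⁻¹ : ℝ) : ℂ) * Complex.I := by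
  unfold polePt; push_cast; ring

lemma polePt_ne_one (h0 : 0 < q) (h1 : q < 1) {k : ℤ} (hk : k ≠ 0) : polePt q k ≠ 1 := by
  have hL := log_inv_pos h0 h1
  have hk' : (k : ℝ) ≠ 0 := by exact_mod_cast hk
  intro h
  have := congrArg Complex.im h
  have hy : 2 * (k : ℝ) * Real.pi / Real.log q⁻¹ ≠ 0 := by
    refine div_ne_zero ?_ hL.ne'
    have := Real.pi_ne_zero
    positivity
  rw [polePt_eq] at this
  generalize 2 * (k : ℝ) * Real.pi / Real.log q⁻¹ = y at this hy
  simp at this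
  exact hy this

lemma polePt_re (q : ℝ) (k : ℤ) : (polePt q k).re = 1 := by
  rw [polePt_eq]
  generalize 2 * (k : ℝ) * Real.pi / Real.log q⁻¹ = y
  simp

lemma polePt_ne_zero (q : ℝ) (k : ℤ) : polePt q k ≠ 0 := by
  intro h
  have := congrArg Complex.re h
  rw [polePt_re] at this
  simp at this

lemma norm_fourier_theta_le (h0 : 0 < q) (h1 : q < 1) (N : ℕ) {k : ℤ} (hk : k ≠ 0) :
    ‖Complex.Gamma (2 - polePt q k) / polePt q k / ((Real.log q⁻¹ : ℝ) : ℂ)‖ ≤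
      ((2 * N + 1).factorial : ℝ) * Real.log q⁻¹ ^ N / Real.log q⁻¹ * (1 / |(k : ℝ) ^ N|) := by
  have hL := log_inv_pos h0 h1
  set L := Real.log q⁻¹ with hLdef
  have hk' : (0 : ℝ) < |(k : ℝ)| := abs_pos.mpr (by exact_mod_cast hk)
  have hpi := Real.pi_gt_three
  have e : 2 - polePt q k = 1 + ((-(2 * k * Real.pi / L) : ℝ) : ℂ) * Complex.I := by
    rw [polePt_eq]; push_cast; ring
  have hy : -(2 * (k : ℝ) * Real.pi / L) ≠ 0 := by
    have : (k : ℝ) ≠ 0 := by exact_mod_cast hk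
    have := Real.pi_ne_zero
    refine neg_ne_zero.mpr (div_ne_zero ?_ hL.ne')
    positivity
  have hG := norm_Gamma_one_add_mul_I_le hy N
  have hz : 1 ≤ ‖polePt q k‖ := by
    have := Complex.abs_re_le_norm (polePt q k)
    rwa [polePt_re, abs_one] at this
  have hb : |(k : ℝ)| / L ≤ Real.pi * |-(2 * (k : ℝ) * Real.pi / L)| := by
    rw [abs_neg, abs_div, abs_mul, abs_mul, abs_of_pos hL, abs_of_pos Real.pi_pos, abs_two,
      ← mul_div_assoc]
    gcongr
    have h2 : 1 ≤ 2 * Real.pi * Real.pi := by nlinarith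
    calc |(k : ℝ)| = 1 * |(k : ℝ)| := (one_mul _).symm
      _ ≤ (2 * Real.pi * Real.pi) * |(k : ℝ)| := by gcongr
      _ = _ := by ring
  rw [norm_div, norm_div, Complex.norm_real, Real.norm_of_nonneg hL.le, e]
  calc _ ≤ ‖Complex.Gamma (1 + ((-(2 * k * Real.pi / L) : ℝ) : ℂ) * Complex.I)‖ / 1 / L := by gcongr
    _ ≤ ((2 * N + 1).factorial : ℝ) / (|(k : ℝ)| / L) ^ N / 1 / L := by
        gcongr
        refine hG.trans ?_
        gcongr
    _ = _ := by
        rw [abs_pow, div_pow]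
        field_simp

lemma summable_fourier_theta (h0 : 0 < q) (h1 : q < 1) : Summable fun k : ℤ =>
    ‖Complex.Gamma (2 - polePt q k) / polePt q k / ((Real.log q⁻¹ : ℝ) : ℂ)‖ := by
  have hs := ((Real.summable_one_div_int_pow (p := 2)).mpr (by norm_num)).abs.mul_left
    (((2 * 2 + 1).factorial : ℝ) * Real.log q⁻¹ ^ 2 / Real.log q⁻¹)
  refine Summable.of_norm_bounded_eventually hs ?_
  rw [Filter.eventually_cofinite]
  refine (Set.finite_singleton (0 : ℤ)).subset fun k hk => ?_
  by_contra h
  apply hk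
  have := norm_fourier_theta_le h0 h1 2 (k := k) h
  rw [norm_norm]
  refine this.trans (le_of_eq ?_)
  rw [abs_div, abs_one]

lemma norm_exp_two_pi (k : ℤ) (x : ℝ) :
    ‖Complex.exp (2 * Real.pi * Complex.I * k * x)‖ = 1 := by
  rw [show 2 * (Real.pi : ℂ) * Complex.I * k * x = ((2 * Real.pi * k * x : ℝ) : ℂ) * Complex.I by
      push_cast; ring]
  exact Complex.norm_exp_ofReal_mul_I _

/-- Poisson summation for `x ↦ θ(Q^x)`, whose Fourier transform is the Mellin transform of `θ` on
the imaginary axis. -/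
lemma hasSum_perSum (h0 : 0 < q) (h1 : q < 1) (x : ℝ) :
    HasSum (fun k : ℤ => Complex.Gamma (2 - polePt q k) / polePt q k / ((Real.log q⁻¹ : ℝ) : ℂ) *
      Complex.exp (2 * Real.pi * Complex.I * k * x)) (perSum q x : ℂ) := by
  have hL := log_inv_pos h0 h1
  have hO : (fun x : ℝ => (theta (Real.exp (Real.log q⁻¹ * x)) : ℂ)) =O[cocompact ℝ]
      fun x : ℝ => |x| ^ (-2 : ℝ) := by
    refine IsBigO.of_bound (2 / Real.log q⁻¹ ^ 2) ?_
    filter_upwards [(tendsto_norm_cocompact_atTop (E := ℝ)).eventually_gt_atTop 0] with x hx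
    rw [Real.norm_eq_abs] at hx
    rw [Complex.norm_real, Real.norm_of_nonneg (theta_nonneg (Real.exp_pos _)),
      Real.norm_of_nonneg (by positivity)]
    refine (theta_exp_le _).trans ?_
    rw [abs_mul, abs_of_pos hL, Real.exp_neg, Real.rpow_neg hx.le]
    have hp : 0 < Real.log q⁻¹ * |x| := by positivity
    have hq := Real.quadratic_le_exp_of_nonneg hp.le
    rw [inv_le_comm₀ (Real.exp_pos _) (by positivity)]
    refine le_trans (le_of_eq ?_) (show (Real.log q⁻¹ * |x|) ^ 2 / 2 ≤ _ by linarith)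
    norm_cast
    field_simp
  have hc : Continuous (fun x : ℝ => (theta (Real.exp (Real.log q⁻¹ * x)) : ℂ)) :=
    Complex.continuous_ofReal.comp (continuous_theta_exp _)
  have hsF : Summable fun k : ℤ => FourierTransform.fourier
      (fun x : ℝ => (theta (Real.exp (Real.log q⁻¹ * x)) : ℂ)) (k : ℝ) := by
    simp_rw [fourier_theta h0 h1]
    exact (summable_fourier_theta h0 h1).of_norm
  have hP := Real.tsum_eq_tsum_fourier_of_rpow_decay_of_summable hc one_lt_two hO hsF x
  simp_rw [fourier_theta h0 h1] at hP
  have e : ∀ k : ℤ, (fourier k (x : UnitAddCircle) : ℂ) =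
      Complex.exp (2 * Real.pi * Complex.I * k * x) := fun k => by
    rw [fourier_coe_apply]; simp
  simp_rw [e] at hP
  have e2 : (perSum q x : ℂ) = ∑' n : ℤ, (theta (Real.exp (Real.log q⁻¹ * (x + n))) : ℂ) := by
    unfold perSum; push_cast; rfl
  rw [e2, hP]
  refine Summable.hasSum ?_
  refine (summable_fourier_theta h0 h1).of_norm_bounded fun k => ?_
  rw [norm_mul, norm_exp_two_pi, mul_one]

lemma continuous_perSum (h0 : 0 < q) (h1 : q < 1) : Continuous (perSum q) := by
  have h : Continuous fun x : ℝ => ∑' k : ℤ,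
      Complex.Gamma (2 - polePt q k) / polePt q k / ((Real.log q⁻¹ : ℝ) : ℂ) *
      Complex.exp (2 * Real.pi * Complex.I * k * x) := by
    refine continuous_tsum (fun k => by fun_prop) (summable_fourier_theta h0 h1) fun k x => ?_
    rw [norm_mul, norm_exp_two_pi, mul_one]
  have e : perSum q = fun x : ℝ => (∑' k : ℤ,
      Complex.Gamma (2 - polePt q k) / polePt q k / ((Real.log q⁻¹ : ℝ) : ℂ) *
      Complex.exp (2 * Real.pi * Complex.I * k * x)).re := by
    ext x; rw [(hasSum_perSum h0 h1 x).tsum_eq, Complex.ofReal_re]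
  rw [e]
  exact Complex.continuous_re.comp h

lemma perSum_add_one (q x : ℝ) : perSum q (x + 1) = perSum q x := by
  unfold perSum
  rw [← (Equiv.addRight (1 : ℤ)).tsum_eq (fun j : ℤ => theta (Real.exp (Real.log q⁻¹ * (x + j))))]
  congr 1
  ext j
  simp only [Equiv.coe_addRight]
  push_cast
  ring_nf

/-- The periodic sum without its mean value. -/
lemma hasSum_perSum_sub (h0 : 0 < q) (h1 : q < 1) (x : ℝ) :
    HasSum (fun k : {k : ℤ // k ≠ 0} =>
      Complex.Gamma (2 - polePt q k) / polePt q k / ((Real.log q⁻¹ : ℝ) : ℂ) *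
      Complex.exp (2 * Real.pi * Complex.I * ((k : ℤ) : ℂ) * x))
      ((perSum q x - 1 / Real.log q⁻¹ : ℝ) : ℂ) := by
  have hs := hasSum_perSum h0 h1 x
  have h2 := hs.sub (hasSum_ite_eq (0 : ℤ) (1 / ((Real.log q⁻¹ : ℝ) : ℂ)))
  have e : (fun k : {k : ℤ // k ≠ 0} =>
      Complex.Gamma (2 - polePt q k) / polePt q k / ((Real.log q⁻¹ : ℝ) : ℂ) *
      Complex.exp (2 * Real.pi * Complex.I * ((k : ℤ) : ℂ) * x)) =
    (fun k : ℤ => Complex.Gamma (2 - polePt q k) / polePt q k / ((Real.log q⁻¹ : ℝ) : ℂ) *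
      Complex.exp (2 * Real.pi * Complex.I * k * x)) ∘ ((↑) : {k : ℤ | k ≠ 0} → ℤ) := rfl
  rw [e]
  refine (hasSum_subtype_iff_indicator (s := {k : ℤ | k ≠ 0})).mpr ?_
  push_cast
  refine h2.congr_fun fun k => ?_
  by_cases hk : k = 0
  · subst hk
    norm_num [polePt]
  · rw [Set.indicator_of_mem (by exact hk), if_neg hk, sub_zero]

lemma abs_perSum_sub_le (h0 : 0 < q) (h1 : q < 1) {N : ℕ} (hN : 2 ≤ N) (x : ℝ) :
    |perSum q x - 1 / Real.log q⁻¹| ≤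
      ((2 * N + 1).factorial : ℝ) * Real.log q⁻¹ ^ N / Real.log q⁻¹ *
        ∑' k : {k : ℤ // k ≠ 0}, 1 / |((k : ℤ) : ℝ) ^ N| := by
  have hs := hasSum_perSum_sub h0 h1 x
  have hsum : Summable fun k : {k : ℤ // k ≠ 0} => 1 / |((k : ℤ) : ℝ) ^ N| := by
    have h := ((Real.summable_one_div_int_pow (p := N)).mpr (by omega)).abs
    refine (h.comp_injective (Subtype.val_injective (p := fun k : ℤ => k ≠ 0))).congr fun k => ?_
    simp only [Function.comp]
    rw [abs_div, abs_one]
  have h := tsum_of_norm_bounded (hsum.hasSum.mul_left (((2 * N + 1).factorial : ℝ) *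
    Real.log q⁻¹ ^ N / Real.log q⁻¹)) (f := fun k : {k : ℤ // k ≠ 0} =>
      Complex.Gamma (2 - polePt q k) / polePt q k / ((Real.log q⁻¹ : ℝ) : ℂ) *
      Complex.exp (2 * Real.pi * Complex.I * ((k : ℤ) : ℂ) * x)) fun k => by
      rw [norm_mul, norm_exp_two_pi, mul_one]
      exact norm_fourier_theta_le h0 h1 N k.2
  rw [hs.tsum_eq, Complex.norm_real, Real.norm_eq_abs] at h
  exact h

lemma Gamma_two_sub {z : ℂ} (hz : z ≠ 0) (hz1 : z ≠ 1) :
    Complex.Gamma (2 - z) / z = (z - 1) * Complex.Gamma (-z) := by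
  have e1 := Complex.Gamma_add_one (-z) (neg_ne_zero.mpr hz)
  have e2 := Complex.Gamma_add_one (1 - z) (sub_ne_zero.mpr (Ne.symm hz1))
  rw [show 2 - z = 1 - z + 1 by ring, e2, show 1 - z = -z + 1 by ring, e1]
  field_simp
  ring

end

/-! ### Riemann sums for powers of the logarithm -/

/-- `λ_s(Y) = log(1+Y)^s / s!`, the `s`-fold iterated integral of `dY / (1+Y)`. -/
def lam (s : ℕ) (Y : ℝ) : ℝ := Real.log (1 + Y) ^ s / (s.factorial : ℝ)

/-- The discrete analogue of `lam`: an iterated Riemann sum of `dY / (1+Y)` over the geometric grid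
`Y q, Y q^2, …`. -/
def kap (q : ℝ) : ℕ → ℝ → ℝ
  | 0, _ => 1
  | s + 1, Y => ∑' a : ℕ, (1 - q) / q * (Y * q ^ (a + 1)) / (1 + Y * q ^ (a + 1)) *
      kap q s (Y * q ^ (a + 1))

lemma lam_nonneg (s : ℕ) {Y : ℝ} (hY : 0 ≤ Y) : 0 ≤ lam s Y :=
  div_nonneg (pow_nonneg (Real.log_nonneg (by linarith)) s) (by positivity)

lemma lam_mono (s : ℕ) {X Y : ℝ} (hX : 0 ≤ X) (hXY : X ≤ Y) : lam s X ≤ lam s Y := by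
  unfold lam
  have : 0 ≤ Real.log (1 + X) := Real.log_nonneg (by linarith)
  gcongr

lemma lam_le (s : ℕ) {Y : ℝ} (hY : 0 ≤ Y) : lam s Y ≤ 1 + Y := by
  have h := Real.pow_div_factorial_le_exp _ (Real.log_nonneg (by linarith : (1 : ℝ) ≤ 1 + Y)) s
  rwa [Real.exp_log (by linarith)] at h

lemma le_pow_succ_sub {a b : ℝ} (ha : 0 ≤ a) (hab : a ≤ b) (m : ℕ) :
    (m + 1) * a ^ m * (b - a) ≤ b ^ (m + 1) - a ^ (m + 1) := by
  induction m with
  | zero => simp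
  | succ m ih =>
    have e : b ^ (m + 1 + 1) - a ^ (m + 1 + 1) =
        a * (b ^ (m + 1) - a ^ (m + 1)) + (b - a) * b ^ (m + 1) := by ring
    have h1 : a ^ (m + 1) ≤ b ^ (m + 1) := by gcongr
    have h2 := mul_le_mul_of_nonneg_left ih ha
    have h3 := mul_le_mul_of_nonneg_left h1 (sub_nonneg.mpr hab)
    rw [e]
    push_cast
    calc _ = a * ((m + 1) * a ^ m * (b - a)) + (b - a) * a ^ (m + 1) := by ring
      _ ≤ _ := by linarith

lemma le_lam_sub (s : ℕ) {a b : ℝ} (ha : 0 ≤ a) (hab : a ≤ b) :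
    lam s a * ((b - a) / (1 + b)) ≤ lam (s + 1) b - lam (s + 1) a := by
  have hx : 0 ≤ Real.log (1 + a) := Real.log_nonneg (by linarith)
  have hxy : Real.log (1 + a) ≤ Real.log (1 + b) := Real.log_le_log (by linarith) (by linarith)
  have h := le_pow_succ_sub hx hxy s
  have hl : (b - a) / (1 + b) ≤ Real.log (1 + b) - Real.log (1 + a) := by
    have := Real.one_sub_inv_le_log_of_pos (x := (1 + b) / (1 + a)) (div_pos (by linarith) (by linarith))
    rw [Real.log_div (by linarith) (by linarith), inv_div] at this
    refine le_trans (le_of_eq ?_) this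
    have : 1 + b ≠ 0 := by linarith
    field_simp
    ring
  calc _ ≤ lam s a * (Real.log (1 + b) - Real.log (1 + a)) :=
        mul_le_mul_of_nonneg_left hl (lam_nonneg s ha)
    _ = ((s + 1) * Real.log (1 + a) ^ s * (Real.log (1 + b) - Real.log (1 + a))) /
        ((s + 1).factorial : ℝ) := by
        unfold lam
        rw [Nat.factorial_succ]
        push_cast
        field_simp
    _ ≤ (Real.log (1 + b) ^ (s + 1) - Real.log (1 + a) ^ (s + 1)) / ((s + 1).factorial : ℝ) := by
        gcongr
    _ = _ := by unfold lam; rw [sub_div]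

lemma lam_sub_le (s : ℕ) {a b : ℝ} (ha : 0 ≤ a) (hab : a ≤ b) :
    lam (s + 1) b - lam (s + 1) a ≤ lam s b * ((b - a) / (1 + a)) := by
  have hx : 0 ≤ Real.log (1 + a) := Real.log_nonneg (by linarith)
  have hxy : Real.log (1 + a) ≤ Real.log (1 + b) := Real.log_le_log (by linarith) (by linarith)
  have h := pow_sub_pow_le hx hxy (s + 1)
  have hl : Real.log (1 + b) - Real.log (1 + a) ≤ (b - a) / (1 + a) := by
    have := Real.log_le_sub_one_of_pos (x := (1 + b) / (1 + a)) (div_pos (by linarith) (by linarith))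
    rw [Real.log_div (by linarith) (by linarith)] at this
    refine this.trans (le_of_eq ?_)
    have : 1 + a ≠ 0 := by linarith
    field_simp
    ring
  calc _ = (Real.log (1 + b) ^ (s + 1) - Real.log (1 + a) ^ (s + 1)) / ((s + 1).factorial : ℝ) := by
        unfold lam; rw [sub_div]
    _ ≤ ((Real.log (1 + b) - Real.log (1 + a)) * (((s + 1 : ℕ) : ℝ) * Real.log (1 + b) ^ s)) /
        ((s + 1).factorial : ℝ) := by gcongr; exact h
    _ = lam s b * (Real.log (1 + b) - Real.log (1 + a)) := by
        unfold lam
        rw [Nat.factorial_succ]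
        push_cast
        field_simp
    _ ≤ _ := mul_le_mul_of_nonneg_left hl (lam_nonneg s (ha.trans hab))

lemma continuousAt_lam (s : ℕ) {Y : ℝ} (hY : 0 ≤ Y) : ContinuousAt (lam s) Y := by
  unfold lam
  refine ContinuousAt.div_const (ContinuousAt.pow (ContinuousAt.log (by fun_prop) ?_) s) _
  linarith

lemma lam_succ_zero (s : ℕ) : lam (s + 1) 0 = 0 := by simp [lam]

section
variable {q : ℝ}

lemma hasSum_lam_telescope (h0 : 0 < q) (h1 : q < 1) (s : ℕ) {Y : ℝ} (hY : 0 ≤ Y) :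
    HasSum (fun a : ℕ => lam (s + 1) (Y * q ^ a) - lam (s + 1) (Y * q ^ (a + 1)))
      (lam (s + 1) Y) := by
  rw [hasSum_iff_tendsto_nat_of_nonneg]
  · simp_rw [Finset.sum_range_sub' (fun a => lam (s + 1) (Y * q ^ a))]
    have t1 : Tendsto (fun n : ℕ => Y * q ^ n) atTop (𝓝 0) := by
      simpa using (tendsto_pow_atTop_nhds_zero_of_lt_one h0.le h1).const_mul Y
    have t2 := (continuousAt_lam (s + 1) le_rfl).tendsto.comp t1
    rw [lam_succ_zero] at t2
    have t3 := t2.const_sub (lam (s + 1) (Y * q ^ 0))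
    rw [pow_zero, mul_one, sub_zero] at t3
    simpa only [pow_zero, mul_one, Function.comp_def] using t3
  · intro a
    exact sub_nonneg.mpr (lam_mono _ (by positivity)
      (mul_le_mul_of_nonneg_left (pow_le_pow_of_le_one h0.le h1.le (Nat.le_succ a)) hY))

lemma kap_nonneg (h0 : 0 < q) (h1 : q < 1) (s : ℕ) {Y : ℝ} (hY : 0 ≤ Y) : 0 ≤ kap q s Y := by
  induction s generalizing Y with
  | zero => simp [kap]
  | succ s ih =>
    rw [kap]
    refine tsum_nonneg fun a => mul_nonneg ?_ (ih (by positivity))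
    have : 0 ≤ 1 - q := by linarith
    positivity

lemma kap_term_nonneg (h0 : 0 < q) (h1 : q < 1) (s : ℕ) {Y : ℝ} (hY : 0 ≤ Y) (a : ℕ) :
    0 ≤ (1 - q) / q * (Y * q ^ (a + 1)) / (1 + Y * q ^ (a + 1)) * kap q s (Y * q ^ (a + 1)) := by
  have : 0 ≤ 1 - q := by linarith
  refine mul_nonneg (by positivity) (kap_nonneg h0 h1 s (by positivity))

lemma kap_term_le (h0 : 0 < q) (h1 : q < 1) (s : ℕ) {b : ℝ} (hb : 0 ≤ b)
    (h : kap q s (b * q) ≤ q⁻¹ ^ s * lam s (b * q)) :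
    (1 - q) / q * (b * q) / (1 + b * q) * kap q s (b * q) ≤
      q⁻¹ ^ (s + 1) * (lam (s + 1) b - lam (s + 1) (b * q)) := by
  have hbq : b * q ≤ b := mul_le_of_le_one_right hb h1.le
  have e := le_lam_sub s (by positivity : 0 ≤ b * q) hbq
  have hp : 0 ≤ 1 - q := by linarith
  have h2 : (1 - q) / q * (b * q) / (1 + b * q) ≤ q⁻¹ * ((b - b * q) / (1 + b)) := by
    have e1 : (1 - q) / q * (b * q) = b - b * q := by field_simp
    have hbb : 0 ≤ b - b * q := by linarith
    rw [e1, div_le_iff₀ (by positivity)]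
    have : q⁻¹ * ((b - b * q) / (1 + b)) * (1 + b * q) =
        (b - b * q) * ((1 + b * q) / (q * (1 + b))) := by field_simp
    rw [this]
    refine le_mul_of_one_le_right hbb ?_
    rw [one_le_div (by positivity)]
    nlinarith
  calc _ ≤ q⁻¹ * ((b - b * q) / (1 + b)) * (q⁻¹ ^ s * lam s (b * q)) := by
        have := kap_nonneg h0 h1 s (by positivity : 0 ≤ b * q)
        have hbb : 0 ≤ b - b * q := by linarith
        gcongr
    _ = q⁻¹ ^ (s + 1) * (lam s (b * q) * ((b - b * q) / (1 + b))) := by ring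
    _ ≤ _ := by gcongr

/-- The terms of the Riemann sum are bounded by increments of `lam`, which telescope. -/
lemma kap_le_lam (h0 : 0 < q) (h1 : q < 1) (s : ℕ) {Y : ℝ} (hY : 0 ≤ Y) :
    kap q s Y ≤ q⁻¹ ^ s * lam s Y := by
  induction s generalizing Y with
  | zero => simp [kap, lam]
  | succ s ih =>
    rw [kap]
    refine Real.tsum_le_of_sum_le (kap_term_nonneg h0 h1 s hY) fun t => ?_
    have ht := (hasSum_lam_telescope h0 h1 s hY).mul_left (q⁻¹ ^ (s + 1))
    refine (Finset.sum_le_sum fun a _ => ?_).trans (sum_le_hasSum t (fun a _ => ?_) ht)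
    · have := kap_term_le h0 h1 s (b := Y * q ^ a) (by positivity) (ih (by positivity))
      rwa [mul_assoc, ← pow_succ] at this
    · exact mul_nonneg (by positivity) (sub_nonneg.mpr (lam_mono _ (by positivity)
        (mul_le_mul_of_nonneg_left (pow_le_pow_of_le_one h0.le h1.le (Nat.le_succ a)) hY)))

lemma summable_kap (h0 : 0 < q) (h1 : q < 1) (s : ℕ) {Y : ℝ} (hY : 0 ≤ Y) :
    Summable fun a : ℕ => (1 - q) / q * (Y * q ^ (a + 1)) / (1 + Y * q ^ (a + 1)) *
      kap q s (Y * q ^ (a + 1)) := by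
  refine Summable.of_nonneg_of_le (kap_term_nonneg h0 h1 s hY) (fun a => ?_)
    ((hasSum_lam_telescope h0 h1 s hY).mul_left (q⁻¹ ^ (s + 1))).summable
  have := kap_term_le h0 h1 s (b := Y * q ^ a) (by positivity) (kap_le_lam h0 h1 s (by positivity))
  rwa [mul_assoc, ← pow_succ] at this

/-- The counterpart of `kap_le_lam`, at the cost of shrinking the argument. -/
lemma lam_le_kap (h0 : 0 < q) (h1 : q < 1) (s : ℕ) {Y : ℝ} (hY : 0 ≤ Y) :
    lam s (q ^ s * Y) ≤ kap q s Y := by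
  induction s generalizing Y with
  | zero => simp [kap, lam]
  | succ s ih =>
    have ht := hasSum_lam_telescope h0 h1 s (Y := q ^ (s + 1) * Y) (by positivity)
    rw [← ht.tsum_eq, kap]
    refine ht.summable.tsum_le_tsum (fun a => ?_) (summable_kap h0 h1 s hY)
    set b := Y * q ^ a with hb
    have hb0 : 0 ≤ b := by positivity
    have e1 : Y * q ^ (a + 1) = b * q := by rw [hb]; ring
    have e2 : q ^ (s + 1) * Y * q ^ a = q ^ (s + 1) * b := by rw [hb]; ring
    have e3 : q ^ (s + 1) * Y * q ^ (a + 1) = q ^ (s + 1) * b * q := by rw [hb]; ring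
    rw [e1, e2, e3]
    have hB : q ^ (s + 1) * b ≤ b := mul_le_of_le_one_left hb0 (pow_le_one₀ h0.le h1.le)
    set B := q ^ (s + 1) * b with hBdef
    have hB0 : 0 ≤ B := by positivity
    have hBq : B * q ≤ B := mul_le_of_le_one_right hB0 h1.le
    have hp : 0 ≤ 1 - q := by linarith
    refine (lam_sub_le s (by positivity) hBq).trans ?_
    have hk := ih (Y := b * q) (by positivity)
    rw [show q ^ s * (b * q) = B by rw [hBdef]; ring] at hk
    have hfr : (B - B * q) / (1 + B * q) ≤ (1 - q) / q * (b * q) / (1 + b * q) := by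
      have e4 : (1 - q) / q * (b * q) = b - b * q := by field_simp
      rw [e4, div_le_div_iff₀ (by positivity) (by positivity)]
      nlinarith [mul_nonneg hp (sub_nonneg.mpr hB)]
    rw [mul_comm (lam s B)]
    have := lam_nonneg s hB0
    gcongr

lemma kap_mono (h0 : 0 < q) (h1 : q < 1) (s : ℕ) {X Y : ℝ} (hX : 0 ≤ X) (hXY : X ≤ Y) :
    kap q s X ≤ kap q s Y := by
  induction s generalizing X Y with
  | zero => simp [kap]
  | succ s ih =>
    have hY := hX.trans hXY
    rw [kap, kap]
    refine (summable_kap h0 h1 s hX).tsum_le_tsum (fun a => ?_) (summable_kap h0 h1 s hY)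
    have h2 : X * q ^ (a + 1) ≤ Y * q ^ (a + 1) := by gcongr
    have h3 := ih (by positivity) h2
    have hp : 0 ≤ 1 - q := by linarith
    have h4 := kap_nonneg h0 h1 s (by positivity : 0 ≤ X * q ^ (a + 1))
    have h5 : X * q ^ (a + 1) / (1 + X * q ^ (a + 1)) ≤ Y * q ^ (a + 1) / (1 + Y * q ^ (a + 1)) := by
      rw [div_le_div_iff₀ (by positivity) (by positivity)]
      nlinarith
    rw [mul_div_assoc ((1 - q) / q) (X * q ^ (a + 1)), mul_div_assoc ((1 - q) / q) (Y * q ^ (a + 1))]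
    gcongr

end

/-! ### The generating function of the expectations, computed in two ways -/

lemma hasSum_of_eq {E : Type*} [AddCommMonoid E] [TopologicalSpace E] {f f' : ℕ → E} {a a' : E}
    (h : HasSum f a) (hf : ∀ n, f' n = f n) (ha : a' = a) : HasSum f' a' :=
  ha ▸ h.congr_fun hf

/-- Interchange of two summations, under a summable majorant. -/
lemma hasSum_tsum_of_norm_le {E : Type*} [NormedAddCommGroup E] [CompleteSpace E]
    {F : ℕ → ℕ → E} {G : ℕ → ℕ → ℝ} {A : ℕ → E} {B : ℕ → ℝ} {a : ℕ → E}
    (hFG : ∀ j n, ‖F j n‖ ≤ G j n) (hG : ∀ j, HasSum (G j) (B j)) (hB : Summable B)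
    (hF : ∀ j, HasSum (F j) (A j)) (ha : ∀ n, HasSum (fun j => F j n) (a n)) :
    HasSum a (∑' j, A j) := by
  have hGs : Summable fun z : ℕ × ℕ => G z.1 z.2 := by
    rw [summable_prod_of_nonneg fun z => (norm_nonneg _).trans (hFG z.1 z.2)]
    exact ⟨fun j => (hG j).summable, by simpa only [(hG _).tsum_eq] using hB⟩
  have hFs : Summable fun z : ℕ × ℕ => F z.1 z.2 :=
    Summable.of_norm_bounded hGs fun z => hFG z.1 z.2
  have h1 := hFs.hasSum.prod_fiberwise hF
  rw [h1.tsum_eq]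
  have h2 := ((Equiv.prodComm ℕ ℕ).hasSum_iff.mpr hFs.hasSum)
  exact h2.prod_fiberwise ha

section
variable {q : ℝ}

lemma hasSum_prec_succ (h0 : 0 < q) (h1 : q < 1) (s m v : ℕ) :
    HasSum (fun a : ℕ => (1 - q) * q ^ (a + v) * prec q s m (a + v + 1))
      (prec q (s + 1) (m + 1) v - (1 - q ^ v) * prec q (s + 1) m v) := by
  have b1 : ∀ b, |(if v < b then prec q s m b else 0 : ℝ)| ≤ 1 := fun b => by
    split_ifs
    · rw [abs_of_nonneg (prec_nonneg _ _ _ _)]; exact prec_le_one h0 h1 _ _ _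
    · simp
  have b2 : ∀ b, |(if v < b then 0 else 1 : ℝ)| ≤ 1 := fun b => by split_ifs <;> simp
  have e : prec q (s + 1) (m + 1) v - (1 - q ^ v) * prec q (s + 1) m v =
      ∫ b, (if v < b then prec q s m b else 0 : ℝ) ∂(letterLaw q) := by
    rw [prec_succ h0 h1, ← integral_le h0 h1, mul_comm, ← integral_const_mul, ← integral_sub]
    · congr 1; ext b
      split_ifs <;> simp_all
    · refine integrable_letterLaw h0 h1 (C := 1) fun b => ?_
      split_ifs
      · simp
      · rw [abs_of_nonneg (prec_nonneg _ _ _ _)]; exact prec_le_one h0 h1 _ _ _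
      · rw [abs_of_nonneg (prec_nonneg _ _ _ _)]; exact prec_le_one h0 h1 _ _ _
    · exact (integrable_letterLaw h0 h1 b2).const_mul _
  rw [e]
  have h := (hasSum_nat_add_iff' v).mpr (hasSum_integral_letterLaw h0 h1 b1)
  rw [Finset.sum_eq_zero (fun k hk => ?_), sub_zero] at h
  · refine h.congr_fun fun a => ?_
    rw [if_pos (by omega)]
  · rw [if_neg (by simp at hk; omega), mul_zero]

lemma prec_zero_eq (h0 : 0 < q) (h1 : q < 1) (m v : ℕ) : prec q 0 m v = (1 - q ^ v) ^ m := by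
  induction m with
  | zero => rw [prec_zero h0 h1]; simp
  | succ m ih =>
    rw [prec_succ h0 h1, pow_succ, ← ih, ← integral_le h0 h1 v, ← integral_const_mul]
    congr 1; ext b
    by_cases hvb : v < b <;> simp [hvb]

lemma one_sub_mul_div {y : ℝ} (hy : 0 < y) (u : ℝ) :
    1 - (1 - u) * (y / (1 + y)) = (1 + y * u) / (1 + y) := by
  have : 1 + y ≠ 0 := by positivity
  field_simp
  ring

lemma summable_prec_mul (h0 : 0 < q) (h1 : q < 1) (s v : ℕ) {y : ℝ} (hy : 0 < y) :
    Summable fun m => prec q s m v * (y / (1 + y)) ^ m := by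
  refine Summable.of_nonneg_of_le (fun m => mul_nonneg (prec_nonneg _ _ _ _) (by positivity))
    (fun m => ?_) (summable_geometric_of_lt_one (by positivity : 0 ≤ y / (1 + y))
      ((div_lt_one (by positivity)).mpr (by linarith)))
  exact mul_le_of_le_one_left (by positivity) (prec_le_one h0 h1 _ _ _)

/-- The generating function, over the length of a word, of the probability of having `s` records
above `v`. -/
lemma hasSum_prec (h0 : 0 < q) (h1 : q < 1) (s v : ℕ) {y : ℝ} (hy : 0 < y) :
    HasSum (fun m => prec q s m v * (y / (1 + y)) ^ m)
      ((1 + y) * kap q s (y * q ^ v) / (1 + y * q ^ v)) := by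
  have hy1 : 1 + y ≠ 0 := by positivity
  have hyv : 1 + y * q ^ v ≠ 0 := by positivity
  induction s generalizing v with
  | zero =>
    have hq : q ^ v ≤ 1 := pow_le_one₀ h0.le h1.le
    have e : ∀ m, prec q 0 m v * (y / (1 + y)) ^ m = ((1 - q ^ v) * (y / (1 + y))) ^ m := fun m => by
      rw [prec_zero_eq h0 h1, mul_pow]
    simp_rw [e]
    have h := hasSum_geometric_of_lt_one (r := (1 - q ^ v) * (y / (1 + y)))
      (mul_nonneg (by linarith) (by positivity)) (by
        have := one_sub_mul_div hy (q ^ v)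
        have h3 : 0 < (1 + y * q ^ v) / (1 + y) := by positivity
        linarith)
    rw [one_sub_mul_div hy, inv_div] at h
    simpa [kap] using h
  | succ s ih =>
    set x := y / (1 + y) with hx
    have hx0 : 0 ≤ x := by positivity
    have hS := summable_prec_mul h0 h1 (s + 1) v hy
    rw [← hx] at hS
    set S := ∑' m, prec q (s + 1) m v * x ^ m with hSdef
    have hk := (summable_kap h0 h1 s (by positivity : 0 ≤ y * q ^ v)).hasSum
    rw [← kap.eq_2] at hk
    have hA : ∀ a : ℕ, HasSum (fun m => (1 - q) * q ^ (a + v) * prec q s m (a + v + 1) * x ^ m)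
        ((1 + y) / y * ((1 - q) / q * (y * q ^ v * q ^ (a + 1)) / (1 + y * q ^ v * q ^ (a + 1)) *
          kap q s (y * q ^ v * q ^ (a + 1)))) := fun a => by
      have h := (ih (a + v + 1) (by positivity)).mul_left ((1 - q) * q ^ (a + v))
      have e : y * q ^ v * q ^ (a + 1) = y * q ^ (a + v + 1) := by ring
      rw [e]
      refine hasSum_of_eq h (fun m => ?_) ?_
      · ring
      · have : 1 + y * q ^ (a + v + 1) ≠ 0 := by positivity
        rw [pow_succ] at this ⊢
        field_simp
    have hD := hasSum_tsum_of_norm_le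
      (F := fun a m => (1 - q) * q ^ (a + v) * prec q s m (a + v + 1) * x ^ m)
      (fun a m => le_of_eq (Real.norm_of_nonneg (mul_nonneg (mul_nonneg
        (letterLaw_weight h1 h0 _) (prec_nonneg _ _ _ _)) (by positivity))))
      hA (hk.summable.mul_left _) hA (fun m => (hasSum_prec_succ h0 h1 s m v).mul_right _)
    rw [tsum_mul_left, hk.tsum_eq] at hD
    have hT := (hasSum_nat_add_iff' 1).mpr hS.hasSum
    simp only [Finset.range_one, Finset.sum_singleton, prec_zero h0 h1, Nat.add_eq_zero_iff,
      one_ne_zero, and_false, if_false, zero_mul, sub_zero] at hT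
    have hE := (hD.mul_left x).add (hS.hasSum.mul_left (x * (1 - q ^ v)))
    have hfun : ∀ m, prec q (s + 1) (m + 1) v * x ^ (m + 1) =
        x * ((prec q (s + 1) (m + 1) v - (1 - q ^ v) * prec q (s + 1) m v) * x ^ m) +
        x * (1 - q ^ v) * (prec q (s + 1) m v * x ^ m) := fun m => by ring
    have hu := hT.unique (hE.congr_fun hfun)
    rw [← hSdef] at hu
    have hval : S = (1 + y) * kap q (s + 1) (y * q ^ v) / (1 + y * q ^ v) := by
      rw [eq_div_iff hyv]
      have hxy : x * ((1 + y) / y) = 1 := by rw [hx]; field_simp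
      have h3 := one_sub_mul_div hy (q ^ v)
      rw [← hx, eq_div_iff hy1] at h3
      have h4 : S - x * (1 - q ^ v) * S = kap q (s + 1) (y * q ^ v) := by
        rw [← mul_assoc, hxy, one_mul] at hu
        linarith
      rw [← h4, ← h3]
      ring
    rw [← hval]
    exact hS.hasSum

/-- The summand, as a function of `Y = y q^ν`, in the generating function of the expectations. -/
def genF (q : ℝ) (r : ℕ) (Y : ℝ) : ℝ :=
  (1 - q) * Y / (1 + Y) ^ 2 * (kap q (r - 1) (q * Y) / (1 + q * Y))

lemma genF_nonneg (h0 : 0 < q) (h1 : q < 1) (r : ℕ) {Y : ℝ} (hY : 0 ≤ Y) : 0 ≤ genF q r Y := by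
  have := kap_nonneg h0 h1 (r - 1) (by positivity : 0 ≤ q * Y)
  have : 0 ≤ 1 - q := by linarith
  unfold genF
  positivity

lemma genF_le (h0 : 0 < q) (h1 : q < 1) (r : ℕ) {Y : ℝ} (hY : 0 ≤ Y) :
    genF q r Y ≤ (1 - q) * q⁻¹ ^ (r - 1) * (Y / (1 + Y) ^ 2) := by
  have hqY : 0 ≤ q * Y := by positivity
  have hp : 0 ≤ 1 - q := by linarith
  have h := kap_le_lam h0 h1 (r - 1) hqY
  have h2 := mul_le_mul_of_nonneg_left (lam_le (r - 1) hqY) (by positivity : 0 ≤ q⁻¹ ^ (r - 1))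
  have h3 : kap q (r - 1) (q * Y) / (1 + q * Y) ≤ q⁻¹ ^ (r - 1) := by
    rw [div_le_iff₀ (by positivity)]
    linarith
  unfold genF
  calc _ ≤ (1 - q) * Y / (1 + Y) ^ 2 * q⁻¹ ^ (r - 1) := by gcongr
    _ = _ := by ring

lemma hasSum_sum_mul_prec (h0 : 0 < q) (h1 : q < 1) (s ν : ℕ) {y : ℝ} (hy : 0 < y) :
    HasSum (fun n => (∑ i ∈ Finset.range n, (i : ℝ) * ((1 - q) * q ^ ν * ((1 - q ^ ν) ^ i *
        prec q s (n - 1 - i) (ν + 1)))) * (y / (1 + y)) ^ n)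
      (y * (1 + y) * ((1 - q ^ ν) * genF q (s + 1) (y * q ^ ν))) := by
  have hy1 : 1 + y ≠ 0 := by positivity
  have hyν : 1 + y * q ^ ν ≠ 0 := by positivity
  set x := y / (1 + y) with hx
  have hx0 : 0 ≤ x := by positivity
  have hq : q ^ ν ≤ 1 := pow_le_one₀ h0.le h1.le
  have hz0 : 0 ≤ (1 - q ^ ν) * x := mul_nonneg (by linarith) hx0
  have hone := one_sub_mul_div hy (q ^ ν)
  rw [← hx] at hone
  have hz1 : (1 - q ^ ν) * x < 1 := by
    have h3 : 0 < (1 + y * q ^ ν) / (1 + y) := by positivity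
    linarith
  have hA := hasSum_coe_mul_geometric_of_norm_lt_one (𝕜 := ℝ) (r := (1 - q ^ ν) * x)
    (by rwa [Real.norm_of_nonneg hz0])
  have hB := hasSum_prec h0 h1 s (ν + 1) hy
  rw [← hx] at hB
  have hAB := hA.summable.norm.mul_norm hB.summable.norm
  have hsum : Summable fun n => ∑ i ∈ Finset.range (n + 1),
      ((i : ℝ) * ((1 - q ^ ν) * x) ^ i) * (prec q s (n - i) (ν + 1) * x ^ (n - i)) :=
    (summable_norm_sum_mul_range_of_summable_norm hA.summable.norm hB.summable.norm).of_norm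
  have hC := tsum_mul_tsum_eq_tsum_sum_range_of_summable_norm hA.summable.norm hB.summable.norm
  have hH := hsum.hasSum
  rw [← hC, hA.tsum_eq, hB.tsum_eq] at hH
  rw [← hasSum_nat_add_iff' 1]
  simp only [Finset.range_one, Finset.sum_singleton, Finset.range_zero, Finset.sum_empty, zero_mul,
    sub_zero]
  refine hasSum_of_eq (hH.mul_left ((1 - q) * q ^ ν * x)) (fun n => ?_) ?_
  · rw [Finset.mul_sum, Finset.sum_mul]
    refine Finset.sum_congr rfl fun i hi => ?_
    have hi' : i ≤ n := by simp at hi; omega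
    have e : x ^ (n + 1) = x * (x ^ i * x ^ (n - i)) := by
      rw [← pow_add, ← pow_succ']; congr 1; omega
    rw [e, mul_pow, Nat.add_sub_cancel]
    ring
  · have e1 : q * (y * q ^ ν) = y * q ^ (ν + 1) := by ring
    have : 1 + y * q ^ (ν + 1) ≠ 0 := by positivity
    rw [hone, genF, e1, hx, Nat.add_sub_cancel]
    field_simp

/-- The generating function of the expectations, from the decomposition of a word at the `r`th
record from the right. -/
lemma hasSum_avgPos_mul_pow (h0 : 0 < q) (h1 : q < 1) {r : ℕ} (hr : 1 ≤ r) {y : ℝ} (hy : 0 < y) :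
    HasSum (fun n => avgPos q r n * (y / (1 + y)) ^ n)
      (y * (1 + y) * ∑' ν : ℕ, (1 - q ^ ν) * genF q r (y * q ^ ν)) := by
  obtain ⟨s, rfl⟩ : ∃ s, r = s + 1 := ⟨r - 1, by omega⟩
  have hp : 0 ≤ 1 - q := by linarith
  have hb : ∀ ν : ℕ, 0 ≤ 1 - q ^ ν := fun ν => sub_nonneg.mpr (pow_le_one₀ h0.le h1.le)
  rw [← tsum_mul_left]
  refine hasSum_tsum_of_norm_le (fun ν n => le_of_eq (Real.norm_of_nonneg ?_))
    (hasSum_sum_mul_prec h0 h1 s · hy) ?_ (hasSum_sum_mul_prec h0 h1 s · hy) fun n => ?_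
  · refine mul_nonneg (Finset.sum_nonneg fun i _ => ?_) (by positivity)
    have := hb ν
    have := prec_nonneg q s (n - 1 - i) (ν + 1)
    positivity
  · refine Summable.mul_left _ (Summable.of_nonneg_of_le
      (fun ν => mul_nonneg (hb ν) (genF_nonneg h0 h1 _ (by positivity))) (fun ν => ?_)
      ((summable_geometric_of_lt_one h0.le h1).mul_left ((1 - q) * q⁻¹ ^ s * y)))
    calc _ ≤ 1 * ((1 - q) * q⁻¹ ^ s * (y * q ^ ν / (1 + y * q ^ ν) ^ 2)) := by
          refine mul_le_mul (by linarith [pow_nonneg h0.le ν]) (genF_le h0 h1 (s + 1) (by positivity))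
            (genF_nonneg h0 h1 _ (by positivity)) zero_le_one
      _ ≤ (1 - q) * q⁻¹ ^ s * (y * q ^ ν) := by
          rw [one_mul]
          refine mul_le_mul_of_nonneg_left (div_le_self (by positivity) ?_) (by positivity)
          refine one_le_pow₀ ?_
          have : 0 < y * q ^ ν := by positivity
          linarith
      _ = _ := by ring
  · refine HasSum.mul_right _ ?_
    rw [avgPos_eq h0 h1 _ hr]
    exact hasSum_sum fun i _ => (summable_avgPos h0 h1 s i _).hasSum.mul_left _

lemma hasSum_binTail_mul_pow {u y : ℝ} (hu : 0 < u) (hu1 : u ≤ 1) (hy : 0 < y) :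
    HasSum (fun n => binTail n u * (y / (1 + y)) ^ n)
      ((1 + y) * ((y * u) ^ 2 / (1 + y * u) ^ 2)) := by
  have hy1 : 1 + y ≠ 0 := by positivity
  have hyu : 1 + y * u ≠ 0 := by positivity
  set x := y / (1 + y) with hx
  have hx0 : 0 ≤ x := by positivity
  have hone := one_sub_mul_div hy u
  have hone0 := one_sub_mul_div hy 0
  rw [← hx] at hone hone0
  have hz1 : (1 - u) * x < 1 := by
    have h3 : 0 < (1 + y * u) / (1 + y) := by positivity
    linarith
  have hx1 : x < 1 := (div_lt_one (by positivity)).mpr (by linarith)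
  have hz0 : 0 ≤ (1 - u) * x := mul_nonneg (by linarith) hx0
  have a1 := hasSum_geometric_of_lt_one hx0 hx1
  have a2 := hasSum_geometric_of_lt_one hz0 hz1
  have hA := hasSum_coe_mul_geometric_of_norm_lt_one (𝕜 := ℝ) (r := (1 - u) * x)
    (by rwa [Real.norm_of_nonneg hz0])
  -- `n (1-u)^(n-1) x^n` is obtained by shifting the index, to avoid the division by `1 - u`
  have a3 : HasSum (fun n : ℕ => (n : ℝ) * (1 - u) ^ (n - 1) * x ^ n)
      (x * ((1 - u) * x / (1 - (1 - u) * x) ^ 2 + (1 - (1 - u) * x)⁻¹)) := by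
    rw [← hasSum_nat_add_iff' 1]
    simp only [Finset.range_one, Finset.sum_singleton, Nat.cast_zero, zero_mul, sub_zero]
    refine ((hA.add a2).mul_left x).congr_fun fun n => ?_
    rw [Nat.add_sub_cancel, mul_pow]
    push_cast
    ring
  have h := (a1.sub a2).sub (a3.mul_left u)
  refine hasSum_of_eq (h) (fun n => ?_) ?_
  · rw [binTail, mul_pow]; ring
  · have hx2 : 1 - x = 1 / (1 + y) := by rw [hx]; field_simp; ring
    rw [hone, hx2, hx]
    field_simp
    ring

lemma hasSum_pow_sub_mul_pow {u y : ℝ} (hu : 0 < u) (hu1 : u ≤ 1) (hy : 0 < y) :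
    HasSum (fun n : ℕ => ((1 - u) ^ n - 1 + n * u) * (y / (1 + y)) ^ n)
      ((1 + y) * ((y * u) ^ 2 / (1 + y * u))) := by
  have hy1 : 1 + y ≠ 0 := by positivity
  have hyu : 1 + y * u ≠ 0 := by positivity
  set x := y / (1 + y) with hx
  have hx0 : 0 ≤ x := by positivity
  have hone := one_sub_mul_div hy u
  rw [← hx] at hone
  have hz1 : (1 - u) * x < 1 := by
    have h3 : 0 < (1 + y * u) / (1 + y) := by positivity
    linarith
  have hx1 : x < 1 := (div_lt_one (by positivity)).mpr (by linarith)
  have hz0 : 0 ≤ (1 - u) * x := mul_nonneg (by linarith) hx0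
  have a1 := hasSum_geometric_of_lt_one hx0 hx1
  have a2 := hasSum_geometric_of_lt_one hz0 hz1
  have hA := hasSum_coe_mul_geometric_of_norm_lt_one (𝕜 := ℝ) (r := x)
    (by rwa [Real.norm_of_nonneg hx0])
  have h := (a2.sub a1).add (hA.mul_left u)
  refine hasSum_of_eq (h) (fun n => ?_) ?_
  · rw [mul_pow]; ring
  · have hx2 : 1 - x = 1 / (1 + y) := by rw [hx]; field_simp; ring
    rw [hone, hx2, hx]
    field_simp
    ring

lemma pow_sub_one_add_mul_nonneg {u : ℝ} (hu1 : u ≤ 1) (n : ℕ) :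
    0 ≤ (1 - u) ^ n - 1 + n * u := by
  have h := one_add_mul_le_pow (a := -u) (by linarith) n
  have e : 1 + -u = 1 - u := by ring
  rw [e] at h
  linarith

/-- Comparison of the two expressions for the generating function of the expectations. -/
lemma tsum_genF_eq (h0 : 0 < q) (h1 : q < 1) {r : ℕ} (hr : 1 ≤ r) {y : ℝ} (hy : 0 < y) :
    ((∑' ν : ℕ, (1 - q ^ ν) * genF q r (y * q ^ ν) : ℝ) : ℂ) =
      (sgnC q r : ℂ) * ((betaR q r : ℂ) *
        ((∑' j : ℕ, (1 - q ^ j) * (y * q ^ j / (1 + y * q ^ j) ^ 2) : ℝ) : ℂ) +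
        ∑' j : ℕ, hcoef q r j * (q : ℂ) ^ j * ((y * q ^ j / (1 + y * q ^ j) : ℝ) : ℂ)) := by
  have hp : 0 ≤ 1 - q := by linarith
  have hq1 : ∀ j : ℕ, q ^ j ≤ 1 := fun j => pow_le_one₀ h0.le h1.le
  have hQ : ∀ j : ℕ, 0 ≤ q⁻¹ ^ j - 1 := fun j =>
    sub_nonneg.mpr (one_le_pow₀ ((one_le_inv₀ h0).mpr h1.le))
  have hb : ∀ j : ℕ, HasSum (fun n => (q⁻¹ ^ j - 1) * binTail n (q ^ j) * (y / (1 + y)) ^ n)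
      (y * (1 + y) * ((1 - q ^ j) * (y * q ^ j / (1 + y * q ^ j) ^ 2))) := fun j => by
    have h := (hasSum_binTail_mul_pow (pow_pos h0 j) (hq1 j) hy).mul_left (q⁻¹ ^ j - 1)
    refine hasSum_of_eq (h) (fun n => ?_) ?_
    · ring
    · have : 1 + y * q ^ j ≠ 0 := by positivity
      rw [inv_pow]
      field_simp
  have hc : ∀ j : ℕ, HasSum (fun n : ℕ => ((1 - q ^ j) ^ n - 1 + n * q ^ j) * (y / (1 + y)) ^ n)
      (y * (1 + y) * (q ^ j * (y * q ^ j / (1 + y * q ^ j)))) := fun j => by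
    have h := hasSum_pow_sub_mul_pow (pow_pos h0 j) (hq1 j) hy
    exact hasSum_of_eq h (fun n => rfl) (by ring)
  have s1 : Summable fun j : ℕ => (1 - q ^ j) * (y * q ^ j / (1 + y * q ^ j) ^ 2) := by
    refine Summable.of_nonneg_of_le (fun j => mul_nonneg (by linarith [hq1 j]) (by positivity))
      (fun j => ?_) ((summable_geometric_of_lt_one h0.le h1).mul_left y)
    calc _ ≤ 1 * (y * q ^ j) := by
          refine mul_le_mul (by linarith [pow_pos h0 j]) (div_le_self (by positivity)
            (one_le_pow₀ ?_)) (by positivity) zero_le_one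
          have : 0 < y * q ^ j := by positivity
          linarith
      _ = _ := one_mul _
  have hqn : ‖(q : ℂ)‖ < 1 := by rwa [Complex.norm_real, Real.norm_of_nonneg h0.le]
  have sh : Summable fun j : ℕ => ‖hcoef q r j‖ * q ^ j := by
    have := (hasSum_hcoef h0 h1 r hqn).summable.norm
    simpa [abs_of_pos h0] using this
  have hfr : ∀ j : ℕ, y * q ^ j / (1 + y * q ^ j) ≤ 1 := fun j => by
    rw [div_le_one (by positivity)]; linarith
  have s2 : Summable fun j : ℕ => ‖hcoef q r j‖ * (q ^ j * (y * q ^ j / (1 + y * q ^ j))) := by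
    refine Summable.of_nonneg_of_le (fun j => by positivity) (fun j => ?_) sh
    refine mul_le_mul_of_nonneg_left (mul_le_of_le_one_right (by positivity) (hfr j))
      (norm_nonneg _)
  have s3 : Summable fun j : ℕ => hcoef q r j * (q : ℂ) ^ j *
      ((y * q ^ j / (1 + y * q ^ j) : ℝ) : ℂ) := by
    refine Summable.of_norm_bounded s2 fun j => le_of_eq ?_
    rw [norm_mul, norm_mul, norm_pow, Complex.norm_real, Complex.norm_real,
      Real.norm_of_nonneg h0.le, Real.norm_of_nonneg (by positivity), mul_assoc]
  have H := hasSum_tsum_of_norm_le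
    (F := fun j n => (sgnC q r : ℂ) * ((betaR q r : ℂ) * (((q⁻¹ ^ j - 1) * binTail n (q ^ j) : ℝ))
      + hcoef q r j * (((1 - q ^ j) ^ n - 1 + n * q ^ j : ℝ) : ℂ)) * (((y / (1 + y)) ^ n : ℝ) : ℂ))
    (G := fun j n => ‖(sgnC q r : ℂ)‖ * (‖(betaR q r : ℂ)‖ *
      ((q⁻¹ ^ j - 1) * binTail n (q ^ j) * (y / (1 + y)) ^ n) +
      ‖hcoef q r j‖ * (((1 - q ^ j) ^ n - 1 + n * q ^ j) * (y / (1 + y)) ^ n)))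
    (A := fun j => (sgnC q r : ℂ) * ((betaR q r : ℂ) *
      ((y * (1 + y) * ((1 - q ^ j) * (y * q ^ j / (1 + y * q ^ j) ^ 2)) : ℝ) : ℂ) +
      hcoef q r j * ((y * (1 + y) * (q ^ j * (y * q ^ j / (1 + y * q ^ j))) : ℝ) : ℂ)))
    (B := fun j => ‖(sgnC q r : ℂ)‖ * (‖(betaR q r : ℂ)‖ *
      (y * (1 + y) * ((1 - q ^ j) * (y * q ^ j / (1 + y * q ^ j) ^ 2))) +
      ‖hcoef q r j‖ * (y * (1 + y) * (q ^ j * (y * q ^ j / (1 + y * q ^ j))))))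
    (a := fun n => (avgPos q r n : ℂ) * (((y / (1 + y)) ^ n : ℝ) : ℂ))
    (fun j n => ?_) (fun j => (((hb j).mul_left _).add ((hc j).mul_left _)).mul_left _) ?_
    (fun j => ?_) (fun n => (hasSum_avgPos h0 h1 hr n).mul_right _)
  · have H2 := (Complex.hasSum_ofReal (f := fun n => avgPos q r n * (y / (1 + y)) ^ n)).mpr
      (hasSum_avgPos_mul_pow h0 h1 hr hy)
    have hu := H2.unique (H.congr_fun fun n => Complex.ofReal_mul _ _)
    have hyy : ((y * (1 + y) : ℝ) : ℂ) ≠ 0 := Complex.ofReal_ne_zero.mpr (by positivity)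
    refine mul_left_cancel₀ hyy ?_
    rw [← Complex.ofReal_mul, hu, tsum_mul_left, mul_left_comm]
    congr 1
    have s1' := (Complex.hasSum_ofReal.mpr s1.hasSum).mul_left
      (((y * (1 + y) : ℝ) : ℂ) * (betaR q r : ℂ))
    have s3' := s3.hasSum.mul_left ((y * (1 + y) : ℝ) : ℂ)
    rw [mul_add ((y * (1 + y) : ℝ) : ℂ), ← mul_assoc ((y * (1 + y) : ℝ) : ℂ) (betaR q r : ℂ),
      ← (s1'.add s3').tsum_eq]
    refine tsum_congr fun j => ?_
    push_cast
    ring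
  · rw [norm_mul, norm_mul, mul_assoc]
    refine mul_le_mul_of_nonneg_left ?_ (norm_nonneg _)
    have hxn : 0 ≤ (y / (1 + y)) ^ n := by positivity
    have e1 : ‖(((y / (1 + y)) ^ n : ℝ) : ℂ)‖ = (y / (1 + y)) ^ n := by
      rw [Complex.norm_real, Real.norm_of_nonneg hxn]
    rw [e1]
    refine (mul_le_mul_of_nonneg_right (norm_add_le _ _) hxn).trans (le_of_eq ?_)
    rw [norm_mul, norm_mul, Complex.norm_real ((q⁻¹ ^ j - 1) * binTail n (q ^ j)),
      Complex.norm_real ((1 - q ^ j) ^ n - 1 + n * q ^ j),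
      Real.norm_of_nonneg (mul_nonneg (hQ j) (binTail_nonneg (hq1 j) n)),
      Real.norm_of_nonneg (pow_sub_one_add_mul_nonneg (hq1 j) n)]
    ring
  · refine Summable.mul_left _ (((s1.mul_left _).mul_left _).add ?_)
    refine (s2.mul_left (y * (1 + y))).congr fun j => ?_
    ring
  · have t1 := (Complex.hasSum_ofReal.mpr (hb j)).mul_left (betaR q r : ℂ)
    have t2 := (Complex.hasSum_ofReal.mpr (hc j)).mul_left (hcoef q r j)
    refine ((t1.add t2).mul_left (sgnC q r : ℂ)).congr_fun fun n => ?_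
    push_cast
    ring

end

/-! ### The mean value as an integral -/

section
variable {q : ℝ}

/-- As `N → ∞`, the sum over `ν ≥ 0` becomes a two-sided sum, and the weight `1 - q^ν` tends
to `1`. -/
lemma tendsto_tsum_shift (h0 : 0 < q) (h1 : q < 1) {Φ : ℤ → ℝ} (hΦ : Summable Φ) :
    Tendsto (fun N : ℕ => ∑' ν : ℕ, (1 - q ^ ν) * Φ (ν - N)) atTop (𝓝 (∑' k : ℤ, Φ k)) := by
  have e : ∀ N : ℕ, ∑' ν : ℕ, (1 - q ^ ν) * Φ (ν - N) =
      ∑' k : ℤ, (if 0 ≤ k + N then 1 - q ^ (k + N).toNat else 0) * Φ k := fun N => by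
    have hinj : Function.Injective fun ν : ℕ => (ν : ℤ) - N := fun a b h => by
      simp only at h; omega
    rw [← hinj.tsum_eq]
    · refine tsum_congr fun ν => ?_
      rw [sub_add_cancel, if_pos (by omega), Int.toNat_natCast]
    · intro k hk
      by_contra hc
      refine hk ?_
      have : ¬ 0 ≤ k + N := fun h => hc ⟨(k + N).toNat, by simp only; omega⟩
      simp [this]
  simp_rw [e]
  have hw : ∀ n : ℕ, |1 - q ^ n| ≤ 1 := fun n => by
    have := pow_pos h0 n
    have := pow_le_one₀ (n := n) h0.le h1.le
    rw [abs_le]; constructor <;> linarith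
  refine tendsto_tsum_of_dominated_convergence hΦ.norm (fun k => ?_)
    (Eventually.of_forall fun N k => ?_)
  · have ht : Tendsto (fun N : ℕ => (k + N).toNat) atTop atTop := by
      refine tendsto_atTop.mpr fun b => ?_
      filter_upwards [eventually_ge_atTop (b + k.natAbs)] with N hN
      omega
    have h2 := ((tendsto_pow_atTop_nhds_zero_of_lt_one h0.le h1).comp ht).const_sub 1
    rw [sub_zero] at h2
    have h3 := h2.mul_const (Φ k)
    rw [one_mul] at h3
    refine h3.congr' ?_
    filter_upwards [eventually_ge_atTop k.natAbs] with N hN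
    rw [if_pos (by omega), Function.comp_apply]
  · rw [norm_mul]
    refine mul_le_of_le_one_left (norm_nonneg _) ?_
    split_ifs
    · exact hw _
    · simp

/-- The density `e^u / (1 + e^u)^2` in the variable `Y = e^u`. -/
def logis (Y : ℝ) : ℝ := Y / (1 + Y) ^ 2

lemma logis_nonneg {Y : ℝ} (hY : 0 ≤ Y) : 0 ≤ logis Y := by unfold logis; positivity

lemma logis_le_self {Y : ℝ} (hY : 0 ≤ Y) : logis Y ≤ Y :=
  div_le_self hY (one_le_pow₀ (by linarith))

lemma logis_le_inv {Y : ℝ} (hY : 0 < Y) : logis Y ≤ Y⁻¹ := by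
  unfold logis
  rw [div_le_iff₀ (by positivity), inv_mul_eq_div, le_div_iff₀ hY]
  nlinarith

lemma summable_logis (h0 : 0 < q) (h1 : q < 1) {Y : ℝ} (hY : 0 < Y) :
    Summable fun k : ℤ => logis (Y * q ^ k) := by
  refine Summable.of_nat_of_neg ?_ ?_
  · refine Summable.of_nonneg_of_le (fun n => logis_nonneg (by positivity))
      (fun n => logis_le_self (by positivity)) ?_
    simpa using (summable_geometric_of_lt_one h0.le h1).mul_left Y
  · refine Summable.of_nonneg_of_le (fun n => logis_nonneg (by positivity))
      (fun n => logis_le_inv (by positivity)) ?_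
    refine ((summable_geometric_of_lt_one h0.le h1).mul_left Y⁻¹).congr fun n => ?_
    rw [mul_inv, zpow_neg, inv_inv, zpow_natCast]

lemma genF_le_logis (h0 : 0 < q) (h1 : q < 1) (r : ℕ) {Y : ℝ} (hY : 0 ≤ Y) :
    genF q r Y ≤ (1 - q) * q⁻¹ ^ (r - 1) * logis Y := genF_le h0 h1 r hY

lemma summable_genF (h0 : 0 < q) (h1 : q < 1) (r : ℕ) {Y : ℝ} (hY : 0 < Y) :
    Summable fun k : ℤ => genF q r (Y * q ^ k) :=
  Summable.of_nonneg_of_le (fun _ => genF_nonneg h0 h1 r (by positivity))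
    (fun _ => genF_le_logis h0 h1 r (by positivity)) ((summable_logis h0 h1 hY).mul_left _)

/-- The limit of `tsum_genF_eq` along `y = Y q^(-N)`. -/
lemma tsum_genF_zpow (h0 : 0 < q) (h1 : q < 1) {r : ℕ} (hr : 1 ≤ r) {Y : ℝ} (hY : 0 < Y) :
    ((∑' k : ℤ, genF q r (Y * q ^ k) : ℝ) : ℂ) =
      (sgnC q r : ℂ) * ((betaR q r : ℂ) * ((∑' k : ℤ, logis (Y * q ^ k) : ℝ) : ℂ) + hW q r q) := by
  have hqn : ‖(q : ℂ)‖ < 1 := by rwa [Complex.norm_real, Real.norm_of_nonneg h0.le]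
  have e : ∀ N ν : ℕ, Y * q⁻¹ ^ N * q ^ ν = Y * q ^ ((ν : ℤ) - N) := fun N ν => by
    rw [zpow_sub₀ h0.ne', zpow_natCast, zpow_natCast, inv_pow]
    field_simp
  have t1 := tendsto_tsum_shift h0 h1 (summable_genF h0 h1 r hY)
  have t2 := tendsto_tsum_shift h0 h1 (summable_logis h0 h1 hY)
  have hh := hasSum_hcoef h0 h1 r hqn
  have t3 : Tendsto (fun N : ℕ => ∑' j : ℕ, hcoef q r j * (q : ℂ) ^ j *
      ((Y * q⁻¹ ^ N * q ^ j / (1 + Y * q⁻¹ ^ N * q ^ j) : ℝ) : ℂ)) atTop (𝓝 (hW q r q)) := by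
    rw [← hh.tsum_eq]
    refine tendsto_tsum_of_dominated_convergence hh.summable.norm (fun j => ?_)
      (Eventually.of_forall fun N j => ?_)
    · have a1 : Tendsto (fun N : ℕ => Y * q⁻¹ ^ N * q ^ j) atTop atTop :=
        ((tendsto_pow_atTop_atTop_of_one_lt ((one_lt_inv₀ h0).mpr h1)).const_mul_atTop
          hY).atTop_mul_const (by positivity)
      have a2 : Tendsto (fun X : ℝ => X / (1 + X)) atTop (𝓝 1) := by
        have : Tendsto (fun X : ℝ => 1 - (1 + X)⁻¹) atTop (𝓝 (1 - 0)) :=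
          (tendsto_inv_atTop_zero.comp (tendsto_atTop_add_const_left _ 1 tendsto_id)).const_sub 1
        rw [sub_zero] at this
        refine this.congr' ?_
        filter_upwards [eventually_gt_atTop 0] with X hX
        field_simp
        ring
      have a3 := (Complex.continuous_ofReal.tendsto 1).comp (a2.comp a1)
      simpa [Function.comp_def] using a3.const_mul (hcoef q r j * (q : ℂ) ^ j)
    · rw [norm_mul]
      refine mul_le_of_le_one_right (norm_nonneg _) ?_
      rw [Complex.norm_real, Real.norm_of_nonneg (by positivity), div_le_one (by positivity)]
      linarith
  have l1 := (Complex.continuous_ofReal.tendsto _).comp t1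
  have l2 := ((((Complex.continuous_ofReal.tendsto _).comp t2).const_mul
    (betaR q r : ℂ)).add t3).const_mul (sgnC q r : ℂ)
  refine tendsto_nhds_unique l1 (l2.congr fun N => ?_)
  have h := tsum_genF_eq h0 h1 hr (y := Y * q⁻¹ ^ N) (by positivity)
  simp only [Function.comp_apply]
  simp only [e] at h ⊢
  exact h.symm

lemma sgnC_ne_zero (h0 : 0 < q) (h1 : q < 1) (r : ℕ) : sgnC q r ≠ 0 := by
  have : 1 - q ≠ 0 := by linarith
  unfold sgnC
  have := h0.ne'
  positivity

lemma hW_im (h0 : 0 < q) (h1 : q < 1) {r : ℕ} (hr : 1 ≤ r) : (hW q r q).im = 0 := by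
  have h := congrArg Complex.im (tsum_genF_zpow h0 h1 hr one_pos)
  rw [Complex.ofReal_im, Complex.im_ofReal_mul, Complex.add_im, Complex.im_ofReal_mul,
    Complex.ofReal_im, mul_zero, zero_add] at h
  exact (mul_eq_zero.mp h.symm).resolve_left (sgnC_ne_zero h0 h1 r)

lemma tsum_genF_zpow_real (h0 : 0 < q) (h1 : q < 1) {r : ℕ} (hr : 1 ≤ r) {Y : ℝ} (hY : 0 < Y) :
    ∑' k : ℤ, genF q r (Y * q ^ k) =
      sgnC q r * (betaR q r * ∑' k : ℤ, logis (Y * q ^ k) + (hW q r q).re) := by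
  have h := congrArg Complex.re (tsum_genF_zpow h0 h1 hr hY)
  rwa [Complex.ofReal_re, Complex.re_ofReal_mul, Complex.add_re, Complex.re_ofReal_mul,
    Complex.ofReal_re] at h

lemma integrable_and_integral_eq_sub {f g : ℝ → ℝ} {m n : ℝ} (hf : Continuous f) (hf0 : ∀ x, 0 ≤ f x)
    (hg : ∀ x, HasDerivAt g (f x) x) (hm : Tendsto g atBot (𝓝 m)) (hn : Tendsto g atTop (𝓝 n)) :
    Integrable f ∧ ∫ x, f x = n - m := by
  have hi : Integrable f := by
    refine integrable_of_intervalIntegral_norm_tendsto (l := atTop) (a := fun i : ℕ => -(i : ℝ))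
      (b := fun i : ℕ => (i : ℝ)) (n - m) (fun i => hf.integrableOn_Ioc)
      (tendsto_neg_atTop_atBot.comp tendsto_natCast_atTop_atTop) tendsto_natCast_atTop_atTop ?_
    have e : ∀ i : ℕ, ∫ x in (-(i : ℝ))..i, ‖f x‖ = g i - g (-i) := fun i => by
      simp_rw [Real.norm_of_nonneg (hf0 _)]
      exact intervalIntegral.integral_eq_sub_of_hasDerivAt (fun x _ => hg x)
        (hf.intervalIntegrable _ _)
    simp_rw [e]
    exact (hn.comp tendsto_natCast_atTop_atTop).sub
      (hm.comp (tendsto_neg_atTop_atBot.comp tendsto_natCast_atTop_atTop))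
  exact ⟨hi, integral_of_hasDerivAt_of_tendsto hg hi hm hn⟩

lemma tendsto_one_add_exp_inv_pow (k : ℕ) (hk : k ≠ 0) :
    Tendsto (fun u : ℝ => ((1 + Real.exp u) ^ k)⁻¹) atTop (𝓝 0) :=
  tendsto_inv_atTop_zero.comp ((tendsto_pow_atTop hk).comp
    (tendsto_atTop_add_const_left _ 1 Real.tendsto_exp_atTop))

lemma tendsto_one_add_exp_atBot : Tendsto (fun u : ℝ => 1 + Real.exp u) atBot (𝓝 1) := by
  simpa using Real.tendsto_exp_atBot.const_add 1

lemma continuous_logis_exp : Continuous fun u : ℝ => logis (Real.exp u) := by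
  unfold logis
  exact Continuous.div (by fun_prop) (by fun_prop) fun u => by positivity

lemma integral_logis_exp : Integrable (fun u : ℝ => logis (Real.exp u)) ∧
    ∫ u : ℝ, logis (Real.exp u) = 1 := by
  have h := integrable_and_integral_eq_sub (f := fun u : ℝ => logis (Real.exp u))
    (g := fun u => -((1 + Real.exp u) ^ 1)⁻¹) (m := -1) (n := -0) continuous_logis_exp
    (fun u => logis_nonneg (Real.exp_pos u).le) (fun u => ?_) ?_
    (tendsto_one_add_exp_inv_pow 1 one_ne_zero).neg
  · simpa using h
  · have hne : (1 + Real.exp u) ≠ 0 := by positivity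
    have h := (((Real.hasDerivAt_exp u).const_add 1).inv hne).neg
    simp only [pow_one]
    refine h.congr_deriv ?_
    unfold logis
    ring
  · have := (tendsto_one_add_exp_atBot.inv₀ one_ne_zero).neg
    simpa using this

lemma measurable_genF_exp (h0 : 0 < q) (h1 : q < 1) (r : ℕ) :
    Measurable fun u : ℝ => genF q r (Real.exp u) := by
  have hk : Measurable fun u : ℝ => kap q (r - 1) (q * Real.exp u) :=
    Monotone.measurable fun a b hab => kap_mono h0 h1 _ (by positivity)
      (mul_le_mul_of_nonneg_left (Real.exp_le_exp.mpr hab) h0.le)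
  unfold genF
  fun_prop

lemma integrable_genF_exp (h0 : 0 < q) (h1 : q < 1) (r : ℕ) :
    Integrable fun u : ℝ => genF q r (Real.exp u) := by
  refine (integral_logis_exp.1.const_mul ((1 - q) * q⁻¹ ^ (r - 1))).mono'
    (measurable_genF_exp h0 h1 r).aestronglyMeasurable (Eventually.of_forall fun u => ?_)
  rw [Real.norm_of_nonneg (genF_nonneg h0 h1 r (Real.exp_pos u).le)]
  exact genF_le_logis h0 h1 r (Real.exp_pos u).le

lemma integral_tsum_comp_add_int {f : ℝ → ℝ} (hf : Integrable f) (h0 : ∀ x, 0 ≤ f x) :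
    ∫ x in (0 : ℝ)..1, ∑' n : ℤ, f (x + n) = ∫ x, f x := by
  have hs := hf.hasSum_intervalIntegral_comp_add_int
  have hi : ∀ n : ℤ, Integrable (fun x => f (x + n)) (volume.restrict (Set.Ioc 0 1)) := fun n =>
    (hf.comp_add_right (n : ℝ)).integrableOn
  have e : ∀ n : ℤ, ∫ x in (0 : ℝ)..1, f (x + n) = ∫ x in Set.Ioc 0 1, f (x + n) := fun n =>
    intervalIntegral.integral_of_le zero_le_one
  simp_rw [e] at hs
  have h := hasSum_integral_of_summable_integral_norm hi
    (by simpa only [Real.norm_of_nonneg (h0 _)] using hs.summable)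
  rw [intervalIntegral.integral_of_le zero_le_one]
  exact h.unique hs

lemma exp_mul_log_add_int (h0 : 0 < q) (x : ℝ) (n : ℤ) :
    Real.exp ((x + n) * Real.log q) = Real.exp (x * Real.log q) * q ^ n := by
  rw [add_mul, Real.exp_add, mul_comm (n : ℝ), ← Real.rpow_def_of_pos h0, Real.rpow_intCast]

lemma integral_comp_exp_mul_log (h0 : 0 < q) (h1 : q < 1) (f : ℝ → ℝ) :
    ∫ x : ℝ, f (Real.exp (x * Real.log q)) = (Real.log q⁻¹)⁻¹ * ∫ u : ℝ, f (Real.exp u) := by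
  rw [Measure.integral_comp_mul_right (fun u => f (Real.exp u)) (Real.log q), smul_eq_mul,
    abs_inv, abs_of_neg (Real.log_neg h0 h1), Real.log_inv]

/-- The coefficient of `n` in the asymptotics of the expectation, as an integral. -/
lemma const_eq_integral (h0 : 0 < q) (h1 : q < 1) {r : ℕ} (hr : 1 ≤ r) :
    sgnC q r * (betaR q r / Real.log q⁻¹ + (hW q r q).re) =
      (Real.log q⁻¹)⁻¹ * ∫ u : ℝ, genF q r (Real.exp u) := by
  have hlog : Real.log q ≠ 0 := (Real.log_neg h0 h1).ne
  have i1 : Integrable fun x : ℝ => genF q r (Real.exp (x * Real.log q)) :=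
    (integrable_genF_exp h0 h1 r).comp_mul_right' hlog
  have i2 : Integrable fun x : ℝ => logis (Real.exp (x * Real.log q)) :=
    integral_logis_exp.1.comp_mul_right' hlog
  have j1 := integral_tsum_comp_add_int i1 fun x => genF_nonneg h0 h1 r (Real.exp_pos _).le
  have j2 := integral_tsum_comp_add_int i2 fun x => logis_nonneg (Real.exp_pos _).le
  rw [integral_comp_exp_mul_log h0 h1] at j1 j2
  rw [integral_logis_exp.2, mul_one] at j2
  have hint : IntervalIntegrable (fun x : ℝ => ∑' n : ℤ, logis (Real.exp ((x + n) * Real.log q)))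
      volume 0 1 := by
    rw [intervalIntegrable_iff_integrableOn_Ioc_of_le zero_le_one]
    refine Integrable.of_integral_ne_zero ?_
    rw [← intervalIntegral.integral_of_le zero_le_one, j2]
    exact inv_ne_zero (log_inv_pos h0 h1).ne'
  simp only [exp_mul_log_add_int h0] at j1 j2 hint
  rw [← j1]
  have e : ∀ x : ℝ, ∑' n : ℤ, genF q r (Real.exp (x * Real.log q) * q ^ n) =
      sgnC q r * (betaR q r * ∑' n : ℤ, logis (Real.exp (x * Real.log q) * q ^ n) +
        (hW q r q).re) := fun x => tsum_genF_zpow_real h0 h1 hr (Real.exp_pos _)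
  simp_rw [e]
  rw [intervalIntegral.integral_const_mul, intervalIntegral.integral_add (hint.const_mul _)
    intervalIntegrable_const, intervalIntegral.integral_const_mul, j2]
  simp [div_eq_mul_inv]

/-! ### The limit of the mean value as `q → 1` -/

/-- An antiderivative of `e^u λ_s(e^u) / (1 + e^u)^3`. -/
def lamPrim : ℕ → ℝ → ℝ
  | 0, u => -(1 / 2) * ((1 + Real.exp u) ^ 2)⁻¹
  | s + 1, u => lamPrim s u / 2 - (1 / 2) * (((1 + Real.exp u) ^ 2)⁻¹ * lam (s + 1) (Real.exp u))

lemma hasDerivAt_lam_exp (s : ℕ) (u : ℝ) : HasDerivAt (fun u => lam (s + 1) (Real.exp u))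
    (lam s (Real.exp u) * (Real.exp u / (1 + Real.exp u))) u := by
  have hne : (1 + Real.exp u) ≠ 0 := by positivity
  have h := ((((Real.hasDerivAt_exp u).const_add 1).log hne).pow (s + 1)).div_const
    ((s + 1).factorial : ℝ)
  refine h.congr_deriv ?_
  unfold lam
  rw [Nat.factorial_succ]
  push_cast
  field_simp

lemma hasDerivAt_lamPrim (s : ℕ) (u : ℝ) : HasDerivAt (lamPrim s)
    (Real.exp u / (1 + Real.exp u) ^ 3 * lam s (Real.exp u)) u := by
  have hne : (1 + Real.exp u) ≠ 0 := by positivity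
  have hinv := (((Real.hasDerivAt_exp u).const_add 1).pow 2).inv (pow_ne_zero 2 hne)
  induction s with
  | zero =>
    refine (hinv.const_mul (-(1 / 2))).congr_deriv ?_
    simp [lam]
    field_simp
  | succ s ih =>
    refine ((ih.div_const 2).sub ((hinv.mul (hasDerivAt_lam_exp s u)).const_mul (1 / 2))).congr_deriv ?_
    simp
    field_simp
    ring

lemma tendsto_lamPrim_atTop (s : ℕ) : Tendsto (lamPrim s) atTop (𝓝 0) := by
  induction s with
  | zero =>
    have := (tendsto_one_add_exp_inv_pow 2 two_ne_zero).const_mul (-(1 / 2))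
    rw [mul_zero] at this
    exact this
  | succ s ih =>
    have h2 : Tendsto (fun u : ℝ => ((1 + Real.exp u) ^ 2)⁻¹ * lam (s + 1) (Real.exp u)) atTop
        (𝓝 0) := by
      refine squeeze_zero (fun u => mul_nonneg (by positivity) (lam_nonneg _ (Real.exp_pos u).le))
        (fun u => ?_) (tendsto_one_add_exp_inv_pow 1 one_ne_zero)
      refine (mul_le_mul_of_nonneg_left (lam_le (s + 1) (Real.exp_pos u).le)
        (by positivity)).trans (le_of_eq ?_)
      have hne : (1 + Real.exp u) ≠ 0 := by positivity
      field_simp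
    have h3 := (ih.div_const 2).sub (h2.const_mul (1 / 2))
    rw [zero_div, mul_zero, sub_zero] at h3
    exact h3

lemma tendsto_lamPrim_atBot (s : ℕ) : Tendsto (lamPrim s) atBot (𝓝 (-(1 / 2 ^ (s + 1)))) := by
  have h1 : Tendsto (fun u : ℝ => ((1 + Real.exp u) ^ 2)⁻¹) atBot (𝓝 1) := by
    simpa using (tendsto_one_add_exp_atBot.pow 2).inv₀ (by norm_num)
  induction s with
  | zero =>
    rw [show -(1 / 2 ^ (0 + 1) : ℝ) = -(1 / 2) * 1 by norm_num]
    exact h1.const_mul _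
  | succ s ih =>
    have h2 := (continuousAt_lam (s + 1) le_rfl).tendsto.comp Real.tendsto_exp_atBot
    rw [lam_succ_zero] at h2
    have h3 := (ih.div_const 2).sub ((h1.mul h2).const_mul (1 / 2))
    have e : -(1 / 2 ^ (s + 1)) / 2 - 1 / 2 * (1 * 0) = -(1 / 2 ^ (s + 1 + 1) : ℝ) := by ring
    rw [e] at h3
    exact h3

lemma integral_lam_exp (s : ℕ) :
    ∫ u : ℝ, Real.exp u / (1 + Real.exp u) ^ 3 * lam s (Real.exp u) = 1 / 2 ^ (s + 1) := by
  have h := (integrable_and_integral_eq_sub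
    (f := fun u : ℝ => Real.exp u / (1 + Real.exp u) ^ 3 * lam s (Real.exp u)) ?_
    (fun u => mul_nonneg (by positivity) (lam_nonneg s (Real.exp_pos u).le))
    (hasDerivAt_lamPrim s) (tendsto_lamPrim_atBot s) (tendsto_lamPrim_atTop s)).2
  · rw [h]; ring
  · refine Continuous.mul (Continuous.div (by fun_prop) (by fun_prop) fun u => by positivity) ?_
    refine continuous_iff_continuousAt.mpr fun u => ?_
    exact (continuousAt_lam s (Real.exp_pos u).le).comp Real.continuous_exp.continuousAt

lemma tendsto_one_sub_div_log :
    Tendsto (fun q : ℝ => (1 - q) / Real.log q⁻¹) (𝓝[<] 1) (𝓝 1) := by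
  have h := (hasDerivAt_iff_tendsto_slope.mp (Real.hasDerivAt_log one_ne_zero)).inv₀ (by norm_num)
  rw [inv_one, inv_one] at h
  refine (h.mono_left (nhdsWithin_mono _ fun x hx => ne_of_lt hx)).congr fun q => ?_
  rw [slope_def_field, Real.log_one, sub_zero, inv_div, Real.log_inv, ← neg_sub q 1, neg_div_neg_eq]

lemma tendsto_kap (s : ℕ) {Y : ℝ} (hY : 0 ≤ Y) :
    Tendsto (fun q : ℝ => kap q s (q * Y)) (𝓝[<] 1) (𝓝 (lam s Y)) := by
  have ev : ∀ᶠ q : ℝ in 𝓝[<] 1, 0 < q ∧ q < 1 :=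
    Ioo_mem_nhdsLT (show (0 : ℝ) < 1 by norm_num)
  have hid : Tendsto (fun q : ℝ => q) (𝓝[<] 1) (𝓝 1) := tendsto_id.mono_left nhdsWithin_le_nhds
  have hl := (continuousAt_lam s hY).tendsto
  have hlow : Tendsto (fun q : ℝ => lam s (q ^ s * (q * Y))) (𝓝[<] 1) (𝓝 (lam s Y)) := by
    refine hl.comp ?_
    simpa using (hid.pow s).mul (hid.mul_const Y)
  have hup : Tendsto (fun q : ℝ => q⁻¹ ^ s * lam s (q * Y)) (𝓝[<] 1) (𝓝 (lam s Y)) := by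
    have h2 : Tendsto (fun q : ℝ => lam s (q * Y)) (𝓝[<] 1) (𝓝 (lam s Y)) := by
      refine hl.comp ?_
      simpa using hid.mul_const Y
    simpa using ((hid.inv₀ one_ne_zero).pow s).mul h2
  refine tendsto_of_tendsto_of_tendsto_of_le_of_le' hlow hup ?_ ?_
  · filter_upwards [ev] with q hq
    exact lam_le_kap hq.1 hq.2 s (mul_nonneg hq.1.le hY)
  · filter_upwards [ev] with q hq
    exact kap_le_lam hq.1 hq.2 s (mul_nonneg hq.1.le hY)

/-- The mean value of `E_n / n` tends to `2^(-r)` as `q → 1`, because the iterated Riemann sum in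
`genF` converges to a power of the logarithm. -/
lemma tendsto_const {r : ℕ} (hr : 1 ≤ r) :
    Tendsto (fun q : ℝ => sgnC q r * (betaR q r / Real.log q⁻¹ + (hW q r q).re)) (𝓝[<] 1)
      (𝓝 (1 / 2 ^ r)) := by
  obtain ⟨s, rfl⟩ : ∃ s, r = s + 1 := ⟨r - 1, by omega⟩
  have ev : ∀ᶠ q : ℝ in 𝓝[<] 1, 1 / 2 < q ∧ q < 1 :=
    Ioo_mem_nhdsLT (show (1 / 2 : ℝ) < 1 by norm_num)
  have hid : Tendsto (fun q : ℝ => q) (𝓝[<] 1) (𝓝 1) := tendsto_id.mono_left nhdsWithin_le_nhds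
  rw [← integral_lam_exp s]
  have H : Tendsto (fun q : ℝ => ∫ u : ℝ, (Real.log q⁻¹)⁻¹ * genF q (s + 1) (Real.exp u)) (𝓝[<] 1)
      (𝓝 (∫ u : ℝ, Real.exp u / (1 + Real.exp u) ^ 3 * lam s (Real.exp u))) := by
    refine tendsto_integral_filter_of_dominated_convergence
      (fun u => 2 ^ s * logis (Real.exp u)) ?_ ?_ (integral_logis_exp.1.const_mul _) ?_
    · filter_upwards [ev] with q hq
      exact ((measurable_genF_exp (by linarith) hq.2 _).const_mul _).aestronglyMeasurable
    · filter_upwards [ev] with q hq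
      have h0 : 0 < q := by linarith [hq.1]
      refine Eventually.of_forall fun u => ?_
      have hL := log_inv_pos h0 hq.2
      have hY := Real.exp_pos u
      rw [Real.norm_of_nonneg (mul_nonneg (inv_nonneg.mpr hL.le) (genF_nonneg h0 hq.2 _ hY.le))]
      have h2 : (Real.log q⁻¹)⁻¹ * (1 - q) ≤ 1 := by
        rw [inv_mul_le_iff₀ hL, mul_one, Real.log_inv]
        linarith [Real.log_le_sub_one_of_pos h0]
      have h3 : q⁻¹ ≤ 2 := by
        rw [inv_le_comm₀ h0 two_pos]; linarith [hq.1]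
      have h4 : 0 ≤ (Real.log q⁻¹)⁻¹ * (1 - q) :=
        mul_nonneg (inv_nonneg.mpr hL.le) (by linarith [hq.2])
      have h5 := logis_nonneg hY.le
      calc _ ≤ (Real.log q⁻¹)⁻¹ * ((1 - q) * q⁻¹ ^ s * logis (Real.exp u)) :=
            mul_le_mul_of_nonneg_left (genF_le_logis h0 hq.2 _ hY.le) (inv_nonneg.mpr hL.le)
        _ = (Real.log q⁻¹)⁻¹ * (1 - q) * (q⁻¹ ^ s * logis (Real.exp u)) := by ring
        _ ≤ 1 * (2 ^ s * logis (Real.exp u)) := by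
            gcongr
        _ = _ := one_mul _
    · refine Eventually.of_forall fun u => ?_
      have hY := Real.exp_pos u
      have hne : 1 + 1 * Real.exp u ≠ 0 := by positivity
      have h1 := (tendsto_one_sub_div_log.mul_const (logis (Real.exp u))).mul
        ((tendsto_kap s hY.le).div ((hid.mul_const (Real.exp u)).const_add 1) hne)
      refine (h1.congr fun q => ?_).trans (le_of_eq ?_)
      · simp only [genF, logis, Nat.add_sub_cancel, Pi.div_apply]
        ring
      · congr 1
        unfold logis
        field_simp
  refine H.congr' ?_
  filter_upwards [ev] with q hq
  rw [const_eq_integral (by linarith [hq.1]) hq.2 hr, integral_const_mul]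

end

/-! ### The periodic part and its uniform decay as `q → 1` -/

/-- The periodic fluctuation of `E_n / n`, as a function of `log_Q n`. -/
def varpi (q : ℝ) (r : ℕ) (x : ℝ) : ℝ :=
  sgnC q r * betaR q r * (perSum q x - 1 / Real.log q⁻¹)

/-- The real limit of `ψ_r` at `1`. -/
def psiOne (q : ℝ) (r : ℕ) : ℝ := betaR q r / Real.log q⁻¹ + (hW q r q).re

section
variable {q : ℝ}

lemma ar_nonneg (h0 : 0 < q) (h1 : q < 1) (l : ℕ) : 0 ≤ ar q l :=
  div_nonneg (by positivity) (sub_nonneg.mpr (pow_le_one₀ h0.le h1.le))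

lemma mul_ar_le (h0 : 0 < q) (h1 : q < 1) (l : ℕ) : (1 - q) / q * ar q (l + 1) ≤ q ^ l := by
  have hp : 0 < 1 - q := by linarith
  have hl : q ^ (l + 1) ≤ q := by
    simpa using pow_le_pow_of_le_one h0.le h1.le (Nat.le_add_left 1 l)
  have hl' : 0 < 1 - q ^ (l + 1) := by linarith
  rw [ar, div_mul_div_comm, div_le_iff₀ (mul_pos h0 hl'), pow_succ]
  have : 0 ≤ q ^ l * q := by positivity
  rw [pow_succ] at hl
  nlinarith

lemma gr_nonneg (h0 : 0 < q) (h1 : q < 1) (s l : ℕ) : 0 ≤ gr q s l := by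
  induction s generalizing l with
  | zero => simp [gr]
  | succ s ih => exact Finset.sum_nonneg fun i _ => mul_nonneg (ar_nonneg h0 h1 i) (ih i)

lemma mul_gr_le (h0 : 0 < q) (h1 : q < 1) (s l : ℕ) :
    ((1 - q) / q) ^ s * gr q s l ≤ (1 - q)⁻¹ ^ s := by
  have hp : 0 < 1 - q := by linarith
  induction s generalizing l with
  | zero => simp [gr]
  | succ s ih =>
    have hsum : ∑ i ∈ Finset.range (l - 1), q ^ i ≤ (1 - q)⁻¹ :=
      sum_le_hasSum _ (fun i _ => by positivity) (hasSum_geometric_of_lt_one h0.le h1)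
    have e : Finset.Ioo 0 l = (Finset.range (l - 1)).map (addRightEmbedding 1) := by
      ext i
      simp only [Finset.mem_Ioo, Finset.mem_map, Finset.mem_range, addRightEmbedding_apply]
      constructor
      · rintro ⟨h, h'⟩; exact ⟨i - 1, by omega, by omega⟩
      · rintro ⟨j, hj, rfl⟩; omega
    rw [gr, e, Finset.sum_map, Finset.mul_sum]
    calc _ ≤ ∑ i ∈ Finset.range (l - 1), q ^ i * (1 - q)⁻¹ ^ s := by
          refine Finset.sum_le_sum fun i _ => ?_
          simp only [addRightEmbedding_apply]
          have h2 := mul_nonneg (pow_nonneg (div_pos hp h0).le s) (gr_nonneg h0 h1 s (i + 1))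
          calc _ = ((1 - q) / q * ar q (i + 1)) * (((1 - q) / q) ^ s * gr q s (i + 1)) := by ring
            _ ≤ _ := mul_le_mul (mul_ar_le h0 h1 i) (ih (i + 1)) h2 (by positivity)
      _ ≤ (1 - q)⁻¹ * (1 - q)⁻¹ ^ s := by
          rw [← Finset.sum_mul]
          gcongr
      _ = _ := by ring

lemma abs_sgnC_mul_betaR_le (h0 : 0 < q) (h1 : q < 1) {r : ℕ} (hr : 1 ≤ r) :
    |sgnC q r * betaR q r| ≤ (1 - q)⁻¹ ^ (r - 1) := by
  have hp : 0 < 1 - q := by linarith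
  have hc : 0 < (1 - q) / q := div_pos hp h0
  have hcc : (1 - q) / q * (q / (1 - q)) = 1 := by field_simp
  have ha : |sgnC q r| = ((1 - q) / q) ^ r := by
    rw [sgnC, abs_mul, abs_pow, abs_neg, abs_one, one_pow, one_mul, abs_of_pos (by positivity)]
  rw [abs_mul, ha]
  match r, hr with
  | 1, _ =>
    rw [betaR, abs_of_pos (div_pos h0 hp), pow_one, hcc]
    simp
  | s + 2, _ =>
    have hg := hasSum_geometric_of_lt_one h0.le h1
    have hnn : ∀ i : ℕ, 0 ≤ ar q (i + 1) * gr q s (i + 1) * q ^ (i + 1) := fun i =>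
      mul_nonneg (mul_nonneg (ar_nonneg h0 h1 _) (gr_nonneg h0 h1 _ _)) (by positivity)
    rw [betaR, abs_of_nonneg (mul_nonneg (by positivity) (tsum_nonneg hnn))]
    calc _ = ((1 - q) / q * (q / (1 - q))) * (((1 - q) / q) ^ (s + 1) *
          ∑' i : ℕ, ar q (i + 1) * gr q s (i + 1) * q ^ (i + 1)) := by ring
      _ = ∑' i : ℕ, ((1 - q) / q) ^ (s + 1) * (ar q (i + 1) * gr q s (i + 1) * q ^ (i + 1)) := by
          rw [hcc, one_mul, tsum_mul_left]
      _ ≤ (1 - q)⁻¹ ^ s * (1 - q)⁻¹ := by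
          refine Real.tsum_le_of_sum_le (fun i => mul_nonneg (by positivity) (hnn i)) fun t => ?_
          refine (Finset.sum_le_sum fun i _ => ?_).trans
            (sum_le_hasSum t (fun i _ => by positivity) (hg.mul_left ((1 - q)⁻¹ ^ s)))
          have h2 := mul_nonneg (pow_nonneg hc.le s) (gr_nonneg h0 h1 s (i + 1))
          calc _ = ((1 - q) / q * ar q (i + 1)) * (((1 - q) / q) ^ s * gr q s (i + 1)) *
                q ^ (i + 1) := by ring
            _ ≤ q ^ i * (1 - q)⁻¹ ^ s * 1 :=
                mul_le_mul (mul_le_mul (mul_ar_le h0 h1 i) (mul_gr_le h0 h1 s _) h2 (by positivity))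
                  (pow_le_one₀ h0.le h1.le) (by positivity) (by positivity)
            _ = _ := by ring
      _ = _ := by rw [show s + 2 - 1 = s + 1 by omega, pow_succ]

/-- The fluctuation is of order `p` uniformly: the factor `β_r` grows at most like `p^(1-r)`, while
the Fourier coefficients, values of the Gamma function far up a vertical line, are smaller than any
power of `L`. -/
lemma abs_varpi_le (h0 : 1 / 2 ≤ q) (h1 : q < 1) {r : ℕ} (hr : 1 ≤ r) (x : ℝ) :
    |varpi q r x| ≤ ((2 * (r + 1) + 1).factorial : ℝ) * 2 ^ r *
      (∑' k : {k : ℤ // k ≠ 0}, 1 / |((k : ℤ) : ℝ) ^ (r + 1)|) * (1 - q) := by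
  have hq : 0 < q := by linarith
  have hp : 0 < 1 - q := by linarith
  have hL := log_inv_pos hq h1
  have hL2 : Real.log q⁻¹ ≤ 2 * (1 - q) := by
    refine (Real.log_le_sub_one_of_pos (inv_pos.mpr hq)).trans ?_
    have : q⁻¹ - 1 = (1 - q) * q⁻¹ := by field_simp
    rw [this, mul_comm 2]
    refine mul_le_mul_of_nonneg_left ?_ hp.le
    rw [inv_le_comm₀ hq two_pos]; linarith
  have hb := abs_perSum_sub_le hq h1 (N := r + 1) (by omega) x
  set C := ∑' k : {k : ℤ // k ≠ 0}, 1 / |((k : ℤ) : ℝ) ^ (r + 1)|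
  have hC : 0 ≤ C := tsum_nonneg fun k => by positivity
  have e : ((2 * (r + 1) + 1).factorial : ℝ) * Real.log q⁻¹ ^ (r + 1) / Real.log q⁻¹ * C =
      (2 * (r + 1) + 1).factorial * C * Real.log q⁻¹ ^ r := by
    rw [pow_succ, ← mul_assoc, mul_div_assoc, div_self hL.ne']
    ring
  rw [e] at hb
  have hLr : Real.log q⁻¹ ^ r ≤ (2 * (1 - q)) ^ r := pow_le_pow_left₀ hL.le hL2 r
  rw [varpi, abs_mul]
  calc _ ≤ (1 - q)⁻¹ ^ (r - 1) * ((2 * (r + 1) + 1).factorial * C * (2 * (1 - q)) ^ r) := by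
        refine mul_le_mul (abs_sgnC_mul_betaR_le hq h1 hr) (hb.trans ?_) (abs_nonneg _)
          (by positivity)
        gcongr
    _ = _ := by
        obtain ⟨s, rfl⟩ : ∃ s, r = s + 1 := ⟨r - 1, by omega⟩
        rw [Nat.add_sub_cancel, mul_pow, pow_succ (1 - q), inv_pow]
        field_simp

lemma tendstoUniformly_varpi {r : ℕ} (hr : 1 ≤ r) :
    TendstoUniformly (fun q => varpi q r) (fun _ : ℝ => (0 : ℝ)) (𝓝[<] (1 : ℝ)) := by
  rw [Metric.tendstoUniformly_iff]
  intro ε hε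
  have hid : Tendsto (fun q : ℝ => q) (𝓝[<] 1) (𝓝 1) := tendsto_id.mono_left nhdsWithin_le_nhds
  have ht := (hid.const_sub 1).const_mul (((2 * (r + 1) + 1).factorial : ℝ) * 2 ^ r *
      (∑' k : {k : ℤ // k ≠ 0}, 1 / |((k : ℤ) : ℝ) ^ (r + 1)|))
  rw [sub_self, mul_zero] at ht
  filter_upwards [ht.eventually_lt_const hε,
    Ioo_mem_nhdsLT (show (1 / 2 : ℝ) < 1 by norm_num)] with q hq1 hq2 x
  rw [dist_zero_left, Real.norm_eq_abs]
  exact (abs_varpi_le hq2.1.le hq2.2 hr x).trans_lt hq1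

lemma continuous_varpi (h0 : 0 < q) (h1 : q < 1) (r : ℕ) : Continuous (varpi q r) :=
  ((continuous_perSum h0 h1).sub continuous_const).const_mul _

lemma varpi_add_one (q : ℝ) (r : ℕ) (x : ℝ) : varpi q r (x + 1) = varpi q r x := by
  rw [varpi, perSum_add_one, varpi]

/-- The Fourier series of the fluctuation, in terms of the residues of `ψ_r`. -/
lemma hasSum_varpi (h0 : 0 < q) (h1 : q < 1) (r : ℕ) (x : ℝ) :
    HasSum (fun k : {k : ℤ // k ≠ 0} => (-1 : ℂ) ^ (r - 1) * ((1 - (q : ℂ)) / (q : ℂ)) ^ r *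
        (beta q r * (polePt q k - 1) / ((Real.log q⁻¹ : ℝ) : ℂ)) *
        Complex.Gamma (-polePt q k) *
        Complex.exp (2 * (Real.pi : ℂ) * Complex.I * ((k : ℤ) : ℂ) * (x : ℂ)))
      (varpi q r x : ℂ) := by
  have h := (hasSum_perSum_sub h0 h1 x).mul_left ((sgnC q r : ℂ) * (betaR q r : ℂ))
  have e : (varpi q r x : ℂ) = (sgnC q r : ℂ) * (betaR q r : ℂ) *
      ((perSum q x - 1 / Real.log q⁻¹ : ℝ) : ℂ) := by
    rw [varpi, Complex.ofReal_mul, Complex.ofReal_mul]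
  rw [e]
  refine h.congr_fun fun k => ?_
  rw [Gamma_two_sub (polePt_ne_zero q k) (polePt_ne_one h0 h1 k.2), beta_eq_betaR h0 h1, sgnC]
  push_cast
  ring

lemma tendsto_psi_psiOne (h0 : 0 < q) (h1 : q < 1) {r : ℕ} (hr : 1 ≤ r) :
    Tendsto (psi q r) (𝓝[≠] (1 : ℂ)) (𝓝 (psiOne q r : ℂ)) := by
  have e : (psiOne q r : ℂ) = beta q r / ((Real.log q⁻¹ : ℝ) : ℂ) + hW q r q := by
    rw [beta_eq_betaR h0 h1, psiOne, Complex.ofReal_add, Complex.ofReal_div]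
    congr 1
    exact Complex.ext (by simp) (by simp [hW_im h0 h1 hr])
  rw [e]
  exact tendsto_psi_one h0 h1 r

lemma isLittleO_avgPos (h0 : 0 < q) (h1 : q < 1) {r : ℕ} (hr : 1 ≤ r) :
    (fun n : ℕ => avgPos q r n - (sgnC q r * psiOne q r * n + n * varpi q r (Real.logb q⁻¹ n)))
      =o[atTop] (fun n : ℕ => (n : ℝ)) := by
  have h := (Complex.continuous_re.tendsto _).comp (tendsto_avgPos_div h0 h1 hr)
  have hh : hW q r q = ((hW q r q).re : ℂ) := Complex.ext (by simp) (by simp [hW_im h0 h1 hr])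
  rw [isLittleO_iff_tendsto' (by
    filter_upwards [eventually_gt_atTop 0] with n hn h
    exact absurd h (by positivity))]
  have h2 := h.sub_const (sgnC q r * hW q r q).re
  rw [sub_self] at h2
  refine h2.congr' ?_
  filter_upwards [eventually_gt_atTop 0] with n hn
  have hn' : (n : ℝ) ≠ 0 := by positivity
  simp only [Function.comp_apply, Complex.sub_re, Complex.ofReal_re, Complex.re_ofReal_mul, psiOne,
    varpi]
  field_simp
  ring

end

/-! ### Random permutations -/

lemma isLTRMax_comp {α β : Type*} [LinearOrder α] [LinearOrder β] {n : ℕ} {f : α → β}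
    (hf : StrictMono f) (w : Fin n → α) : IsLTRMax (fun i => f (w i)) = IsLTRMax w := by
  funext i
  simp only [IsLTRMax, hf.lt_iff_lt]

/-- The statistic depends only on the relative order of the letters. -/
lemma lettersLeft_comp {α β : Type*} [LinearOrder α] [LinearOrder β] {n : ℕ} {f : α → β}
    (hf : StrictMono f) (r : ℕ) (w : Fin n → α) :
    lettersLeft r (fun i => f (w i)) = lettersLeft r w := by
  unfold lettersLeft IsRthFromRight
  rw [isLTRMax_comp hf w]

section Snoc
variable {α : Type*} [LinearOrder α] {n : ℕ}

lemma isLTRMax_snoc_castSucc (w : Fin n → α) (b : α) (i : Fin n) :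
    IsLTRMax (Fin.snoc w b : Fin (n + 1) → α) i.castSucc ↔ IsLTRMax w i := by
  simp only [IsLTRMax, Fin.forall_fin_succ', Fin.snoc_castSucc, Fin.snoc_last,
    Fin.castSucc_lt_castSucc_iff]
  constructor
  · exact fun h => h.1
  · exact fun h => ⟨h, fun h' => absurd h' (Fin.le_last _).not_gt⟩

lemma isLTRMax_snoc_last (w : Fin n → α) (b : α) :
    IsLTRMax (Fin.snoc w b : Fin (n + 1) → α) (Fin.last n) ↔ ∀ j, w j < b := by
  simp only [IsLTRMax, Fin.forall_fin_succ', Fin.snoc_castSucc, Fin.snoc_last,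
    Fin.castSucc_lt_last, forall_const, lt_irrefl, false_imp_iff, and_true]

open Classical in
lemma isRthFromRight_snoc_castSucc (r : ℕ) (w : Fin n → α) (b : α) (i : Fin n) :
    IsRthFromRight r (Fin.snoc w b : Fin (n + 1) → α) i.castSucc ↔ IsLTRMax w i ∧
      (Finset.univ.filter fun j : Fin n => i ≤ j ∧ IsLTRMax w j).card +
        (if ∀ j, w j < b then 1 else 0) = r := by
  rw [IsRthFromRight, isLTRMax_snoc_castSucc, Finset.card_filter, Finset.card_filter,
    Fin.sum_univ_castSucc]
  simp only [Fin.castSucc_le_castSucc_iff, isLTRMax_snoc_castSucc, isLTRMax_snoc_last, Fin.le_last,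
    true_and]

open Classical in
lemma isRthFromRight_snoc_last (r : ℕ) (w : Fin n → α) (b : α) :
    IsRthFromRight r (Fin.snoc w b : Fin (n + 1) → α) (Fin.last n) ↔ (∀ j, w j < b) ∧ 1 = r := by
  rw [IsRthFromRight, isLTRMax_snoc_last, Finset.card_filter, Fin.sum_univ_castSucc]
  simp only [Fin.last_le_iff, Fin.castSucc_ne_last, isLTRMax_snoc_last, le_refl, true_and,
    false_and, if_false, Finset.sum_const_zero, zero_add]
  constructor
  · rintro ⟨h, h'⟩; rw [if_pos h] at h'; exact ⟨h, h'⟩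
  · rintro ⟨h, h'⟩; rw [if_pos h]; exact ⟨h, h'⟩

lemma lettersLeft_zero (w : Fin n → α) : lettersLeft 0 w = 0 := by
  classical
  refine Finset.sum_eq_zero fun i hi => ?_
  have h := (Finset.mem_filter.mp hi).2
  have h2 := Finset.card_eq_zero.mp h.2
  exact absurd h2 (Finset.nonempty_iff_ne_empty.mp ⟨i, by simp [h.1]⟩)

lemma lettersLeft_snoc_of_not_forall (r : ℕ) {w : Fin n → α} {b : α} (h : ¬ ∀ j, w j < b) :
    lettersLeft r (Fin.snoc w b : Fin (n + 1) → α) = lettersLeft r w := by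
  classical
  simp only [lettersLeft, Finset.sum_filter, Fin.sum_univ_castSucc, isRthFromRight_snoc_castSucc,
    isRthFromRight_snoc_last, h, false_and, if_false, add_zero, Fin.val_castSucc]
  exact Finset.sum_congr rfl fun i _ => by unfold IsRthFromRight; congr

lemma lettersLeft_snoc_of_forall (s : ℕ) {w : Fin n → α} {b : α} (h : ∀ j, w j < b) :
    lettersLeft (s + 1) (Fin.snoc w b : Fin (n + 1) → α) =
      lettersLeft s w + if s = 0 then n else 0 := by
  classical
  simp only [lettersLeft, Finset.sum_filter, Fin.sum_univ_castSucc, isRthFromRight_snoc_castSucc,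
    isRthFromRight_snoc_last, h, implies_true, true_and, if_true, Fin.val_castSucc, Fin.val_last,
    Nat.add_right_cancel_iff]
  congr 1
  · exact Finset.sum_congr rfl fun i _ => by unfold IsRthFromRight; congr
  · exact if_congr (by omega) rfl rfl

end Snoc

/-- The permutation with last letter `j` whose other letters are in the same relative order as
those of `σ`. -/
def snocPerm {n : ℕ} (x : Fin (n + 1) × Equiv.Perm (Fin n)) : Equiv.Perm (Fin (n + 1)) :=
  Equiv.ofBijective (Fin.snoc (fun i => x.1.succAbove (x.2 i)) x.1 : Fin (n + 1) → Fin (n + 1)) <| by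
    rw [← Finite.injective_iff_bijective]
    intro a b
    refine Fin.lastCases ?_ (fun a => ?_) a <;> refine Fin.lastCases ?_ (fun b => ?_) b
    · simp
    · simp only [Fin.snoc_last, Fin.snoc_castSucc]
      exact fun h => absurd h.symm (Fin.succAbove_ne _ _)
    · simp only [Fin.snoc_last, Fin.snoc_castSucc]
      exact fun h => absurd h (Fin.succAbove_ne _ _)
    · simp

lemma snocPerm_apply {n : ℕ} (x : Fin (n + 1) × Equiv.Perm (Fin n)) :
    (fun i => snocPerm x i) =
      (Fin.snoc (fun i => x.1.succAbove (x.2 i)) x.1 : Fin (n + 1) → Fin (n + 1)) := rfl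

lemma bijective_snocPerm (n : ℕ) : Function.Bijective (snocPerm (n := n)) := by
  rw [Fintype.bijective_iff_injective_and_card]
  constructor
  · rintro ⟨j, σ⟩ ⟨j', σ'⟩ h
    have h' : ∀ i, snocPerm (j, σ) i = snocPerm (j', σ') i := fun i => by rw [h]
    have e : j = j' := by
      have := h' (Fin.last n)
      simpa [snocPerm] using this
    subst e
    have e2 : σ = σ' := by
      ext i
      have := h' i.castSucc
      simp only [snocPerm, Equiv.ofBijective_apply, Fin.snoc_castSucc] at this
      rw [Fin.succAbove_right_injective this]
    rw [e2]
  · simp [Fintype.card_perm, Nat.factorial_succ]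

/-- The sum over all permutations, multiplied out by the last letter: it is the largest letter for
one choice out of `n + 1`. -/
lemma sum_lettersLeft_succ (s n : ℕ) :
    ∑ σ : Equiv.Perm (Fin (n + 1)), (lettersLeft (s + 1) (fun i => σ i) : ℝ) =
      ∑ σ : Equiv.Perm (Fin n), ((lettersLeft s (fun i => σ i) : ℝ) + if s = 0 then (n : ℝ) else 0) +
      n * ∑ σ : Equiv.Perm (Fin n), (lettersLeft (s + 1) (fun i => σ i) : ℝ) := by
  rw [← (bijective_snocPerm n).sum_comp, Fintype.sum_prod_type, Fin.sum_univ_castSucc, add_comm]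
  congr 1
  · refine Finset.sum_congr rfl fun σ _ => ?_
    rw [snocPerm_apply, lettersLeft_snoc_of_forall]
    · simp only [Fin.succAbove_last, lettersLeft_comp Fin.strictMono_castSucc]
      split_ifs <;> simp
    · intro j
      simp only [Fin.succAbove_last]
      exact Fin.castSucc_lt_last _
  · have e : ∀ (j : Fin n) (σ : Equiv.Perm (Fin n)),
        lettersLeft (s + 1) (fun i => snocPerm (j.castSucc, σ) i) =
          lettersLeft (s + 1) (fun i => σ i) := fun j σ => by
      rw [snocPerm_apply, lettersLeft_snoc_of_not_forall]
      · exact lettersLeft_comp (Fin.strictMono_succAbove _) _ _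
      · -- the letter `j + 1` occurs among the others and is larger than `j`
        intro h
        have h2 := h (σ.symm j)
        simp only [Equiv.apply_symm_apply, Fin.succAbove_castSucc_self] at h2
        exact absurd h2 (Fin.castSucc_lt_succ).not_gt
    simp [e]

/-- Removing the last letter of a permutation of `n + 1` elements: with probability `1 / (n + 1)`
it is the largest, hence a left-to-right maximum, and `r = s + 1` drops to `s`; otherwise it plays
no role. -/
lemma permAvgPos_succ (s n : ℕ) :
    ((n : ℝ) + 1) * permAvgPos (s + 1) (n + 1) =
      (permAvgPos s n + if s = 0 then (n : ℝ) else 0) + n * permAvgPos (s + 1) n := by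
  have hf : (n.factorial : ℝ) ≠ 0 := by positivity
  have hn : (n : ℝ) + 1 ≠ 0 := by positivity
  rw [permAvgPos, sum_lettersLeft_succ, Finset.sum_add_distrib, Finset.sum_const, Finset.card_univ,
    Fintype.card_perm, Fintype.card_fin, nsmul_eq_mul, Nat.factorial_succ, permAvgPos, permAvgPos]
  push_cast
  field_simp

/-- The deviation of the expected position from `(n + 1) / 2^r`; it is set to `0` for `r = 0`. -/
def permDev (r n : ℕ) : ℝ :=
  if r = 0 then 0 else permAvgPos r n + 1 - ((n : ℝ) + 1) / 2 ^ r

lemma permAvgPos_zero_left (n : ℕ) : permAvgPos 0 n = 0 := by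
  simp [permAvgPos, lettersLeft_zero]

lemma permDev_succ (s n : ℕ) :
    ((n : ℝ) + 1) * permDev (s + 1) (n + 1) = permDev s n + n * permDev (s + 1) n := by
  have h := permAvgPos_succ s n
  have e : permDev s n = (permAvgPos s n + if s = 0 then (n : ℝ) else 0) + 1 -
      ((n : ℝ) + 1) / 2 ^ s := by
    unfold permDev
    split_ifs with hs
    · subst hs; rw [permAvgPos_zero_left]; simp
    · simp
  rw [e]
  simp only [permDev, Nat.succ_ne_zero, if_false]
  push_cast
  have h2 : ((n : ℝ) + 1) * (permAvgPos (s + 1) (n + 1) + 1 - ((n : ℝ) + 1 + 1) / 2 ^ (s + 1)) =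
      ((n : ℝ) + 1) * permAvgPos (s + 1) (n + 1) + ((n : ℝ) + 1) * (1 - (n + 2) / 2 ^ (s + 1)) := by
    ring
  rw [h2, h, pow_succ]
  field_simp
  ring

/-- The deviation for `r` is the Cesàro mean of the deviation for `r - 1`. -/
lemma mul_permDev (s n : ℕ) :
    (n : ℝ) * permDev (s + 1) n = ∑ i ∈ Finset.range n, permDev s i := by
  induction n with
  | zero => simp
  | succ n ih =>
    rw [Finset.sum_range_succ, ← ih]
    push_cast
    rw [permDev_succ]
    ring

lemma tendsto_permDev (r : ℕ) : Tendsto (permDev r) atTop (𝓝 0) := by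
  induction r with
  | zero =>
    have : permDev 0 = fun _ => 0 := by funext n; simp [permDev]
    rw [this]
    exact tendsto_const_nhds
  | succ s ih =>
    refine ih.cesaro.congr' ?_
    filter_upwards [eventually_gt_atTop 0] with n hn
    have : (n : ℝ) ≠ 0 := by positivity
    rw [← mul_permDev, inv_mul_cancel_left₀ this]

lemma tendsto_permAvgPos {r : ℕ} (hr : 1 ≤ r) :
    Tendsto (fun n : ℕ => permAvgPos r n + 1 - ((n : ℝ) + 1) / 2 ^ r) atTop (𝓝 0) := by
  have h := tendsto_permDev r
  have : permDev r = fun n : ℕ => permAvgPos r n + 1 - ((n : ℝ) + 1) / 2 ^ r := by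
    funext n
    simp only [permDev, if_neg (show r ≠ 0 by omega)]
  rwa [this] at h

lemma permAvgPos_one {n : ℕ} (hn : 1 ≤ n) : permAvgPos 1 n + 1 = ((n : ℝ) + 1) / 2 ^ 1 := by
  have h := mul_permDev 0 n
  have hn' : (n : ℝ) ≠ 0 := by positivity
  simp only [permDev, if_true, Finset.sum_const_zero] at h
  have h2 := (mul_eq_zero.mp h).resolve_left hn'
  simp only [zero_add, one_ne_zero, if_false] at h2
  linarith

lemma isLittleO_permAvgPos {r : ℕ} (hr : 1 ≤ r) :
    (fun n : ℕ => permAvgPos r n - (n : ℝ) / 2 ^ r) =o[atTop] (fun n : ℕ => (n : ℝ)) := by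
  have h1 : (fun n : ℕ => permAvgPos r n + 1 - ((n : ℝ) + 1) / 2 ^ r) =o[atTop]
      (fun n : ℕ => (n : ℝ)) :=
    (tendsto_permAvgPos hr).isBigO_one ℝ |>.trans_isLittleO
      (isLittleO_const_left.mpr (Or.inr (tendsto_norm_atTop_atTop.comp tendsto_natCast_atTop_atTop)))
  have h2 : (fun _ : ℕ => (1 - 1 / 2 ^ r : ℝ)) =o[atTop] (fun n : ℕ => (n : ℝ)) :=
    isLittleO_const_left.mpr (Or.inr (tendsto_norm_atTop_atTop.comp tendsto_natCast_atTop_atTop))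
  refine (h1.sub h2).congr_left fun n => ?_
  ring

/-! ### From words to permutations -/

/-- Summed over all rearrangements, a word with distinct letters gives the same as a
permutation. -/
lemma sum_lettersLeft_comp_perm {n : ℕ} (r : ℕ) {w : Fin n → ℕ} (hw : Function.Injective w) :
    ∑ σ : Equiv.Perm (Fin n), (lettersLeft r (fun i => w (σ i)) : ℝ) =
      ∑ σ : Equiv.Perm (Fin n), (lettersLeft r (fun i => σ i) : ℝ) := by
  have hm : StrictMono (w ∘ Tuple.sort w) :=
    (Tuple.monotone_sort w).strictMono_of_injective (hw.comp (Tuple.sort w).injective)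
  rw [← Equiv.sum_comp (Equiv.mulLeft (Tuple.sort w))]
  refine Finset.sum_congr rfl fun σ _ => ?_
  rw [← lettersLeft_comp hm]
  rfl

lemma lettersLeft_le {α : Type*} [LT α] {n : ℕ} (r : ℕ) (w : Fin n → α) :
    (lettersLeft r w : ℝ) ≤ (n : ℝ) ^ 2 := by
  classical
  have h : lettersLeft r w ≤ ∑ i : Fin n, n :=
    (Finset.sum_le_sum_of_subset (Finset.filter_subset _ _)).trans
      (Finset.sum_le_sum fun i _ => i.2.le)
  rw [Finset.sum_const, Finset.card_univ, Fintype.card_fin, smul_eq_mul, ← sq] at h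
  exact_mod_cast h

section
variable {q : ℝ}

lemma integral_wordLaw_comp_perm (h0 : 0 < q) (h1 : q < 1) {n : ℕ} (σ : Equiv.Perm (Fin n))
    (F : (Fin n → ℕ) → ℝ) :
    ∫ w, F (fun i => w (σ i)) ∂(wordLaw q n) = ∫ w, F w ∂(wordLaw q n) := by
  have := isProbabilityMeasure_letterLaw h0 h1
  have h := (measurePreserving_piCongrLeft (fun _ : Fin n => letterLaw q) σ.symm).integral_comp' F
  refine Eq.trans ?_ h
  unfold wordLaw
  congr 1
  ext w
  congr 1
  ext i
  have := Equiv.piCongrLeft_apply_apply (fun _ : Fin n => ℕ) σ.symm w (σ i)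
  rw [Equiv.symm_apply_apply] at this
  exact this.symm

open Classical in
/-- The probability that a random word has a repeated letter. -/
def repProb (q : ℝ) (n : ℕ) : ℝ :=
  ∫ w, (if Function.Injective w then 0 else 1 : ℝ) ∂(wordLaw q n)

lemma integral_letterLaw_eq_le (h0 : 0 < q) (h1 : q < 1) (c : ℕ) :
    ∫ b, (if b = c then 1 else 0 : ℝ) ∂(letterLaw q) ≤ 1 - q := by
  have h := hasSum_integral_letterLaw h0 h1 (f := fun b => if b = c then (1 : ℝ) else 0)
    fun b => abs_ite_le_one _
  rw [← h.tsum_eq, tsum_eq_single (c - 1)]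
  · have : q ^ (c - 1) ≤ 1 := pow_le_one₀ h0.le h1.le
    split_ifs
    · nlinarith
    · rw [mul_zero]; linarith
  · intro b hb
    rw [if_neg (by omega), mul_zero]

open Classical in
/-- The new letter equals one of the `n` old ones, each with probability at most `p`. -/
lemma repProb_succ_le (h0 : 0 < q) (h1 : q < 1) (n : ℕ) :
    repProb q (n + 1) ≤ repProb q n + n * (1 - q) := by
  have := isProbabilityMeasure_letterLaw h0 h1
  have := isProbabilityMeasure_wordLaw h0 h1 n
  have hb : ∀ {m : ℕ} (w : Fin m → ℕ), |(if Function.Injective w then 0 else 1 : ℝ)| ≤ 1 :=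
    fun w => by split_ifs <;> simp
  have hite : ∀ (c b : ℕ), |(if b = c then 1 else 0 : ℝ)| ≤ 1 := fun c b => abs_ite_le_one _
  have hbound : ∀ w : Fin n → ℕ,
      ∫ b, (if Function.Injective (Fin.cons b w : Fin (n + 1) → ℕ) then 0 else 1 : ℝ) ∂(letterLaw q) ≤
        (if Function.Injective w then 0 else 1 : ℝ) + n * (1 - q) := fun w => by
    calc _ ≤ ∫ b, ((if Function.Injective w then 0 else 1 : ℝ) +
          ∑ i, (if b = w i then 1 else 0 : ℝ)) ∂(letterLaw q) := by
          refine integral_mono (integrable_letterLaw h0 h1 fun b => hb _)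
            ((integrable_const _).add (integrable_finsetSum _ fun i _ =>
              integrable_letterLaw h0 h1 (hite (w i)))) fun b => ?_
          simp only [Fin.cons_injective_iff]
          by_cases hw : Function.Injective w
          · by_cases hbw : b ∈ Set.range w
            · obtain ⟨i, rfl⟩ := hbw
              have := Finset.single_le_sum (f := fun j => (if w i = w j then 1 else 0 : ℝ))
                (fun j _ => by split_ifs <;> norm_num) (Finset.mem_univ i)
              simp only [if_true] at this
              simpa [hw] using this
            · simp [hw, hbw]
          · simp [hw]
      _ = (if Function.Injective w then 0 else 1 : ℝ) +
          ∑ i, ∫ b, (if b = w i then 1 else 0 : ℝ) ∂(letterLaw q) := by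
          rw [integral_add (integrable_const _) (integrable_finsetSum _ fun i _ =>
              integrable_letterLaw h0 h1 (hite (w i))), integral_finsetSum _ fun i _ =>
              integrable_letterLaw h0 h1 (hite (w i))]
          simp
      _ ≤ _ := by
          gcongr
          refine (Finset.sum_le_sum fun i _ => integral_letterLaw_eq_le h0 h1 (w i)).trans ?_
          rw [Finset.sum_const, Finset.card_univ, Fintype.card_fin, nsmul_eq_mul]
  have hint : Integrable (fun w : Fin n → ℕ => ∫ b,
      (if Function.Injective (Fin.cons b w : Fin (n + 1) → ℕ) then 0 else 1 : ℝ) ∂(letterLaw q))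
      (wordLaw q n) := by
    refine integrable_wordLaw h0 h1 (C := 1) fun w => ?_
    have h := norm_integral_le_of_norm_le_const (μ := letterLaw q)
      (f := fun b => (if Function.Injective (Fin.cons b w : Fin (n + 1) → ℕ) then 0 else 1 : ℝ))
      (C := 1) (Eventually.of_forall fun b => hb _)
    simpa using h
  rw [repProb, integral_wordLaw_succ' h0 h1 hb]
  refine (integral_mono hint ((integrable_wordLaw h0 h1 hb).add (integrable_const _)) hbound).trans
    (le_of_eq ?_)
  rw [integral_add' (integrable_wordLaw h0 h1 hb) (integrable_const _)]
  simp [repProb]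

lemma repProb_le (h0 : 0 < q) (h1 : q < 1) (n : ℕ) : repProb q n ≤ (n : ℝ) ^ 2 * (1 - q) := by
  induction n with
  | zero => simp [repProb, Function.injective_of_subsingleton]
  | succ n ih =>
    refine (repProb_succ_le h0 h1 n).trans ?_
    push_cast
    nlinarith

lemma abs_avgPos_sub_permAvgPos_le (h0 : 0 < q) (h1 : q < 1) (r n : ℕ) :
    |avgPos q r n - permAvgPos r n| ≤ (n : ℝ) ^ 2 * ((n : ℝ) ^ 2 * (1 - q)) := by
  classical
  have := isProbabilityMeasure_wordLaw h0 h1 n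
  have hf : (0 : ℝ) < (n.factorial : ℝ) := by positivity
  have hb : ∀ (σ : Equiv.Perm (Fin n)) (w : Fin n → ℕ),
      |(lettersLeft r (fun i => w (σ i)) : ℝ)| ≤ (n : ℝ) ^ 2 := fun σ w => by
    rw [abs_of_nonneg (Nat.cast_nonneg _)]; exact lettersLeft_le r _
  have hint := fun σ => integrable_wordLaw h0 h1 (hb σ)
  have hmean : ∀ a : Equiv.Perm (Fin n) → ℝ, (∀ σ, 0 ≤ a σ ∧ a σ ≤ (n : ℝ) ^ 2) →
      0 ≤ (∑ σ, a σ) / n.factorial ∧ (∑ σ, a σ) / n.factorial ≤ (n : ℝ) ^ 2 := fun a ha => by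
    refine ⟨div_nonneg (Finset.sum_nonneg fun σ _ => (ha σ).1) hf.le, ?_⟩
    rw [div_le_iff₀ hf]
    refine (Finset.sum_le_sum fun σ _ => (ha σ).2).trans (le_of_eq ?_)
    rw [Finset.sum_const, Finset.card_univ, Fintype.card_perm, Fintype.card_fin, nsmul_eq_mul,
      mul_comm]
  -- averaging over all rearrangements of the word
  have e1 : avgPos q r n = ∫ w, (∑ σ : Equiv.Perm (Fin n), (lettersLeft r (fun i => w (σ i)) : ℝ)) /
      n.factorial ∂(wordLaw q n) := by
    rw [integral_div, integral_finsetSum _ fun σ _ => hint σ]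
    have e : ∀ σ : Equiv.Perm (Fin n), ∫ w, (lettersLeft r (fun i => w (σ i)) : ℝ) ∂(wordLaw q n) =
        avgPos q r n := fun σ =>
      integral_wordLaw_comp_perm h0 h1 σ fun w => (lettersLeft r w : ℝ)
    simp_rw [e]
    rw [Finset.sum_const, Finset.card_univ, Fintype.card_perm, Fintype.card_fin, nsmul_eq_mul]
    field_simp
  have e2 : permAvgPos r n = ∫ _, permAvgPos r n ∂(wordLaw q n) := by simp
  rw [e1, e2, ← integral_sub ((integrable_finsetSum _ fun σ _ => hint σ).div_const _)
    (integrable_const _)]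
  have hrep : ∀ w : Fin n → ℕ, |(if Function.Injective w then 0 else 1 : ℝ)| ≤ 1 :=
    fun w => by split_ifs <;> simp
  rw [← Real.norm_eq_abs]
  refine (norm_integral_le_of_norm_le
    ((integrable_wordLaw h0 h1 hrep).const_mul ((n : ℝ) ^ 2)) (Eventually.of_forall fun w => ?_)).trans ?_
  · by_cases hw : Function.Injective w
    · rw [sum_lettersLeft_comp_perm r hw, permAvgPos]
      simp [hw]
    · rw [if_neg hw, mul_one, Real.norm_eq_abs, permAvgPos]
      have a1 := hmean (fun σ => (lettersLeft r (fun i => w (σ i)) : ℝ)) fun σ =>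
        ⟨Nat.cast_nonneg _, lettersLeft_le r _⟩
      have a2 := hmean (fun σ => (lettersLeft r (fun i => σ i) : ℝ)) fun σ =>
        ⟨Nat.cast_nonneg _, lettersLeft_le r _⟩
      rw [abs_le]
      constructor <;> linarith [a1.1, a1.2, a2.1, a2.2]
  · rw [integral_const_mul]
    refine mul_le_mul_of_nonneg_left (le_trans (le_of_eq ?_) (repProb_le h0 h1 n)) (by positivity)
    rfl

lemma tendsto_avgPos_permAvgPos (r n : ℕ) :
    Tendsto (fun q : ℝ => avgPos q r n) (𝓝[<] (1 : ℝ)) (𝓝 (permAvgPos r n)) := by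
  have hid : Tendsto (fun q : ℝ => q) (𝓝[<] 1) (𝓝 1) := tendsto_id.mono_left nhdsWithin_le_nhds
  have ht := ((hid.const_sub 1).const_mul ((n : ℝ) ^ 2)).const_mul ((n : ℝ) ^ 2)
  rw [sub_self, mul_zero, mul_zero] at ht
  rw [tendsto_iff_norm_sub_tendsto_zero]
  refine squeeze_zero' (Eventually.of_forall fun q => norm_nonneg _) ?_ ht
  filter_upwards [Ioo_mem_nhdsLT (show (0 : ℝ) < 1 by norm_num)] with q hq
  exact abs_avgPos_sub_permAvgPos_le hq.1 hq.2 r n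

end

end GeomWords

end

theorem mainTheorem2 (r : ℕ) (hr : 1 ≤ r) :
    ∃ (ψ₁ : ℝ → ℝ) (ϖ : ℝ → ℝ → ℝ),
      (∀ q : ℝ, 0 < q → q < 1 →
        (∀ k : ℕ, 2 ≤ k → GeomWords.psi q r (k : ℂ) = GeomWords.psiSum q r k) ∧
        AnalyticOnNhd ℂ (GeomWords.psi q r) {z : ℂ | 1 < z.re} ∧
        Tendsto (GeomWords.psi q r) (𝓝[≠] (1 : ℂ)) (𝓝 (ψ₁ q : ℂ)) ∧
        Continuous (ϖ q) ∧
        Function.Periodic (ϖ q) 1 ∧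
        (∃ ρ : ℤ → ℂ,
          (∀ k : ℤ, k ≠ 0 →
            Tendsto (fun z : ℂ => (z - GeomWords.polePt q k) * GeomWords.psi q r z)
              (𝓝[≠] (GeomWords.polePt q k)) (𝓝 (ρ k))) ∧
          ∀ x : ℝ, HasSum (fun k : {k : ℤ // k ≠ 0} =>
            (-1 : ℂ) ^ (r - 1) * ((1 - (q : ℂ)) / (q : ℂ)) ^ r * ρ k
              * Complex.Gamma (-GeomWords.polePt q k)
              * Complex.exp (2 * (Real.pi : ℂ) * Complex.I * ((k : ℤ) : ℂ) * (x : ℂ)))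
            (ϖ q x : ℂ)) ∧
        (fun n : ℕ => GeomWords.avgPos q r n
            - ((-1 : ℝ) ^ (r - 1) * ((1 - q) / q) ^ r * ψ₁ q * (n : ℝ)
              + (n : ℝ) * ϖ q (Real.logb q⁻¹ (n : ℝ))))
          =o[atTop] (fun n : ℕ => (n : ℝ))) ∧
      Tendsto (fun q : ℝ => (-1 : ℝ) ^ (r - 1) * ((1 - q) / q) ^ r * ψ₁ q)
        (𝓝[<] (1 : ℝ)) (𝓝 (1 / 2 ^ r)) ∧
      TendstoUniformly ϖ (fun _ : ℝ => (0 : ℝ)) (𝓝[<] (1 : ℝ)) ∧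
      (∀ n : ℕ, Tendsto (fun q : ℝ => GeomWords.avgPos q r n)
        (𝓝[<] (1 : ℝ)) (𝓝 (GeomWords.permAvgPos r n))) ∧
      (fun n : ℕ => GeomWords.permAvgPos r n - (n : ℝ) / 2 ^ r)
        =o[atTop] (fun n : ℕ => (n : ℝ)) ∧
      Tendsto (fun n : ℕ => GeomWords.permAvgPos r n + 1 - ((n : ℝ) + 1) / 2 ^ r)
        atTop (𝓝 0) ∧
      (r = 1 → ∀ n : ℕ, 1 ≤ n → GeomWords.permAvgPos r n + 1 = ((n : ℝ) + 1) / 2 ^ r) := by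
  refine ⟨fun q => GeomWords.psiOne q r, fun q => GeomWords.varpi q r, fun q h0 h1 =>
    ⟨fun k hk => GeomWords.psi_eq_psiSum h0 h1 hr hk, GeomWords.analyticOnNhd_psi h0 h1 r,
      GeomWords.tendsto_psi_psiOne h0 h1 hr, GeomWords.continuous_varpi h0 h1 r,
      GeomWords.varpi_add_one q r, ⟨_, fun k _ => GeomWords.tendsto_residue h0 h1 r k,
        GeomWords.hasSum_varpi h0 h1 r⟩, GeomWords.isLittleO_avgPos h0 h1 hr⟩,
    GeomWords.tendsto_const hr, GeomWords.tendstoUniformly_varpi hr,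
    GeomWords.tendsto_avgPos_permAvgPos r, GeomWords.isLittleO_permAvgPos hr,
    GeomWords.tendsto_permAvgPos hr, ?_⟩
  rintro rfl n hn
  exact GeomWords.permAvgPos_one hn
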